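/- Work over $\mathbb C$. Let $S=(s_{ij})$ be a symmetric $3\times3$ matrix and $\boldsymbol t={}^t(t_1,t_2,t_3)$, regarded as coordinates of $\mathbb A(S,\boldsymbol t)\simeq\mathbb A^9$. Let $\boldsymbol p={}^t(p_1,p_2,p_3)$, $p_4$, $\boldsymbol q={}^t(q_1,q_2,q_3)$, $r,u$ be homogeneous coordinates of $\mathbb P^8$. For a vector $\boldsymbol v$ write $[\boldsymbol v]_\times=\begin{pmatrix}0&-v_3&v_2\\ v_3&0&-v_1\\ -v_2&v_1&0\end{pmatrix}$, put $A=[\boldsymbol q]_\times$, $B=[\boldsymbol t]_\times$, and let $S^\dagger$ be the adjoint (adjugate) matrix of $S$. Let $\widehat\Sigma^{13}\subset\mathbb A(S,\boldsymbol t)\times\mathbb P^8$ be the closed subscheme defined by the nine equations $$ {}^t\boldsymbol p\,\boldsymbol q=0,\quad (rI+AS)\boldsymbol p=-p_4A\boldsymbol t,\quad {}^t\boldsymbol pS\boldsymbol p+p_4\,{}^t\boldsymbol p\,\boldsymbol t=0,\quad u\boldsymbol p=(rI-AS)A\boldsymbol t,\quad up_4=-(r^2+{}^t\boldsymbol qS^\dagger\boldsymbol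 q),$$ and let $\rho_\Sigma:\widehat\Sigma^{13}\to\mathbb A(S,\boldsymbol t)$ be the projection. Notation. $\mathbb P^2\times\mathbb P^2\subset\mathbb P^8$ is Segre embedded. $\mathbb P^{2,2}\subset\mathbb P^8$ is the subscheme $\{M^\dagger=O,\ M\boldsymbol\sigma=\boldsymbol 0\}$, where the homogeneous coordinates are the entries of a symmetric $3\times 3$ matrix $M$ and of a vector $\boldsymbol\sigma={}^t(\sigma_1,\sigma_2,\sigma_3)$. $(\mathbb P^1\times\mathbb P^3)'$ is the cone, with vertex a point, over an irreducible hyperplane section of the Segre embedded $\mathbb P^1\times\mathbb P^3\subset\mathbb P^7$ (unique up to projective equivalence). $Q^n$ denotes an $n$-dimensional irreducible and reduced quadric, i.e. a subscheme projectively equivalent to the hypersurface of an irreducible quadratic form in $\mathbb P^{n+1}$ (different occurrences need not be isomorphic). Unions are scheme-theoretic, i.e. correspond to intersections of homogeneous ideals. A double $Q^4$ is a scheme defined by an ideal that is primary to the prime ideal of a $Q^4$ and has multiplicity $2$ at the generic point. Then for every $(S,\boldsymbol t)\in\mathbb A(S,\boldsymbol t)(\mathbb C)$ the scheme-theoretic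 fiber of $\rho_\Sigma$ over $(S,\boldsymbol t)$ is the closed subscheme of $\mathbb P^8$ defined by the nine equations for this $(S,\boldsymbol t)$, and it is, up to projective equivalence of it or of its components, as follows. 1. $S\neq O$, $\boldsymbol t\neq\boldsymbol 0$: - $\operatorname{rank}S=3$: if ${}^t\boldsymbol tS^\dagger\boldsymbol t\ne0$, then $\operatorname{rank}BSB=2$ and the fiber is $\mathbb P^2\times\mathbb P^2$; if ${}^t\boldsymbol tS^\dagger\boldsymbol t=0$, then $\operatorname{rank}BSB=1$ and the fiber is $\mathbb P^{2,2}$. - $\operatorname{rank}S=2$: if ${}^t\boldsymbol tS^\dagger\boldsymbol t\ne0$, then $\operatorname{rank}BSB=2$ and the fiber is $\mathbb P^2\times\mathbb P^2$; if ${}^t\boldsymbol tS^\dagger\boldsymbol t=0$, then either $\operatorname{rank}BSB=1$ and the fiber is $\mathbb P^{2,2}$, or $BSB=O$ and the fiber is $(\mathbb P^1\times\mathbb P^3)'\cup Q^4$. - $\operatorname{rank}S=1$: ${}^t\boldsymbol tS^\dagger\boldsymbol t=0$, and either $\operatorname{rank}BSB=1$ and the fiber is $\mathbb P^{2,2}$,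 or $BSB=O$ and the fiber is $(\mathbb P^1\times\mathbb P^3)'\cup Q^4$. 2. $S\neq O$, $\boldsymbol t=\boldsymbol 0$: the fiber is $(\mathbb P^1\times\mathbb P^3)'\cup Q^4$ if $\operatorname{rank}S=3$; $Q^4\cup Q^4\cup Q^4$ with three distinct quadrics if $\operatorname{rank}S=2$; and $Q^4\cup(\text{double }Q^4)$ with distinct supports if $\operatorname{rank}S=1$. 3. $S=O$, $\boldsymbol t\ne\boldsymbol 0$: the fiber is the union of a $(\mathbb P^1\times\mathbb P^3)'$ and a smooth $Q^4$. 4. $S=O$, $\boldsymbol t=\boldsymbol 0$: the fiber is the union of the $Q^5=\{r=u=p_1q_1+p_2q_2+p_3q_3=0\}$ and the $Q^4=\{p_1=p_2=p_3=r^2+p_4u=0\}$. In particular, the fiber over $(S,\boldsymbol t)$ is isomorphic over $\mathbb C$ to $\mathbb P^2\times\mathbb P^2$ if and only if ${}^t\boldsymbol tS^\dagger\boldsymbol t\ne0$, and is isomorphic over $\mathbb C$ to $\mathbb P^{2,2}$ if and only if ${}^t\boldsymbol tS^\dagger\boldsymbol t=0$ and $BSB\neq O$. -/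

import Mathlib

open MvPolynomial AlgebraicGeometry CategoryTheory CategoryTheory.Limits
open scoped Matrix

attribute [local instance] MvPolynomial.gradedAlgebra

noncomputable section

/-! ### Closed subschemes of projective space -/

section ProjectiveSubschemes

variable {R : Type} [CommRing R] {σ : Type}

/-- The degree-`n` part of the homogeneous coordinate ring `R[x_i : i ∈ σ] / I`. -/
def quotGrading (I : Ideal (MvPolynomial σ R)) (n : ℕ) : Submodule R (MvPolynomial σ R ⧸ I) :=
  (homogeneousSubmodule σ R n).map (Ideal.Quotient.mkₐ R I).toLinearMap

theorem mk_mem_quotGrading (I : Ideal (MvPolynomial σ R)) {n : ℕ} {f : MvPolynomial σ R}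
    (hf : f.IsHomogeneous n) : Ideal.Quotient.mk I f ∈ quotGrading I n :=
  ⟨f, hf, rfl⟩

theorem exists_of_mem_quotGrading {I : Ideal (MvPolynomial σ R)} {n : ℕ}
    {x : MvPolynomial σ R ⧸ I} (hx : x ∈ quotGrading I n) :
    ∃ f : MvPolynomial σ R, f.IsHomogeneous n ∧ Ideal.Quotient.mk I f = x :=
  hx

instance quotGrading_gradedMonoid (I : Ideal (MvPolynomial σ R)) :
    SetLike.GradedMonoid (quotGrading I) where
  one_mem := mk_mem_quotGrading I (isHomogeneous_one σ R)
  mul_mem := by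
    intro i j x y hx hy
    obtain ⟨f, hf, rfl⟩ := exists_of_mem_quotGrading hx
    obtain ⟨g, hg, rfl⟩ := exists_of_mem_quotGrading hy
    rw [← map_mul]
    exact mk_mem_quotGrading I (hf.mul hg)

theorem quotGrading_isInternal (I : HomogeneousIdeal (homogeneousSubmodule σ R)) :
    DirectSum.IsInternal (quotGrading I.toIdeal) := by
  classical
  constructor
  · rw [injective_iff_map_eq_zero]
    intro x hx
    choose f hf hfx using fun n => exists_of_mem_quotGrading (x n).2
    have hmem : (∑ n ∈ x.support, f n) ∈ I.toIdeal := by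
      rw [← Ideal.Quotient.eq_zero_iff_mem, map_sum]
      rw [DirectSum.coeAddMonoidHom_eq_dfinsuppSum, DFinsupp.sum] at hx
      simpa [hfx] using hx
    ext n
    by_cases hn : n ∈ x.support
    · have h := homogeneousComponent_mem_of_mem I.2 hmem n
      have h2 : homogeneousComponent n (∑ n ∈ x.support, f n) = f n := by
        rw [map_sum, Finset.sum_eq_single n]
        · exact homogeneousComponent_eq_self (hf n)
        · intro m _ hm
          rw [homogeneousComponent_of_mem (hf m), if_neg hm.symm]
        · exact fun h => absurd hn h
      rw [h2] at h
      rw [← hfx n, Ideal.Quotient.eq_zero_iff_mem.mpr h]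
      simp
    · rw [DFinsupp.notMem_support_iff.mp hn]
      simp
  · intro x
    obtain ⟨f, rfl⟩ := Ideal.Quotient.mk_surjective x
    refine ⟨∑ n ∈ Finset.range (f.totalDegree + 1), DirectSum.of (fun n => quotGrading I.toIdeal n) n
      ⟨_, mk_mem_quotGrading I.toIdeal (homogeneousComponent_isHomogeneous n f)⟩, ?_⟩
    rw [map_sum]
    simp only [DirectSum.coeAddMonoidHom_of]
    rw [← map_sum, sum_homogeneousComponent]

instance quotGrading_gradedAlgebra (I : HomogeneousIdeal (homogeneousSubmodule σ R)) :
    GradedAlgebra (quotGrading I.toIdeal) where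
  toGradedMonoid := quotGrading_gradedMonoid _
  toDecomposition := (quotGrading_isInternal I).chooseDecomposition

/-- The closed subscheme of the projective space over `Spec R` with homogeneous coordinates
indexed by `σ` which is cut out by the homogeneous ideal `I`: this is `Proj (R[x] / I)`. -/
def projScheme (I : HomogeneousIdeal (homogeneousSubmodule σ R)) : Scheme :=
  Proj (quotGrading I.toIdeal)

/-- The structure morphism to `Spec R`. -/
def projStructure (I : HomogeneousIdeal (homogeneousSubmodule σ R)) :
    projScheme I ⟶ Spec (.of R) :=
  Proj.toSpecZero (quotGrading I.toIdeal) ≫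
    Spec.map (CommRingCat.ofHom (algebraMap R (quotGrading I.toIdeal 0)))

/-- The closed subscheme cut out by `I`, as a scheme over `Spec R`. -/
def projOver (I : HomogeneousIdeal (homogeneousSubmodule σ R)) : Over (Spec (.of R)) :=
  Over.mk (projStructure I)

/-- A ring homomorphism `φ : R → R'` carrying the homogeneous ideal `I` into `I'` induces a
homomorphism of graded rings `R[x] / I → R'[x] / I'`. -/
def quotGradedMap {R' : Type} [CommRing R'] (φ : R →+* R')
    (I : HomogeneousIdeal (homogeneousSubmodule σ R))
    (I' : HomogeneousIdeal (homogeneousSubmodule σ R'))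
    (h : I.toIdeal ≤ I'.toIdeal.comap (MvPolynomial.map φ)) :
    GradedRingHom (quotGrading I.toIdeal) (quotGrading I'.toIdeal) where
  toRingHom := Ideal.quotientMap I'.toIdeal (MvPolynomial.map φ) h
  map_mem := by
    intro n x hx
    obtain ⟨f, hf, rfl⟩ := exists_of_mem_quotGrading hx
    exact mk_mem_quotGrading I'.toIdeal (hf.map φ)

theorem quotGradedMap_irrelevant {R' : Type} [CommRing R'] (φ : R →+* R')
    (I : HomogeneousIdeal (homogeneousSubmodule σ R))
    (I' : HomogeneousIdeal (homogeneousSubmodule σ R'))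
    (h : I.toIdeal ≤ I'.toIdeal.comap (MvPolynomial.map φ)) :
    HomogeneousIdeal.irrelevant (quotGrading I'.toIdeal) ≤
      (HomogeneousIdeal.irrelevant (quotGrading I.toIdeal)).map (quotGradedMap φ I I' h) := by
  rw [HomogeneousIdeal.irrelevant_le]
  intro n hn x hx
  obtain ⟨f, hf, rfl⟩ := exists_of_mem_quotGrading hx
  change Ideal.Quotient.mk I'.toIdeal f ∈
    Ideal.map (quotGradedMap φ I I' h) (HomogeneousIdeal.irrelevant (quotGrading I.toIdeal)).toIdeal
  rw [f.as_sum, map_sum]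
  refine Ideal.sum_mem _ fun m hm => ?_
  have hdeg : m.degree = n := by
    have := hf (mem_support_iff.mp hm)
    rwa [Finsupp.degree_eq_weight_one]
  have hmono : (monomial m (1 : R)).IsHomogeneous n := isHomogeneous_monomial _ hdeg
  have h1 : Ideal.Quotient.mk I.toIdeal (monomial m (1 : R)) ∈
      (HomogeneousIdeal.irrelevant (quotGrading I.toIdeal)).toIdeal :=
    HomogeneousIdeal.mem_irrelevant_of_mem _ hn (mk_mem_quotGrading I.toIdeal hmono)
  have h2 := Ideal.mem_map_of_mem (quotGradedMap φ I I' h) h1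
  have h3 : quotGradedMap φ I I' h (Ideal.Quotient.mk I.toIdeal (monomial m (1 : R))) =
      Ideal.Quotient.mk I'.toIdeal (monomial m (1 : R')) := by
    change Ideal.quotientMap I'.toIdeal (MvPolynomial.map φ) h _ = _
    simp
  rw [h3] at h2
  have h4 : monomial m (coeff m f) = C (coeff m f) * monomial m (1 : R') := by
    simp [C_mul_monomial]
  rw [h4, map_mul]
  exact Ideal.mul_mem_left _ _ h2

/-- The morphism of projective schemes which is the base change `R → R'` on coordinates. -/
def projBaseMap {R' : Type} [CommRing R'] (φ : R →+* R')
    (I : HomogeneousIdeal (homogeneousSubmodule σ R))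
    (I' : HomogeneousIdeal (homogeneousSubmodule σ R'))
    (h : I.toIdeal ≤ I'.toIdeal.comap (MvPolynomial.map φ)) :
    projScheme I' ⟶ projScheme I :=
  Proj.map (quotGradedMap φ I I' h) (quotGradedMap_irrelevant φ I I' h)

theorem span_isHomogeneous_of_forall (s : Set (MvPolynomial σ R))
    (h : ∀ f ∈ s, f.IsHomogeneous 2) :
    (Ideal.span s).IsHomogeneous (homogeneousSubmodule σ R) :=
  Ideal.homogeneous_span _ _ fun f hf => ⟨2, h f hf⟩

end ProjectiveSubschemes

/-! ### Matrices -/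

section Matrices

variable {R : Type} [CommRing R]

/-- The symmetric `3 × 3` matrix with entries `s_{ij}`, the coordinates `s_{ij} = s_{ji}` being
indexed by unordered pairs. -/
def symMat (s : Sym2 (Fin 3) → R) : Matrix (Fin 3) (Fin 3) R :=
  Matrix.of fun i j => s s(i, j)

/-- The skew-symmetric `3 × 3` matrix of a vector, for which `skewMat v *ᵥ w = v × w`. -/
def skewMat (v : Fin 3 → R) : Matrix (Fin 3) (Fin 3) R :=
  !![0, -v 2, v 1; v 2, 0, -v 0; -v 1, v 0, 0]

end Matrices

section MatrixHomogeneous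

variable {R : Type} [CommRing R] {σ : Type}

theorem dotProduct_isHomogeneous {a b : ℕ} {v w : Fin 3 → MvPolynomial σ R}
    (hv : ∀ i, (v i).IsHomogeneous a) (hw : ∀ i, (w i).IsHomogeneous b) :
    (v ⬝ᵥ w).IsHomogeneous (a + b) :=
  IsHomogeneous.sum _ _ _ fun i _ => (hv i).mul (hw i)

theorem mulVec_isHomogeneous {a b : ℕ} {M : Matrix (Fin 3) (Fin 3) (MvPolynomial σ R)}
    {w : Fin 3 → MvPolynomial σ R} (hM : ∀ i j, (M i j).IsHomogeneous a)
    (hw : ∀ i, (w i).IsHomogeneous b) (i : Fin 3) : ((M *ᵥ w) i).IsHomogeneous (a + b) :=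
  dotProduct_isHomogeneous (hM i) hw

theorem mul_isHomogeneous {a b : ℕ} {M N : Matrix (Fin 3) (Fin 3) (MvPolynomial σ R)}
    (hM : ∀ i j, (M i j).IsHomogeneous a) (hN : ∀ i j, (N i j).IsHomogeneous b) (i j : Fin 3) :
    ((M * N) i j).IsHomogeneous (a + b) := by
  rw [Matrix.mul_apply]
  exact IsHomogeneous.sum _ _ _ fun k _ => (hM i k).mul (hN k j)

theorem adjugate_isHomogeneous {a : ℕ} {M : Matrix (Fin 3) (Fin 3) (MvPolynomial σ R)}
    (hM : ∀ i j, (M i j).IsHomogeneous a) (i j : Fin 3) :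
    (M.adjugate i j).IsHomogeneous (a + a) := by
  have key : ∀ i₁ j₁ i₂ j₂ i₃ j₃ i₄ j₄ : Fin 3,
      (M i₁ j₁ * M i₂ j₂ - M i₃ j₃ * M i₄ j₄).IsHomogeneous (a + a) :=
    fun _ _ _ _ _ _ _ _ => ((hM _ _).mul (hM _ _)).sub ((hM _ _).mul (hM _ _))
  have key' : ∀ i₁ j₁ i₂ j₂ i₃ j₃ i₄ j₄ : Fin 3,
      (-(M i₁ j₁ * M i₂ j₂) + M i₃ j₃ * M i₄ j₄).IsHomogeneous (a + a) :=
    fun _ _ _ _ _ _ _ _ => ((hM _ _).mul (hM _ _)).neg.add ((hM _ _).mul (hM _ _))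
  rw [Matrix.adjugate_fin_three]
  fin_cases i <;> fin_cases j <;> simp [key, key']

theorem skewMat_isHomogeneous {a : ℕ} {v : Fin 3 → MvPolynomial σ R}
    (hv : ∀ i, (v i).IsHomogeneous a) (i j : Fin 3) : (skewMat v i j).IsHomogeneous a := by
  fin_cases i <;> fin_cases j <;>
    simp [skewMat, hv, isHomogeneous_zero, (hv _).neg]

end MatrixHomogeneous

/-! ### The family `Σ̂ → 𝔸(S, t)` -/

/-- The nine homogeneous coordinates `p₁, p₂, p₃, p₄, q₁, q₂, q₃, r, u`. -/
inductive KeyVar : Type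
  | p (i : Fin 3)
  | p4
  | q (i : Fin 3)
  | r
  | u

section Family

variable {R : Type} [CommRing R]

/-- The nine quadratic equations, over a ring `R` containing the entries of `S` and `t`:
`ᵗp q = 0`, `(r I + A S) p = - p₄ A t`, `ᵗp S p + p₄ ᵗp t = 0`, `u p = (r I - A S) A t`,
`u p₄ = - (r² + ᵗq S† q)`, where `A` is the skew-symmetric matrix of `q`. -/
def keyEqns (s : Sym2 (Fin 3) → R) (t : Fin 3 → R) : Set (MvPolynomial KeyVar R) :=
  let S : Matrix (Fin 3) (Fin 3) (MvPolynomial KeyVar R) := symMat fun e => C (s e)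
  let t' : Fin 3 → MvPolynomial KeyVar R := fun i => C (t i)
  let p : Fin 3 → MvPolynomial KeyVar R := fun i => X (KeyVar.p i)
  let q : Fin 3 → MvPolynomial KeyVar R := fun i => X (KeyVar.q i)
  let p4 : MvPolynomial KeyVar R := X KeyVar.p4
  let r : MvPolynomial KeyVar R := X KeyVar.r
  let u : MvPolynomial KeyVar R := X KeyVar.u
  let A := skewMat q
  {p ⬝ᵥ q} ∪
  Set.range ((r • (1 : Matrix (Fin 3) (Fin 3) (MvPolynomial KeyVar R)) + A * S) *ᵥ p +
    p4 • (A *ᵥ t')) ∪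
  {p ⬝ᵥ (S *ᵥ p) + p4 * (p ⬝ᵥ t')} ∪
  Set.range (u • p -
    (r • (1 : Matrix (Fin 3) (Fin 3) (MvPolynomial KeyVar R)) - A * S) *ᵥ (A *ᵥ t')) ∪
  {u * p4 + (r ^ 2 + q ⬝ᵥ (S.adjugate *ᵥ q))}

theorem keyEqns_isHomogeneous (s : Sym2 (Fin 3) → R) (t : Fin 3 → R)
    (f : MvPolynomial KeyVar R) (hf : f ∈ keyEqns s t) : f.IsHomogeneous 2 := by
  have hX : ∀ i : KeyVar, (X i : MvPolynomial KeyVar R).IsHomogeneous 1 := isHomogeneous_X R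
  have hS : ∀ i j, (symMat (fun e => (C (s e) : MvPolynomial KeyVar R)) i j).IsHomogeneous 0 :=
    fun i j => isHomogeneous_C KeyVar (s s(i, j))
  have ht : ∀ i, (C (t i) : MvPolynomial KeyVar R).IsHomogeneous 0 := fun i => isHomogeneous_C _ _
  have hA := skewMat_isHomogeneous (v := fun i => (X (KeyVar.q i) : MvPolynomial KeyVar R))
    (fun i => hX _)
  have hAS := mul_isHomogeneous (R := R) (σ := KeyVar) hA hS
  have hAt := mulVec_isHomogeneous hA ht
  have hI : ∀ i j : Fin 3, MvPolynomial.IsHomogeneous (((X KeyVar.r : MvPolynomial KeyVar R) •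
      (1 : Matrix (Fin 3) (Fin 3) (MvPolynomial KeyVar R))) i j) 1 := by
    intro i j
    by_cases h : i = j
    · simpa [h] using hX KeyVar.r
    · simpa [h] using isHomogeneous_zero KeyVar R 1
  rcases hf with (((hf | ⟨i, rfl⟩) | hf) | ⟨i, rfl⟩) | hf
  · rw [Set.mem_singleton_iff.mp hf]
    exact dotProduct_isHomogeneous (fun i => hX _) (fun i => hX _)
  · exact (mulVec_isHomogeneous (fun i j => (hI i j).add (hAS i j)) (fun j => hX _) i).add
      ((hX _).mul (hAt i))
  · rw [Set.mem_singleton_iff.mp hf]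
    have h1 := dotProduct_isHomogeneous (fun i => hX (KeyVar.p i))
      (mulVec_isHomogeneous hS (fun i => hX (KeyVar.p i)))
    have h2 := (hX KeyVar.p4).mul (dotProduct_isHomogeneous (fun i => hX (KeyVar.p i)) ht)
    exact h1.add h2
  · exact ((hX _).mul (hX _)).sub
      (mulVec_isHomogeneous (fun i j => (hI i j).sub (hAS i j)) hAt i)
  · rw [Set.mem_singleton_iff.mp hf]
    have h1 := (hX KeyVar.u).mul (hX KeyVar.p4)
    have h2 := (hX KeyVar.r).pow 2
    have h3 := dotProduct_isHomogeneous (fun i => hX (KeyVar.q i))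
      (mulVec_isHomogeneous (adjugate_isHomogeneous hS) (fun i => hX (KeyVar.q i)))
    exact h1.add (h2.add h3)

/-- The homogeneous ideal generated by the nine equations. -/
def keyIdeal (s : Sym2 (Fin 3) → R) (t : Fin 3 → R) :
    HomogeneousIdeal (homogeneousSubmodule KeyVar R) where
  toSubmodule := Ideal.span (keyEqns s t)
  is_homogeneous' := span_isHomogeneous_of_forall _ (keyEqns_isHomogeneous s t)

theorem keyIdeal_le_comap {R' : Type} [CommRing R'] (φ : R →+* R')
    (s : Sym2 (Fin 3) → R) (t : Fin 3 → R) (s' : Sym2 (Fin 3) → R') (t' : Fin 3 → R')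
    (hs : ∀ e, φ (s e) = s' e) (ht : ∀ i, φ (t i) = t' i) :
    (keyIdeal s t).toIdeal ≤ (keyIdeal s' t').toIdeal.comap (MvPolynomial.map φ) := by
  refine Ideal.span_le.mpr fun f hf => Ideal.subset_span ?_
  have hs' : s' = fun e => φ (s e) := funext fun e => (hs e).symm
  have ht' : t' = fun i => φ (t i) := funext fun i => (ht i).symm
  subst hs' ht'
  rcases hf with (((hf | ⟨i, rfl⟩) | hf) | ⟨i, rfl⟩) | hf
  · rw [Set.mem_singleton_iff.mp hf]
    refine Or.inl <| Or.inl <| Or.inl <| Or.inl <| Set.mem_singleton_iff.mpr ?_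
    simp [dotProduct, Fin.sum_univ_three]
  · refine Or.inl <| Or.inl <| Or.inl <| Or.inr <| ⟨i, ?_⟩
    fin_cases i <;> simp [dotProduct, Fin.sum_univ_three, Matrix.mulVec, symMat, skewMat,
      Matrix.one_apply, Matrix.vecHead, Matrix.vecTail]
  · rw [Set.mem_singleton_iff.mp hf]
    refine Or.inl <| Or.inl <| Or.inr <| Set.mem_singleton_iff.mpr ?_
    simp [dotProduct, Fin.sum_univ_three, Matrix.mulVec, symMat]
  · refine Or.inl <| Or.inr <| ⟨i, ?_⟩
    fin_cases i <;> simp [dotProduct, Fin.sum_univ_three, Matrix.mulVec, symMat, skewMat,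
      Matrix.one_apply, Matrix.vecHead, Matrix.vecTail]
  · rw [Set.mem_singleton_iff.mp hf]
    refine Or.inr <| Set.mem_singleton_iff.mpr ?_
    simp [dotProduct, Fin.sum_univ_three, Matrix.mulVec, symMat, Matrix.adjugate_fin_three]

/-- The coordinate ring `ℂ[s_{ij}, t_k]` of the affine space `𝔸(S, t) ≃ 𝔸⁹`. -/
abbrev BaseRing : Type := MvPolynomial (Sym2 (Fin 3) ⊕ Fin 3) ℂ

/-- The homogeneous ideal of `Σ̂` in `ℂ[S, t][p, p₄, q, r, u]`: here `S` and `t` consist of the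
coordinates of `𝔸(S, t)`. -/
def universalIdeal : HomogeneousIdeal (homogeneousSubmodule KeyVar BaseRing) :=
  keyIdeal (fun e => X (Sum.inl e)) (fun i => X (Sum.inr i))

/-- The closed subscheme `Σ̂` of `𝔸(S, t) × ℙ(p, p₄, q, r, u)`. -/
def SigmaHat : Scheme := projScheme universalIdeal

/-- The projection `ρ : Σ̂ → 𝔸(S, t)`. -/
def rhoSigma : SigmaHat ⟶ Spec (.of BaseRing) := projStructure universalIdeal

/-- Evaluation of polynomials in the entries of `S` and `t` at a complex point. -/
def evalBase (s : Sym2 (Fin 3) → ℂ) (t : Fin 3 → ℂ) : BaseRing →+* ℂ :=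
  MvPolynomial.eval (Sum.elim s t)

/-- The complex point `(S, t)` of `𝔸(S, t)`. -/
def basePoint (s : Sym2 (Fin 3) → ℂ) (t : Fin 3 → ℂ) : Spec (.of ℂ) ⟶ Spec (.of BaseRing) :=
  Spec.map (CommRingCat.ofHom (evalBase s t))

/-- The scheme-theoretic fibre of `ρ` over the point `(S, t)`, a scheme over `ℂ`. -/
def rhoFiber (s : Sym2 (Fin 3) → ℂ) (t : Fin 3 → ℂ) : Over (Spec (.of ℂ)) :=
  Over.mk (pullback.snd rhoSigma (basePoint s t))

theorem universalIdeal_le_comap (s : Sym2 (Fin 3) → ℂ) (t : Fin 3 → ℂ) :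
    universalIdeal.toIdeal ≤ (keyIdeal s t).toIdeal.comap (MvPolynomial.map (evalBase s t)) :=
  keyIdeal_le_comap _ _ _ _ _ (by simp [evalBase]) (by simp [evalBase])

/-- The inclusion in `Σ̂` of the closed subscheme of `{(S, t)} × ℙ⁸` cut out by the nine
equations with the given values of `S` and `t`. -/
def specialMap (s : Sym2 (Fin 3) → ℂ) (t : Fin 3 → ℂ) : projScheme (keyIdeal s t) ⟶ SigmaHat :=
  projBaseMap (evalBase s t) universalIdeal (keyIdeal s t) (universalIdeal_le_comap s t)

end Family

section Strata

/-- The number `ᵗt S† t`, where `S†` is the adjoint (adjugate) matrix of `S`. -/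
def tSt (s : Sym2 (Fin 3) → ℂ) (t : Fin 3 → ℂ) : ℂ :=
  t ⬝ᵥ ((symMat s).adjugate *ᵥ t)

/-- The matrix `B S B`, where `B` is the skew-symmetric matrix of `t`. -/
def matBSB (s : Sym2 (Fin 3) → ℂ) (t : Fin 3 → ℂ) : Matrix (Fin 3) (Fin 3) ℂ :=
  skewMat t * symMat s * skewMat t

end Strata

/-! ### The varieties occurring as fibres and as components of fibres -/

section Models

variable {σ τ : Type}

/-- Two closed subschemes of projective spaces, given by ideals, are projectively equivalent: their
homogeneous coordinate rings are isomorphic as graded `ℂ`-algebras. -/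
def ProjEquiv (I : Ideal (MvPolynomial σ ℂ)) (J : Ideal (MvPolynomial τ ℂ)) : Prop :=
  ∃ e : (MvPolynomial σ ℂ ⧸ I) ≃ₐ[ℂ] (MvPolynomial τ ℂ ⧸ J),
    ∀ n, (quotGrading I n).map e.toLinearMap = quotGrading J n

/-- The pull-back `n_{ij} ↦ x_i y_j` of coordinates under the Segre embedding
`ℙ^{a-1} × ℙ^{b-1} → ℙ^{ab-1}`. -/
def segreHom (a b : ℕ) : MvPolynomial (Fin a × Fin b) ℂ →ₐ[ℂ] MvPolynomial (Fin a ⊕ Fin b) ℂ :=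
  aeval fun ij => X (Sum.inl ij.1) * X (Sum.inr ij.2)

theorem segreHom_isHomogeneous (a b n : ℕ) (f : MvPolynomial (Fin a × Fin b) ℂ)
    (hf : f.IsHomogeneous n) : (segreHom a b f).IsHomogeneous (2 * n) :=
  hf.aeval _ fun _ => (isHomogeneous_X ℂ _).mul (isHomogeneous_X ℂ _)

/-- The homogeneous ideal of the Segre embedded `ℙ^{a-1} × ℙ^{b-1}` in `ℙ^{ab-1}`. -/
def segreIdeal (a b : ℕ) : HomogeneousIdeal (homogeneousSubmodule (Fin a × Fin b) ℂ) where
  toSubmodule := RingHom.ker (segreHom a b)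
  is_homogeneous' := by
    intro n f hf
    have hf' : segreHom a b f = 0 := hf
    change segreHom a b (DirectSum.decompose (homogeneousSubmodule (Fin a × Fin b) ℂ) f n) = 0
    have hcomp : ∀ k, (segreHom a b (homogeneousComponent k f)).IsHomogeneous (2 * k) :=
      fun k => segreHom_isHomogeneous a b k _ (homogeneousComponent_isHomogeneous k f)
    have hdec : (DirectSum.decompose (homogeneousSubmodule (Fin a × Fin b) ℂ) f n :
        MvPolynomial (Fin a × Fin b) ℂ) = homogeneousComponent n f :=
      decomposition.decompose'_apply f n
    rw [hdec]
    by_cases hn : n ∈ Finset.range (f.totalDegree + 1)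
    · have h1 : homogeneousComponent (2 * n)
          (segreHom a b (∑ k ∈ Finset.range (f.totalDegree + 1), homogeneousComponent k f)) = 0 := by
        rw [sum_homogeneousComponent, hf', map_zero]
      rw [map_sum, map_sum, Finset.sum_eq_single n] at h1
      · rwa [homogeneousComponent_eq_self (hcomp n)] at h1
      · intro k _ hk
        rw [homogeneousComponent_of_mem (hcomp k), if_neg (by omega)]
      · exact fun h => absurd hn h
    · rw [homogeneousComponent_eq_zero n f (by simpa using hn), map_zero]

/-- The equations `M† = 0`, `M σ = 0` for a symmetric `3 × 3` matrix `M` and a vector `σ`. -/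
def pTwoTwoEqns : Set (MvPolynomial (Sym2 (Fin 3) ⊕ Fin 3) ℂ) :=
  let M : Matrix (Fin 3) (Fin 3) (MvPolynomial (Sym2 (Fin 3) ⊕ Fin 3) ℂ) :=
    symMat fun e => X (Sum.inl e)
  let v : Fin 3 → MvPolynomial (Sym2 (Fin 3) ⊕ Fin 3) ℂ := fun i => X (Sum.inr i)
  Set.range (fun ij : Fin 3 × Fin 3 => M.adjugate ij.1 ij.2) ∪ Set.range (M *ᵥ v)

theorem pTwoTwoEqns_isHomogeneous (f : MvPolynomial (Sym2 (Fin 3) ⊕ Fin 3) ℂ)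
    (hf : f ∈ pTwoTwoEqns) : f.IsHomogeneous 2 := by
  have hX : ∀ i, (X i : MvPolynomial (Sym2 (Fin 3) ⊕ Fin 3) ℂ).IsHomogeneous 1 := isHomogeneous_X ℂ
  rcases hf with ⟨ij, rfl⟩ | ⟨i, rfl⟩
  · exact adjugate_isHomogeneous (fun i j => hX _) ij.1 ij.2
  · exact mulVec_isHomogeneous (fun i j => hX _) (fun j => hX _) i

/-- The homogeneous ideal of the singular sextic del Pezzo fourfold `ℙ^{2,2} ⊂ ℙ(M, σ) = ℙ⁸`. -/
def pTwoTwoIdeal : HomogeneousIdeal (homogeneousSubmodule (Sym2 (Fin 3) ⊕ Fin 3) ℂ) where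
  toSubmodule := Ideal.span pTwoTwoEqns
  is_homogeneous' := span_isHomogeneous_of_forall _ pTwoTwoEqns_isHomogeneous

/-- The ideal of `(ℙ¹ × ℙ³)' ⊂ ℙ⁸`: the cone, with vertex a point (the coordinate `none`), over
the hyperplane section `n₀₀ + n₁₁ = 0` of the Segre embedded `ℙ¹ × ℙ³ ⊂ ℙ⁷`. The linear forms on
`ℙ⁷` are the bilinear forms on `ℂ² × ℂ⁴`; those of rank two, which cut out the irreducible
(equivalently, smooth) hyperplane sections, are all equivalent to this one under `GL₂ × GL₄`. -/
def coneSegreSectionIdeal : Ideal (MvPolynomial (Option (Fin 2 × Fin 4)) ℂ) :=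
  (segreIdeal 2 4).toIdeal.map (rename some : MvPolynomial (Fin 2 × Fin 4) ℂ →ₐ[ℂ] _) ⊔
    Ideal.span {X (some (0, 0)) + X (some (1, 1))}

/-- The closed subscheme cut out by `J` is projectively equivalent to `(ℙ¹ × ℙ³)'`. -/
def IsConeSegreSection (J : Ideal (MvPolynomial σ ℂ)) : Prop :=
  ProjEquiv J coneSegreSectionIdeal

/-- The closed subscheme cut out by `J` is an (integral) `n`-dimensional quadric, that is,
projectively equivalent to the hypersurface of an irreducible quadratic form on `ℙ^{n+1}`. -/
def IsQuadric (n : ℕ) (J : Ideal (MvPolynomial σ ℂ)) : Prop :=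
  ∃ f : MvPolynomial (Fin (n + 2)) ℂ, f.IsHomogeneous 2 ∧ Irreducible f ∧
    ProjEquiv J (Ideal.span {f})

/-- The closed subscheme cut out by `J` is a smooth `n`-dimensional quadric. -/
def IsSmoothQuadric (n : ℕ) (J : Ideal (MvPolynomial σ ℂ)) : Prop :=
  ProjEquiv J (Ideal.span {(∑ i, X i ^ 2 : MvPolynomial (Fin (n + 2)) ℂ)})

/-- `D` defines a double structure on the integral subscheme defined by the prime ideal `J`: `D` is
`J`-primary, and its multiplicity at the generic point is two. -/
def IsDoubleStructure (D J : Ideal (MvPolynomial σ ℂ)) : Prop :=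
  ∃ _ : J.IsPrime, D.IsPrimary ∧ D.radical = J ∧
    Module.length (Localization.AtPrime J)
      (Localization.AtPrime J ⧸
        D.map (algebraMap (MvPolynomial σ ℂ) (Localization.AtPrime J))) = 2

/-- The closed subscheme cut out by `I` is projectively equivalent to `ℙ² × ℙ²`. -/
def IsP2P2 (I : Ideal (MvPolynomial σ ℂ)) : Prop :=
  ProjEquiv I (segreIdeal 3 3).toIdeal

/-- The closed subscheme cut out by `I` is projectively equivalent to `ℙ^{2,2}`. -/
def IsP22 (I : Ideal (MvPolynomial σ ℂ)) : Prop :=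
  ProjEquiv I pTwoTwoIdeal.toIdeal

/-- The closed subscheme cut out by `I` is the (scheme-theoretic) union of a `(ℙ¹ × ℙ³)'` and a
four-dimensional quadric. -/
def IsConeUnionQuadric (I : Ideal (MvPolynomial σ ℂ)) : Prop :=
  ∃ J₁ J₂ : Ideal (MvPolynomial σ ℂ), IsConeSegreSection J₁ ∧ IsQuadric 4 J₂ ∧ I = J₁ ⊓ J₂

end Models

end

/-!
The nine equations behave well under two kinds of linear changes of the homogeneous coordinates: a
congruence `S ↦ ᵗg S g`, `t ↦ ᵗg t` is absorbed by a substitution in `p` and `q`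
(`linEquivIdeal_of_congruent`), and a shift `S ↦ S + t ᵗw + w ᵗt` by one that mixes all
coordinates (`linEquivIdeal_of_shift`). Both preserve the rank of `B S B` and the vanishing of `ᵗt
S† t`. If `t ≠ 0` one may therefore take `t = e₀`, and the shift removes the first row and column
of `S`, so that only the rank of a binary quadratic form is left. If `t = 0` one may take `S` to
depend on its rank only. This makes seven normal forms (`exists_sameType_of_ne_zero`,
`exists_sameType_zero`).

For `t = e₀` and a binary form of rank two the equations are the `2 × 2` minors of a general `3 ×
3` matrix (`isP2P2_of_hyperbolic`); for a binary form of rank one they are the equations of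
`ℙ^{2,2}` (`isP22_of_square`). For `S = 0` and `t = 0` the two components are intersected directly
(`exists_decomposition_of_rank_zero`). In the other cases a linear form `x` multiplies the prime
ideal `J` of one component into the ideal `I` of the fibre without being in `J`, and then `I = J ⊓
(I + (x))` (`inf_sup_span_singleton_eq`). The residual ideal `I + (x)` is that of a cone over a
hyperplane section of `ℙ¹ × ℙ³`, or is split in the same way once more, or is the double
structure. The latter is the kernel of a homomorphism to the dual numbers over the coordinate ring
of a quadric (`keyIdeal_sup_eq_ker_doubleHom`), which shows that it is primary, and its local ring
at the generic point has a maximal ideal with one generator of square zero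
(`length_quotient_eq_two`). That the Segre ideal is generated by minors is proved by sorting
monomials (`segreIdeal_eq_segreMinors`).

The fibre as a scheme is identified chart by chart: on the chart where `X k` does not vanish, the
closed subscheme defined by `I` is the spectrum of `R[X] / (I + (X k - 1))` (`ker_awayEval`), and
this commutes with base change (`isPullback_projBaseMap`). Finally, `ℙ² × ℙ²`, `ℙ^{2,2}` and the
fibres with `B S B = 0` are not isomorphic to each other: the first is smooth, as its charts are
retracts of polynomial rings (`smooth_segreIdeal`); the second is not, as a tangent vector at a
point with `M = 0` does not extend to second order (`not_smooth_pTwoTwoIdeal`), but is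
irreducible, as its affine cone is the image of an affine space (`isPrime_radical_pTwoTwoIdeal`);
the third are reducible, as a product of two linear forms vanishes on them while neither factor
does (`not_preirreducibleSpace_of_rank_eq_zero`).
-/

noncomputable section

/-! ### The standard charts of a closed subscheme of projective space -/

section Charts

variable {R : Type} [CommRing R] {σ : Type}

theorem X_mem_quotGrading (I : Ideal (MvPolynomial σ R)) (k : σ) :
    Ideal.Quotient.mk I (X k) ∈ quotGrading I 1 :=
  mk_mem_quotGrading I (isHomogeneous_X R k)

/-- The coordinate ring of the chart `X k ≠ 0` of `projScheme I`. -/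
abbrev AwayRing (I : HomogeneousIdeal (homogeneousSubmodule σ R)) (k : σ) : Type :=
  HomogeneousLocalization.Away (quotGrading I.toIdeal) (Ideal.Quotient.mk I.toIdeal (X k))

/-- The dehomogenization of the ideal `I` at the coordinate `X k`, as an ideal of the polynomial
ring in all variables. -/
def dehomIdeal (I : HomogeneousIdeal (homogeneousSubmodule σ R)) (k : σ) :
    Ideal (MvPolynomial σ R) :=
  I.toIdeal ⊔ Ideal.span {X k - 1}

variable (I : HomogeneousIdeal (homogeneousSubmodule σ R)) (k : σ)

/-- The constants in the coordinate ring of a chart. -/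
def awayConst : R →+* AwayRing I k :=
  (HomogeneousLocalization.fromZeroRingHom _ _).comp (algebraMap R (quotGrading I.toIdeal 0))

/-- The function `X i / X k` on the chart `X k ≠ 0`. -/
def awayCoord (i : σ) : AwayRing I k :=
  HomogeneousLocalization.Away.mk _ (X_mem_quotGrading I.toIdeal k) 1
    (Ideal.Quotient.mk I.toIdeal (X i)) (by simpa using X_mem_quotGrading I.toIdeal i)

/-- Substitution of the functions `X i / X k` for the variables. -/
def awayEval : MvPolynomial σ R →+* AwayRing I k :=
  eval₂Hom (awayConst I k) (awayCoord I k)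

theorem val_awayEval {n : ℕ} {f : MvPolynomial σ R} (hf : f.IsHomogeneous n) :
    (awayEval I k f).val =
      Localization.mk (Ideal.Quotient.mk I.toIdeal f)
        (Submonoid.pow (Ideal.Quotient.mk I.toIdeal (X k)) n) := by
  classical
  set L := Localization.Away (Ideal.Quotient.mk I.toIdeal (X k))
  have h1 : (awayEval I k f).val = algebraMap (AwayRing I k) L (awayEval I k f) := rfl
  rw [h1]
  set c : L := Localization.mk 1 (Submonoid.pow (Ideal.Quotient.mk I.toIdeal (X k)) 1) with hc
  have hcoord : ∀ i, algebraMap (AwayRing I k) L (awayCoord I k i) =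
      algebraMap _ L (Ideal.Quotient.mk I.toIdeal (X i)) * c := by
    intro i
    rw [HomogeneousLocalization.algebraMap_apply, awayCoord, HomogeneousLocalization.Away.val_mk,
      hc, ← Localization.mk_one_eq_algebraMap, Localization.mk_mul, mul_one, one_mul]
    congr 1
  have hmono : ∀ m ∈ f.support, algebraMap (AwayRing I k) L
      (awayEval I k (monomial m (coeff m f))) =
      algebraMap _ L (Ideal.Quotient.mk I.toIdeal (monomial m (coeff m f))) * c ^ n := by
    intro m hm
    have hdeg : m.degree = n := by
      have := hf (mem_support_iff.mp hm)
      rwa [Finsupp.degree_eq_weight_one]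
    rw [awayEval, coe_eval₂Hom, eval₂_monomial, map_mul, Finsupp.prod, map_prod]
    simp only [map_pow, hcoord, mul_pow]
    rw [Finset.prod_mul_distrib, Finset.prod_pow_eq_pow_sum, monomial_eq, map_mul, map_mul,
      Finsupp.prod, map_prod, map_prod, ← hdeg, ← mul_assoc]
    simp only [map_pow]
    rfl
  have hsum : Ideal.Quotient.mk I.toIdeal f =
      ∑ m ∈ f.support, Ideal.Quotient.mk I.toIdeal (monomial m (coeff m f)) := by
    rw [← map_sum, ← f.as_sum]
  have hcn : c ^ n = Localization.mk 1 (Submonoid.pow (Ideal.Quotient.mk I.toIdeal (X k)) n) := by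
    rw [hc, Localization.mk_pow, one_pow]
    congr 1
    exact Subtype.ext (by simp [Submonoid.pow_coe])
  conv_lhs => rw [f.as_sum]
  rw [map_sum, map_sum, Finset.sum_congr rfl hmono, ← Finset.sum_mul, ← map_sum, ← map_sum,
    ← f.as_sum, hcn, ← Localization.mk_one_eq_algebraMap, Localization.mk_mul]
  simp

theorem awayEval_eq_mk {n : ℕ} {f : MvPolynomial σ R} (hf : f.IsHomogeneous n) :
    awayEval I k f = HomogeneousLocalization.Away.mk _ (X_mem_quotGrading I.toIdeal k) n
      (Ideal.Quotient.mk I.toIdeal f) (by simpa using mk_mem_quotGrading I.toIdeal hf) := by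
  apply HomogeneousLocalization.val_injective
  rw [val_awayEval I k hf, HomogeneousLocalization.Away.val_mk]
  rfl

theorem awayEval_surjective : Function.Surjective (awayEval I k) := by
  intro z
  obtain ⟨n, a, ha, rfl⟩ :=
    HomogeneousLocalization.Away.mk_surjective _ (X_mem_quotGrading I.toIdeal k) z
  obtain ⟨f, hf, rfl⟩ := exists_of_mem_quotGrading ha
  rw [smul_eq_mul, mul_one] at hf
  exact ⟨f, awayEval_eq_mk I k hf⟩

theorem awayEval_X_self : awayEval I k (X k) = 1 := by
  apply HomogeneousLocalization.val_injective
  rw [val_awayEval I k (isHomogeneous_X R k), HomogeneousLocalization.val_one,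
    ← Localization.mk_self (Submonoid.pow (Ideal.Quotient.mk I.toIdeal (X k)) 1)]
  congr 1
  simp [Submonoid.pow_coe]

theorem dehomIdeal_le_ker : dehomIdeal I k ≤ RingHom.ker (awayEval I k) := by
  refine sup_le (fun f hf => ?_) ?_
  · rw [RingHom.mem_ker, ← sum_homogeneousComponent f, map_sum]
    refine Finset.sum_eq_zero fun n _ => ?_
    apply HomogeneousLocalization.val_injective
    rw [val_awayEval I k (homogeneousComponent_isHomogeneous n f),
      Ideal.Quotient.eq_zero_iff_mem.mpr (homogeneousComponent_mem_of_mem I.2 hf n),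
      Localization.mk_zero, HomogeneousLocalization.val_zero]
  · rw [Ideal.span_singleton_le_iff_mem, RingHom.mem_ker, map_sub, awayEval_X_self, map_one,
      sub_self]

theorem le_dehomIdeal : I.toIdeal ≤ dehomIdeal I k := le_sup_left

theorem mk_dehomIdeal_X_self : Ideal.Quotient.mk (dehomIdeal I k) (X k) = 1 := by
  rw [← map_one (Ideal.Quotient.mk (dehomIdeal I k)), Ideal.Quotient.eq]
  exact Ideal.mem_sup_right (Ideal.mem_span_singleton_self _)

/-- Dehomogenization: the homomorphism from the coordinate ring of the chart `X k ≠ 0` which sends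
`X i / X k` to the class of `X i`. -/
def awayToDehom : AwayRing I k →+* MvPolynomial σ R ⧸ dehomIdeal I k :=
  (IsLocalization.Away.lift (S := Localization.Away (Ideal.Quotient.mk I.toIdeal (X k)))
    (Ideal.Quotient.mk I.toIdeal (X k))
    (g := Ideal.Quotient.factor (le_dehomIdeal I k)) (by
      rw [Ideal.Quotient.factor_mk, mk_dehomIdeal_X_self]
      exact isUnit_one)).comp
    (algebraMap (AwayRing I k) (Localization.Away (Ideal.Quotient.mk I.toIdeal (X k))))

theorem awayToDehom_awayEval (f : MvPolynomial σ R) :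
    awayToDehom I k (awayEval I k f) = Ideal.Quotient.mk _ f := by
  suffices h : (awayToDehom I k).comp (awayEval I k) = Ideal.Quotient.mk (dehomIdeal I k) from
    congr($h f)
  have key : ∀ {n : ℕ} {f : MvPolynomial σ R}, f.IsHomogeneous n →
      awayToDehom I k (awayEval I k f) = Ideal.Quotient.mk _ f := by
    intro n f hf
    rw [awayToDehom, RingHom.comp_apply, HomogeneousLocalization.algebraMap_apply,
      val_awayEval I k hf, Localization.mk_eq_mk', IsLocalization.Away.lift,
      IsLocalization.lift_mk'_spec]
    simp [mk_dehomIdeal_X_self]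
  refine MvPolynomial.ringHom_ext (fun a => key (isHomogeneous_C σ a))
    (fun i => key (isHomogeneous_X R i))

theorem ker_awayEval : RingHom.ker (awayEval I k) = dehomIdeal I k := by
  refine le_antisymm (fun f hf => ?_) (dehomIdeal_le_ker I k)
  rw [← Ideal.Quotient.eq_zero_iff_mem, ← awayToDehom_awayEval, hf, map_zero]

/-- The chart `X k ≠ 0` of `projScheme I`. -/
def projChart : Spec (.of (AwayRing I k)) ⟶ projScheme I :=
  Proj.awayι _ _ (X_mem_quotGrading I.toIdeal k) one_pos

instance : IsOpenImmersion (projChart I k) :=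
  inferInstanceAs (IsOpenImmersion (Proj.awayι _ _ _ _))

theorem projChart_projStructure :
    projChart I k ≫ projStructure I = Spec.map (CommRingCat.ofHom (awayConst I k)) := by
  refine (Proj.awayι_toSpecZero_assoc (quotGrading I.toIdeal) _
    (X_mem_quotGrading I.toIdeal k) one_pos _).trans ?_
  rw [← Spec.map_comp]
  rfl

theorem irrelevant_le_span_X :
    (HomogeneousIdeal.irrelevant (quotGrading I.toIdeal)).toIdeal ≤
      Ideal.span (Set.range fun i => Ideal.Quotient.mk I.toIdeal (X i)) := by
  rw [HomogeneousIdeal.toIdeal_irrelevant_le]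
  intro n hn x hx
  obtain ⟨f, hf, rfl⟩ := exists_of_mem_quotGrading hx
  rw [f.as_sum, map_sum]
  refine Ideal.sum_mem _ fun m hm => ?_
  have hdeg : m.degree = n := by
    have := hf (mem_support_iff.mp hm)
    rwa [Finsupp.degree_eq_weight_one]
  obtain ⟨i, hi⟩ : ∃ i, m i ≠ 0 := by
    by_contra! h
    have : m = 0 := Finsupp.ext h
    simp [this] at hdeg
    omega
  have hm' : m = (m - Finsupp.single i 1) + Finsupp.single i 1 :=
    (tsub_add_cancel_of_le (Finsupp.single_le_iff.mpr (Nat.one_le_iff_ne_zero.mpr hi))).symm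
  have : monomial m (coeff m f) = monomial (m - Finsupp.single i 1) (coeff m f) * X i := by
    rw [X, monomial_mul, mul_one, ← hm']
  rw [this, map_mul]
  exact Ideal.mul_mem_left _ _ (Ideal.subset_span ⟨i, rfl⟩)

/-- The standard affine charts cover `projScheme I`. -/
def projCover : (projScheme I).AffineOpenCover :=
  Proj.affineOpenCoverOfIrrelevantLESpan (quotGrading I.toIdeal)
    (fun i => Ideal.Quotient.mk I.toIdeal (X i)) (m := fun _ => 1)
    (X_mem_quotGrading I.toIdeal) (fun _ => one_pos) (irrelevant_le_span_X I)

end Charts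

/-! ### Base change -/

section BaseChange

/-- A variant of `Proj.awayι_comp_map` for an element `s'` which is only propositionally equal to
the image of `s`. -/
theorem awayι_comp_map_of_eq {A B σ τ : Type} [CommRing A] [SetLike σ A] [AddSubgroupClass σ A]
    [CommRing B] [SetLike τ B] [AddSubgroupClass τ B] {𝒜 : ℕ → σ} {ℬ : ℕ → τ} [GradedRing 𝒜]
    [GradedRing ℬ] (f : GradedRingHom 𝒜 ℬ)
    (hf : HomogeneousIdeal.irrelevant ℬ ≤ (HomogeneousIdeal.irrelevant 𝒜).map f)
    {i : ℕ} (hi : 0 < i) {s : A} (hs : s ∈ 𝒜 i) {s' : B} (hs' : s' ∈ ℬ i) (h : f s = s')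
    (g : HomogeneousLocalization.Away 𝒜 s →+* HomogeneousLocalization.Away ℬ s')
    (hg : ∀ n x hx, g (HomogeneousLocalization.Away.mk 𝒜 hs n x hx) =
      HomogeneousLocalization.Away.mk ℬ hs' n (f x) (f.2 hx)) :
    Proj.awayι ℬ s' hs' hi ≫ Proj.map f hf =
      Spec.map (CommRingCat.ofHom g) ≫ Proj.awayι 𝒜 s hs hi := by
  subst h
  have : g = HomogeneousLocalization.Away.map f s := by
    ext1 x
    obtain ⟨n, x, hx, rfl⟩ := HomogeneousLocalization.Away.mk_surjective 𝒜 hs x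
    rw [hg, HomogeneousLocalization.Away.map_mk]
  rw [this]
  exact Proj.awayι_comp_map f hf hi s hs

variable {R R' : Type} [CommRing R] [CommRing R'] {σ : Type} (φ : R →+* R')
  (I : HomogeneousIdeal (homogeneousSubmodule σ R))
  (I' : HomogeneousIdeal (homogeneousSubmodule σ R'))

/-- The homomorphism of coordinate rings of charts induced by base change. -/
def awayBaseMap (h : I.toIdeal ≤ I'.toIdeal.comap (MvPolynomial.map φ)) (k : σ) :
    AwayRing I k →+* AwayRing I' k :=
  (RingHom.liftOfSurjective (awayEval I k) (awayEval_surjective I k)) 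
    ⟨(awayEval I' k).comp (MvPolynomial.map φ), by
      rw [ker_awayEval]
      refine sup_le (fun f hf => ?_) ?_
      · rw [RingHom.mem_ker, RingHom.comp_apply]
        exact dehomIdeal_le_ker I' k (le_dehomIdeal I' k (h hf))
      · rw [Ideal.span_singleton_le_iff_mem, RingHom.mem_ker, RingHom.comp_apply, map_sub, map_X,
          map_one, map_sub, awayEval_X_self, map_one, sub_self]⟩

theorem awayBaseMap_awayEval (h : I.toIdeal ≤ I'.toIdeal.comap (MvPolynomial.map φ)) (k : σ)
    (f : MvPolynomial σ R) :
    awayBaseMap φ I I' h k (awayEval I k f) = awayEval I' k (MvPolynomial.map φ f) :=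
  RingHom.liftOfRightInverse_comp_apply _ _ _ _ _

theorem projChart_projBaseMap (h : I.toIdeal ≤ I'.toIdeal.comap (MvPolynomial.map φ)) (k : σ) :
    projChart I' k ≫ projBaseMap φ I I' h =
      Spec.map (CommRingCat.ofHom (awayBaseMap φ I I' h k)) ≫ projChart I k := by
  have hX : quotGradedMap φ I I' h (Ideal.Quotient.mk I.toIdeal (X k)) =
      Ideal.Quotient.mk I'.toIdeal (X k) := by
    change Ideal.quotientMap I'.toIdeal (MvPolynomial.map φ) h _ = _
    simp
  refine awayι_comp_map_of_eq (quotGradedMap φ I I' h) (quotGradedMap_irrelevant φ I I' h)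
    one_pos (X_mem_quotGrading I.toIdeal k) (X_mem_quotGrading I'.toIdeal k) hX _ ?_
  intro n x hx
  obtain ⟨f, hf, rfl⟩ := exists_of_mem_quotGrading hx
  rw [smul_eq_mul, mul_one] at hf
  have h1 := awayEval_eq_mk I k hf
  rw [← h1, awayBaseMap_awayEval, awayEval_eq_mk I' k (hf.map φ)]
  rfl

theorem isPushout_awayBaseMap (h : I.toIdeal ≤ I'.toIdeal.comap (MvPolynomial.map φ))
    (h' : I'.toIdeal ≤ I.toIdeal.map (MvPolynomial.map φ)) (k : σ) :
    IsPushout (CommRingCat.ofHom (awayConst I k)) (CommRingCat.ofHom φ)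
      (CommRingCat.ofHom (awayBaseMap φ I I' h k)) (CommRingCat.ofHom (awayConst I' k)) := by
  have hconst : ∀ a, awayConst I k a = awayEval I k (C a) := fun a => by simp [awayEval]
  have hconst' : ∀ a, awayConst I' k a = awayEval I' k (C a) := fun a => by simp [awayEval]
  have hd : dehomIdeal I' k ≤ (dehomIdeal I k).map (MvPolynomial.map φ) := by
    refine sup_le (h'.trans (Ideal.map_mono (le_dehomIdeal I k))) ?_
    rw [Ideal.span_singleton_le_iff_mem]
    have : X k - 1 = MvPolynomial.map φ (X k - 1 : MvPolynomial σ R) := by simp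
    rw [this]
    exact Ideal.mem_map_of_mem _ (Ideal.mem_sup_right (Ideal.mem_span_singleton_self _))
  have hcomp : ∀ s : PushoutCocone (CommRingCat.ofHom (awayConst I k)) (CommRingCat.ofHom φ),
      (eval₂Hom s.inr.hom (fun i => s.inl.hom (awayEval I k (X i)))).comp
        (MvPolynomial.map φ) = s.inl.hom.comp (awayEval I k) := by
    intro s
    refine MvPolynomial.ringHom_ext (fun a => ?_) fun i => ?_
    · have := congr($(s.condition).hom a)
      simp only [CommRingCat.hom_comp, CommRingCat.hom_ofHom, RingHom.comp_apply, hconst] at this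
      simp [this]
    · simp
  have hdesc : ∀ s : PushoutCocone (CommRingCat.ofHom (awayConst I k)) (CommRingCat.ofHom φ),
      ∃ d : AwayRing I' k →+* s.pt, ∀ f, d (awayEval I' k f) =
        eval₂Hom s.inr.hom (fun i => s.inl.hom (awayEval I k (X i))) f := by
    intro s
    refine ⟨RingHom.liftOfSurjective (awayEval I' k)
      (awayEval_surjective I' k) ⟨eval₂Hom s.inr.hom (fun i => s.inl.hom (awayEval I k (X i))), ?_⟩,
      fun f => RingHom.liftOfRightInverse_comp_apply _ _ _ _ _⟩
    rw [ker_awayEval]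
    refine hd.trans (Ideal.map_le_iff_le_comap.mpr fun f hf => ?_)
    rw [Ideal.mem_comap, RingHom.mem_ker, ← RingHom.comp_apply, hcomp s, RingHom.comp_apply,
      RingHom.mem_ker.mp (dehomIdeal_le_ker I k hf), map_zero]
  choose d hdev using hdesc
  refine ⟨⟨?_⟩, ⟨PushoutCocone.IsColimit.mk _ (fun s => CommRingCat.ofHom (d s)) ?_ ?_ ?_⟩⟩
  · ext a
    simp [hconst, hconst', awayBaseMap_awayEval]
  · intro s
    ext x
    obtain ⟨f, rfl⟩ := awayEval_surjective I k x
    simp only [CommRingCat.hom_comp, CommRingCat.hom_ofHom, RingHom.comp_apply,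
      awayBaseMap_awayEval, hdev]
    exact congr($(hcomp s) f)
  · intro s
    ext x
    simp only [CommRingCat.hom_comp, CommRingCat.hom_ofHom, RingHom.comp_apply, hconst', hdev]
    simp
  · intro s m hm1 hm2
    have : m.hom.comp (awayEval I' k) =
        eval₂Hom s.inr.hom (fun i => s.inl.hom (awayEval I k (X i))) := by
      refine MvPolynomial.ringHom_ext (fun a => ?_) fun i => ?_
      · rw [RingHom.comp_apply, ← hconst', ← hm2]
        simp
      · rw [← hm1]
        simp [awayBaseMap_awayEval]
    ext x
    obtain ⟨f, rfl⟩ := awayEval_surjective I' k x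
    rw [CommRingCat.hom_ofHom, hdev, ← this, RingHom.comp_apply]

theorem opensRange_projChart (k : σ) : (projChart I k).opensRange =
    Proj.basicOpen (quotGrading I.toIdeal) (Ideal.Quotient.mk I.toIdeal (X k)) :=
  Proj.opensRange_awayι _ _ _ _

theorem isPullback_awayBaseMap (h : I.toIdeal ≤ I'.toIdeal.comap (MvPolynomial.map φ)) (k : σ) :
    IsPullback (Spec.map (CommRingCat.ofHom (awayBaseMap φ I I' h k))) (projChart I' k)
      (projChart I k) (projBaseMap φ I I' h) := by
  refine IsOpenImmersion.isPullback _ _ _ _ (projChart_projBaseMap φ I I' h k) ?_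
  rw [opensRange_projChart, opensRange_projChart]
  refine (Proj.map_preimage_basicOpen _ _ _).trans ?_
  congr 1
  change Ideal.quotientMap I'.toIdeal (MvPolynomial.map φ) h _ = _
  simp

/-- The formation of closed subschemes of projective space commutes with base change. -/
theorem isPullback_projBaseMap (h : I.toIdeal ≤ I'.toIdeal.comap (MvPolynomial.map φ))
    (h' : I'.toIdeal ≤ I.toIdeal.map (MvPolynomial.map φ)) :
    IsPullback (projBaseMap φ I I' h) (projStructure I') (projStructure I)
      (Spec.map (CommRingCat.ofHom φ)) := by
  refine Scheme.isPullback_of_openCover _ _ _ _ (projCover I).openCover fun k => ?_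
  have key : ∀ k : σ, IsPullback (pullback.snd (projBaseMap φ I I' h) (projChart I k))
      (pullback.fst (projBaseMap φ I I' h) (projChart I k) ≫ projStructure I')
      (projChart I k ≫ projStructure I) (Spec.map (CommRingCat.ofHom φ)) := by
    intro k
    have h1 := isPullback_awayBaseMap φ I I' h k
    have h2 := AlgebraicGeometry.isPullback_SpecMap_of_isPushout _ _ _ _
      (isPushout_awayBaseMap φ I I' h h' k)
    rw [← projChart_projStructure I k, ← projChart_projStructure I' k] at h2
    refine h2.of_iso h1.flip.isoPullback (Iso.refl _) (Iso.refl _) (Iso.refl _) ?_ ?_ ?_ ?_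
    · simp
    · simp
    · simp
    · simp
  exact key k

end BaseChange

/-! ### Isomorphisms, smoothness and irreducibility of projective schemes -/

section ProjFunctor

variable {σ τ : Type} {I : HomogeneousIdeal (homogeneousSubmodule σ ℂ)}
  {J : HomogeneousIdeal (homogeneousSubmodule τ ℂ)}

/-- An isomorphism of homogeneous coordinate rings as a homomorphism of graded rings. -/
def gradedRingHomOfEquiv
    (e : (MvPolynomial σ ℂ ⧸ I.toIdeal) ≃ₐ[ℂ] (MvPolynomial τ ℂ ⧸ J.toIdeal))
    (he : ∀ n, (quotGrading I.toIdeal n).map e.toLinearMap = quotGrading J.toIdeal n) :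
    GradedRingHom (quotGrading I.toIdeal) (quotGrading J.toIdeal) where
  toRingHom := e
  map_mem := fun {n x} hx => by
    rw [← he n]
    exact Submodule.mem_map_of_mem (f := e.toLinearMap) hx

theorem irrelevant_le_map_gradedRingHomOfEquiv
    (e : (MvPolynomial σ ℂ ⧸ I.toIdeal) ≃ₐ[ℂ] (MvPolynomial τ ℂ ⧸ J.toIdeal))
    (he : ∀ n, (quotGrading I.toIdeal n).map e.toLinearMap = quotGrading J.toIdeal n) :
    HomogeneousIdeal.irrelevant (quotGrading J.toIdeal) ≤
      (HomogeneousIdeal.irrelevant (quotGrading I.toIdeal)).map (gradedRingHomOfEquiv e he) := by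
  rw [HomogeneousIdeal.irrelevant_le]
  intro n hn x hx
  rw [← he n] at hx
  obtain ⟨y, hy, rfl⟩ := hx
  exact Ideal.mem_map_of_mem (gradedRingHomOfEquiv e he)
    (HomogeneousIdeal.mem_irrelevant_of_mem _ hn hy)

theorem quotGrading_map_symm {I : Ideal (MvPolynomial σ ℂ)} {J : Ideal (MvPolynomial τ ℂ)}
    (e : (MvPolynomial σ ℂ ⧸ I) ≃ₐ[ℂ] (MvPolynomial τ ℂ ⧸ J))
    (he : ∀ n, (quotGrading I n).map e.toLinearMap = quotGrading J n) (n : ℕ) :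
    (quotGrading J n).map e.symm.toLinearMap = quotGrading I n := by
  rw [← he n, ← Submodule.map_comp]
  convert! Submodule.map_id _
  ext x
  simp

/-- The morphism of projective schemes given by an isomorphism of homogeneous coordinate rings. -/
def projMapOfEquiv
    (e : (MvPolynomial σ ℂ ⧸ I.toIdeal) ≃ₐ[ℂ] (MvPolynomial τ ℂ ⧸ J.toIdeal))
    (he : ∀ n, (quotGrading I.toIdeal n).map e.toLinearMap = quotGrading J.toIdeal n) :
    projScheme J ⟶ projScheme I :=
  Proj.map (gradedRingHomOfEquiv e he) (irrelevant_le_map_gradedRingHomOfEquiv e he)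

theorem projMapOfEquiv_comp_symm
    (e : (MvPolynomial σ ℂ ⧸ I.toIdeal) ≃ₐ[ℂ] (MvPolynomial τ ℂ ⧸ J.toIdeal))
    (he : ∀ n, (quotGrading I.toIdeal n).map e.toLinearMap = quotGrading J.toIdeal n) :
    projMapOfEquiv e he ≫ projMapOfEquiv e.symm (quotGrading_map_symm e he) =
      𝟙 (projScheme J) := by
  refine (Proj.map_comp _ _ _ _).symm.trans ?_
  refine Eq.trans ?_ Proj.map_id
  congr 1
  ext x
  exact e.apply_symm_apply x

theorem projMapOfEquiv_projStructure
    (e : (MvPolynomial σ ℂ ⧸ I.toIdeal) ≃ₐ[ℂ] (MvPolynomial τ ℂ ⧸ J.toIdeal))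
    (he : ∀ n, (quotGrading I.toIdeal n).map e.toLinearMap = quotGrading J.toIdeal n) :
    projMapOfEquiv e he ≫ projStructure I = projStructure J := by
  refine (Proj.mapAffineOpenCover _
    (irrelevant_le_map_gradedRingHomOfEquiv e he)).openCover.hom_ext _ _ fun s => ?_
  refine (Proj.awayι_comp_map_assoc _ (irrelevant_le_map_gradedRingHomOfEquiv e he)
    s.1.2 _ s.2.2 _).trans ?_
  refine Eq.trans ?_ (Proj.awayι_toSpecZero_assoc (quotGrading J.toIdeal) _ _ _ _).symm
  refine (congrArg (_ ≫ ·) (Proj.awayι_toSpecZero_assoc (quotGrading I.toIdeal) _ _ _ _)).trans ?_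
  simp only [← Spec.map_comp, ← CommRingCat.ofHom_comp]
  congr 2
  refine RingHom.ext fun a => HomogeneousLocalization.val_injective _ ?_
  change Localization.mk (e (algebraMap ℂ _ a)) _ = Localization.mk (algebraMap ℂ _ a) _
  rw [AlgEquiv.commutes]
  congr 1
  exact Subtype.ext (map_one e)

/-- Projectively equivalent closed subschemes are isomorphic over the base field. -/
theorem ProjEquiv.nonempty_iso (h : ProjEquiv I.toIdeal J.toIdeal) :
    Nonempty (projOver I ≅ projOver J) := by
  obtain ⟨e, he⟩ := h
  refine ⟨Over.isoMk ⟨projMapOfEquiv e.symm (quotGrading_map_symm e he), projMapOfEquiv e he,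
    ?_, ?_⟩ ?_⟩
  · exact projMapOfEquiv_comp_symm e.symm (quotGrading_map_symm e he)
  · exact projMapOfEquiv_comp_symm e he
  · exact projMapOfEquiv_projStructure e.symm (quotGrading_map_symm e he)

end ProjFunctor

section Smoothness

variable {σ : Type} (I : HomogeneousIdeal (homogeneousSubmodule σ ℂ))

theorem smooth_awayConst_iff (k : σ) : (awayConst I k).Smooth ↔
    Algebra.Smooth ℂ (MvPolynomial σ ℂ ⧸ dehomIdeal I k) := by
  let _ := (awayConst I k).toAlgebra
  let F : MvPolynomial σ ℂ →ₐ[ℂ] AwayRing I k := aeval (awayCoord I k)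
  have hF : (F : MvPolynomial σ ℂ →+* AwayRing I k) = awayEval I k := rfl
  have hsurj : Function.Surjective F := awayEval_surjective I k
  have hker : dehomIdeal I k = RingHom.ker F := (ker_awayEval I k).symm
  let e : (MvPolynomial σ ℂ ⧸ dehomIdeal I k) ≃ₐ[ℂ] AwayRing I k :=
    (Ideal.quotientEquivAlgOfEq ℂ hker).trans (Ideal.quotientKerAlgEquivOfSurjective hsurj)
  exact ⟨fun h => @Algebra.Smooth.of_equiv _ _ _ _ _ _ _ _ h e.symm,
    fun h => Algebra.Smooth.of_equiv e⟩

theorem smooth_projStructure_iff : Smooth (projStructure I) ↔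
    ∀ k, Algebra.Smooth ℂ (MvPolynomial σ ℂ ⧸ dehomIdeal I k) := by
  have h2 : ∀ k : σ, Smooth (projChart I k ≫ projStructure I) ↔
      Algebra.Smooth ℂ (MvPolynomial σ ℂ ⧸ dehomIdeal I k) := by
    intro k
    rw [projChart_projStructure, ← smooth_awayConst_iff]
    exact HasRingHomProperty.Spec_iff (P := @Smooth)
  refine ⟨fun h k => (h2 k).mp inferInstance, fun h => ?_⟩
  have haff : ∀ i, IsAffine ((projCover I).openCover.X i) := fun i => inferInstanceAs
    (IsAffine (Spec (.of (AwayRing I i))))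
  exact (HasRingHomProperty.iff_of_source_openCover (P := @Smooth) (projCover I).openCover).mpr
    fun k => (HasRingHomProperty.iff_of_isAffine (P := @Smooth)).mp ((h2 k).mpr (h k))

/-- A retract of a formally smooth algebra is formally smooth. -/
theorem formallySmooth_of_retract {R A P : Type} [CommRing R] [CommRing A] [CommRing P]
    [Algebra R A] [Algebra R P] [Algebra.FormallySmooth R P] (i : A →ₐ[R] P) (ρ : P →ₐ[R] A)
    (h : ∀ a, ρ (i a) = a) : Algebra.FormallySmooth R A := by
  refine Algebra.FormallySmooth.of_comp_surjective fun B _ _ N hN f => ?_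
  obtain ⟨g, hg⟩ := Algebra.FormallySmooth.comp_surjective R P N hN (f.comp ρ)
  refine ⟨g.comp i, ?_⟩
  ext a
  have := congr($hg (i a))
  simpa [h] using this

end Smoothness

section Irreducibility

variable {σ : Type} (I : HomogeneousIdeal (homogeneousSubmodule σ ℂ))

theorem preirreducibleSpace_projScheme (h : I.toIdeal.radical.IsPrime) :
    PreirreducibleSpace (projScheme I) := by
  by_cases hne : IsEmpty (projScheme I)
  · refine ⟨fun U V _ _ ⟨x, hx⟩ => (hne.false x).elim⟩
  obtain ⟨x⟩ := not_isEmpty_iff.mp hne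
  let N : HomogeneousIdeal (quotGrading I.toIdeal) := (⊥ : HomogeneousIdeal _).radical
  have hNle : ∀ y : ProjectiveSpectrum (quotGrading I.toIdeal), N ≤ y.asHomogeneousIdeal := by
    intro y a ha
    exact (y.isPrime.radical_le_iff.mpr bot_le : (⊥ : Ideal _).radical ≤ _) ha
  have hN : N.toIdeal.IsPrime := by
    have hc : (⊥ : Ideal (MvPolynomial σ ℂ ⧸ I.toIdeal)).radical.comap
        (Ideal.Quotient.mk I.toIdeal) = I.toIdeal.radical := by
      rw [Ideal.comap_radical, ← RingHom.ker_eq_comap_bot, Ideal.mk_ker]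
    have h' : ((⊥ : Ideal (MvPolynomial σ ℂ ⧸ I.toIdeal)).radical.comap
        (Ideal.Quotient.mk I.toIdeal)).IsPrime := hc ▸ h
    refine ⟨fun ht => h'.ne_top ?_, fun {a b} hab => ?_⟩
    · exact Ideal.comap_eq_top_iff.mpr ht
    · obtain ⟨a, rfl⟩ := Ideal.Quotient.mk_surjective a
      obtain ⟨b, rfl⟩ := Ideal.Quotient.mk_surjective b
      exact h'.mem_or_mem (x := a) (y := b) (by rwa [Ideal.mem_comap, map_mul])
  let η : ProjectiveSpectrum (quotGrading I.toIdeal) :=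
    ⟨N, hN, fun hle => x.not_irrelevant_le (hle.trans (hNle x))⟩
  have hη : ∀ U : Set (projScheme I), IsOpen U → U.Nonempty → η ∈ U := by
    rintro U hU ⟨y, hy⟩
    obtain ⟨_, ⟨a, rfl⟩, ha, haU⟩ :=
      (ProjectiveSpectrum.isTopologicalBasis_basic_opens
        (quotGrading I.toIdeal)).exists_subset_of_mem_open
        hy hU
    exact haU fun h => ha (hNle y h)
  refine ⟨fun U V hU hV ⟨y, _, hy⟩ ⟨z, _, hz⟩ => ⟨η, trivial, hη U hU ⟨y, hy⟩, hη V hV ⟨z, hz⟩⟩⟩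

theorem basicOpen_nonempty {f : MvPolynomial σ ℂ} {n : ℕ} (hn : 0 < n) (hf : f.IsHomogeneous n)
    (P : σ → ℂ) (hP : ∀ g ∈ I.toIdeal, eval P g = 0) (hfP : eval P f ≠ 0) :
    ((Proj.basicOpen (quotGrading I.toIdeal) (Ideal.Quotient.mk I.toIdeal f) :
      (Proj (quotGrading I.toIdeal)).Opens) : Set (Proj (quotGrading I.toIdeal))).Nonempty := by
  have hmem := mk_mem_quotGrading I.toIdeal hf
  have hnt : Nontrivial (HomogeneousLocalization.Away (quotGrading I.toIdeal)
      (Ideal.Quotient.mk I.toIdeal f)) := by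
    refine ⟨1, 0, fun h => ?_⟩
    have h1 := congrArg HomogeneousLocalization.val h
    rw [HomogeneousLocalization.val_one, HomogeneousLocalization.val_zero] at h1
    let ev : (MvPolynomial σ ℂ ⧸ I.toIdeal) →+* ℂ := Ideal.Quotient.lift I.toIdeal (eval P) hP
    have hev : IsUnit (ev (Ideal.Quotient.mk I.toIdeal f)) := by
      simpa [ev] using hfP
    have h2 := congrArg (IsLocalization.Away.lift (S := Localization.Away _) _ hev) h1
    rw [map_one, map_zero] at h2
    exact one_ne_zero h2
  rw [← Proj.opensRange_awayι _ _ hmem hn]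
  obtain ⟨y⟩ : Nonempty (PrimeSpectrum (HomogeneousLocalization.Away (quotGrading I.toIdeal)
      (Ideal.Quotient.mk I.toIdeal f))) := inferInstance
  exact ⟨(Proj.awayι _ _ hmem hn) y, ⟨y, rfl⟩⟩

/-- If the product of two forms vanishes on a closed subscheme of projective space, but neither
form vanishes at all points, then the subscheme is reducible. -/
theorem not_preirreducibleSpace_projScheme {f g : MvPolynomial σ ℂ} {m n : ℕ} (hm : 0 < m)
    (hn : 0 < n) (hf : f.IsHomogeneous m) (hg : g.IsHomogeneous n) (hfg : f * g ∈ I.toIdeal)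
    {P Q : σ → ℂ} (hP : ∀ h ∈ I.toIdeal, eval P h = 0) (hfP : eval P f ≠ 0)
    (hQ : ∀ h ∈ I.toIdeal, eval Q h = 0) (hgQ : eval Q g ≠ 0) :
    ¬ PreirreducibleSpace (projScheme I) := by
  intro h
  obtain ⟨y, -, hy⟩ := h.isPreirreducible_univ _ _
    (Proj.basicOpen (quotGrading I.toIdeal) (Ideal.Quotient.mk I.toIdeal f)).isOpen
    (Proj.basicOpen (quotGrading I.toIdeal) (Ideal.Quotient.mk I.toIdeal g)).isOpen
    ((Set.univ_inter _).symm ▸ basicOpen_nonempty I hm hf P hP hfP)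
    ((Set.univ_inter _).symm ▸ basicOpen_nonempty I hn hg Q hQ hgQ)
  have h1 : y ∈ Proj.basicOpen (quotGrading I.toIdeal) (Ideal.Quotient.mk I.toIdeal f) ⊓
    Proj.basicOpen (quotGrading I.toIdeal) (Ideal.Quotient.mk I.toIdeal g) := hy
  rw [← Proj.basicOpen_mul, ← map_mul, Ideal.Quotient.eq_zero_iff_mem.mpr hfg,
    Proj.basicOpen_zero] at h1
  exact h1

end Irreducibility

/-! ### Projective equivalence and ideals of components -/

section ProjectiveEquivalence

variable {σ τ υ : Type}

theorem ProjEquiv.trans {I : Ideal (MvPolynomial σ ℂ)} {J : Ideal (MvPolynomial τ ℂ)}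
    {K : Ideal (MvPolynomial υ ℂ)} (h₁ : ProjEquiv I J) (h₂ : ProjEquiv J K) : ProjEquiv I K := by
  obtain ⟨e, he⟩ := h₁
  obtain ⟨e', he'⟩ := h₂
  refine ⟨e.trans e', fun n => ?_⟩
  rw [← he', ← he, ← Submodule.map_comp]
  rfl

theorem ProjEquiv.isPrime_iff {I : Ideal (MvPolynomial σ ℂ)} {J : Ideal (MvPolynomial τ ℂ)}
    (h : ProjEquiv I J) : I.IsPrime ↔ J.IsPrime := by
  obtain ⟨e, -⟩ := h
  rw [← Ideal.Quotient.isDomain_iff_prime, ← Ideal.Quotient.isDomain_iff_prime]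
  exact e.toMulEquiv.isDomain_iff

/-- Two linear substitutions which carry each ideal into the other and are inverse to each other
modulo the ideals give a projective equivalence. -/
theorem ProjEquiv.of_substitutions {I : Ideal (MvPolynomial σ ℂ)} {J : Ideal (MvPolynomial τ ℂ)}
    (F : σ → MvPolynomial τ ℂ) (G : τ → MvPolynomial σ ℂ)
    (hF : ∀ i, (F i).IsHomogeneous 1) (hG : ∀ j, (G j).IsHomogeneous 1)
    (hIJ : I ≤ J.comap (aeval F)) (hJI : J ≤ I.comap (aeval G))
    (hGF : ∀ i, aeval G (F i) - X i ∈ I) (hFG : ∀ j, aeval F (G j) - X j ∈ J) :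
    ProjEquiv I J := by
  let f : (MvPolynomial σ ℂ ⧸ I) →ₐ[ℂ] MvPolynomial τ ℂ ⧸ J := Ideal.quotientMapₐ J (aeval F) hIJ
  let g : (MvPolynomial τ ℂ ⧸ J) →ₐ[ℂ] MvPolynomial σ ℂ ⧸ I := Ideal.quotientMapₐ I (aeval G) hJI
  have hfg : f.comp g = AlgHom.id ℂ (MvPolynomial τ ℂ ⧸ J) := by
    refine Ideal.Quotient.algHom_ext _ (MvPolynomial.algHom_ext fun j => ?_)
    have h1 : f (g (Ideal.Quotient.mk J (X j))) = Ideal.Quotient.mk J (aeval F (aeval G (X j))) :=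
      rfl
    refine h1.trans ?_
    rw [aeval_X]
    exact Ideal.Quotient.eq.mpr (hFG j)
  have hgf : g.comp f = AlgHom.id ℂ (MvPolynomial σ ℂ ⧸ I) := by
    refine Ideal.Quotient.algHom_ext _ (MvPolynomial.algHom_ext fun j => ?_)
    have h1 : g (f (Ideal.Quotient.mk I (X j))) = Ideal.Quotient.mk I (aeval G (aeval F (X j))) :=
      rfl
    refine h1.trans ?_
    rw [aeval_X]
    exact Ideal.Quotient.eq.mpr (hGF j)
  refine ⟨AlgEquiv.ofAlgHom f g hfg hgf, fun n => le_antisymm ?_ ?_⟩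
  · rintro _ ⟨x, hx, rfl⟩
    obtain ⟨p, hp, rfl⟩ := exists_of_mem_quotGrading hx
    have : (aeval F p).IsHomogeneous (1 * n) := hp.aeval F hF
    rw [one_mul] at this
    exact mk_mem_quotGrading J this
  · intro y hy
    obtain ⟨p, hp, rfl⟩ := exists_of_mem_quotGrading hy
    have : (aeval G p).IsHomogeneous (1 * n) := hp.aeval G hG
    rw [one_mul] at this
    refine ⟨_, mk_mem_quotGrading I this, ?_⟩
    exact congr($hfg (Ideal.Quotient.mk J p))

/-- Two ideals of a polynomial ring are linearly equivalent: a linear change of coordinates carries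
one to the other. -/
def LinEquivIdeal (I I' : Ideal (MvPolynomial σ ℂ)) : Prop :=
  ∃ e : MvPolynomial σ ℂ ≃ₐ[ℂ] MvPolynomial σ ℂ, (∀ i, (e (X i)).IsHomogeneous 1) ∧
    (∀ i, (e.symm (X i)).IsHomogeneous 1) ∧ I = I'.comap e

theorem projEquiv_comap (e : MvPolynomial σ ℂ ≃ₐ[ℂ] MvPolynomial σ ℂ)
    (he : ∀ i, (e (X i)).IsHomogeneous 1) (he' : ∀ i, (e.symm (X i)).IsHomogeneous 1)
    (J : Ideal (MvPolynomial σ ℂ)) : ProjEquiv (J.comap e) J := by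
  have h1 : aeval (fun i => e (X i)) = (e : MvPolynomial σ ℂ →ₐ[ℂ] MvPolynomial σ ℂ) :=
    MvPolynomial.algHom_ext fun i => by simp
  have h2 : aeval (fun i => e.symm (X i)) = (e.symm : MvPolynomial σ ℂ →ₐ[ℂ] MvPolynomial σ ℂ) :=
    MvPolynomial.algHom_ext fun i => by simp
  refine ProjEquiv.of_substitutions _ _ he he' ?_ ?_ ?_ ?_
  · rw [h1]; rfl
  · rw [h2]
    intro x hx
    simpa using hx
  · intro i
    rw [h2]
    simp
  · intro i
    rw [h1]
    simp

theorem LinEquivIdeal.trans {I I' I'' : Ideal (MvPolynomial σ ℂ)} (h : LinEquivIdeal I I')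
    (h' : LinEquivIdeal I' I'') : LinEquivIdeal I I'' := by
  obtain ⟨e, he1, he2, rfl⟩ := h
  obtain ⟨e', he1', he2', rfl⟩ := h'
  have key : ∀ (e : MvPolynomial σ ℂ ≃ₐ[ℂ] MvPolynomial σ ℂ) (_ : ∀ i, (e (X i)).IsHomogeneous 1)
      (p : MvPolynomial σ ℂ), p.IsHomogeneous 1 → (e p).IsHomogeneous 1 := by
    intro e he p hp
    have h1 : aeval (fun i => e (X i)) = (e : MvPolynomial σ ℂ →ₐ[ℂ] MvPolynomial σ ℂ) :=
      MvPolynomial.algHom_ext fun i => by simp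
    have := hp.aeval _ he
    rwa [h1] at this
  exact ⟨e.trans e', fun i => key e' he1' _ (he1 i), fun i => key e.symm he2 _ (he2' i), rfl⟩

theorem LinEquivIdeal.projEquiv {I I' : Ideal (MvPolynomial σ ℂ)} (h : LinEquivIdeal I I') :
    ProjEquiv I I' := by
  obtain ⟨e, he1, he2, rfl⟩ := h
  exact projEquiv_comap e he1 he2 I'

theorem IsQuadric.isPrime {n : ℕ} {J : Ideal (MvPolynomial σ ℂ)} (h : IsQuadric n J) :
    J.IsPrime := by
  obtain ⟨f, -, hf, h⟩ := h
  rw [h.isPrime_iff, Ideal.span_singleton_prime hf.ne_zero]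
  exact hf.prime

theorem IsConeUnionQuadric.of_linEquiv {I I' : Ideal (MvPolynomial σ ℂ)} (h : LinEquivIdeal I I')
    (h' : IsConeUnionQuadric I') : IsConeUnionQuadric I := by
  obtain ⟨e, he1, he2, rfl⟩ := h
  obtain ⟨J₁, J₂, h1, ⟨f, hf, hf', h2⟩, rfl⟩ := h'
  exact ⟨J₁.comap e, J₂.comap e, (projEquiv_comap e he1 he2 J₁).trans h1,
    ⟨f, hf, hf', (projEquiv_comap e he1 he2 J₂).trans h2⟩, Ideal.comap_inf ..⟩

end ProjectiveEquivalence

section PrimaryDecomposition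

variable {A : Type*} [CommRing A]

/-- Splitting off a component: if the prime ideal `J` contains `I`, does not contain `x`, and
annihilates `x` modulo `I`, then `J` is a component of `I` and the other ones lie in `x = 0`. -/
theorem inf_sup_span_singleton_eq {I J : Ideal A} [hJ : J.IsPrime] {x : A} (hIJ : I ≤ J)
    (hx : x ∉ J) (hxJ : ∀ y ∈ J, x * y ∈ I) : J ⊓ (I ⊔ Ideal.span {x}) = I := by
  refine le_antisymm ?_ (le_inf hIJ le_sup_left)
  rintro f ⟨hf1, hf2⟩
  obtain ⟨a, ha, b, hb, rfl⟩ := Submodule.mem_sup.mp hf2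
  obtain ⟨c, rfl⟩ := Ideal.mem_span_singleton'.mp hb
  have h1 : c * x ∈ J := (Submodule.add_mem_iff_right J (hIJ ha)).mp hf1
  have h2 := hxJ c ((hJ.mem_or_mem h1).resolve_right hx)
  exact add_mem ha (by rwa [mul_comm])

theorem forall_mem_span_mul_mem {I : Ideal A} {x : A} {s : Set A} (h : ∀ y ∈ s, x * y ∈ I) :
    ∀ y ∈ Ideal.span s, x * y ∈ I := by
  intro y hy
  induction hy using Submodule.span_induction with
  | mem y hy => exact h y hy
  | zero => simp
  | add y z _ _ hy hz => rw [mul_add]; exact add_mem hy hz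
  | smul a y _ hy => rw [smul_eq_mul, mul_left_comm]; exact Ideal.mul_mem_left _ _ hy

end PrimaryDecomposition

section SegreIdeal

variable {a b : ℕ}

/-- The `2 × 2` minors of the generic matrix. -/
def segreMinors (a b : ℕ) : Ideal (MvPolynomial (Fin a × Fin b) ℂ) :=
  Ideal.span {f | ∃ i j k l, f = X (i, k) * X (j, l) - X (i, l) * X (j, k)}

/-- The monomials with the same row and column indices agree modulo the minors. -/
theorem mk_prod_zip_eq_of_perm (l : List (Fin a)) {m m' : List (Fin b)} (h : m.Perm m')
    (hl : l.length = m.length) :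
    ((l.zip m).map fun ij => Ideal.Quotient.mk (segreMinors a b) (X ij)).prod =
      ((l.zip m').map fun ij => Ideal.Quotient.mk (segreMinors a b) (X ij)).prod := by
  induction h generalizing l with
  | nil => rfl
  | cons x h ih =>
    rcases l with - | ⟨y, l⟩
    · rfl
    · simp only [List.zip_cons_cons, List.map_cons, List.prod_cons]
      rw [ih l (by simpa using hl)]
  | swap x y m =>
    rcases l with - | ⟨i, - | ⟨j, l⟩⟩
    · rfl
    · simp at hl
    · simp only [List.zip_cons_cons, List.map_cons, List.prod_cons, ← mul_assoc]
      congr 1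
      rw [← map_mul, ← map_mul, Ideal.Quotient.eq]
      exact Ideal.subset_span ⟨i, j, y, x, rfl⟩
  | trans h1 h2 ih1 ih2 => rw [ih1 l hl, ih2 l (hl.trans h1.length_eq)]

theorem mk_prod_zip_eq_of_perm' (m : List (Fin b)) {l l' : List (Fin a)} (h : l.Perm l')
    (hl : l.length = m.length) :
    ((l.zip m).map fun ij => Ideal.Quotient.mk (segreMinors a b) (X ij)).prod =
      ((l'.zip m).map fun ij => Ideal.Quotient.mk (segreMinors a b) (X ij)).prod := by
  induction h generalizing m with
  | nil => rfl
  | cons x h ih =>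
    rcases m with - | ⟨y, m⟩
    · rfl
    · simp only [List.zip_cons_cons, List.map_cons, List.prod_cons]
      rw [ih m (by simpa using hl)]
  | swap x y l =>
    rcases m with - | ⟨i, - | ⟨j, m⟩⟩
    · rfl
    · simp at hl
    · simp only [List.zip_cons_cons, List.map_cons, List.prod_cons, ← mul_assoc]
      congr 1
      rw [← map_mul, ← map_mul, Ideal.Quotient.eq]
      exact Ideal.subset_span ⟨y, x, i, j, by ring⟩
  | trans h1 h2 ih1 ih2 => rw [ih1 m hl, ih2 m (h1.length_eq.symm.trans hl)]

theorem mk_monomial_eq_prod (m : Fin a × Fin b →₀ ℕ) :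
    Ideal.Quotient.mk (segreMinors a b) (monomial m 1) =
      (m.toMultiset.toList.map fun ij => Ideal.Quotient.mk (segreMinors a b) (X ij)).prod := by
  rw [← Multiset.prod_coe, ← Multiset.map_coe, Multiset.coe_toList]
  induction m using Finsupp.induction_linear with
  | zero => simp
  | add m n hm hn =>
    rw [map_add, Multiset.map_add, Multiset.prod_add, ← hm, ← hn, ← map_mul, monomial_mul, one_mul]
  | single ij k =>
    rw [Finsupp.toMultiset_single, Multiset.map_nsmul, Multiset.map_singleton,
      Multiset.prod_nsmul, Multiset.prod_singleton, ← map_pow, X_pow_eq_monomial]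

/-- Monomials with the same image under the Segre homomorphism agree modulo the minors. -/
theorem mk_monomial_eq_of_mapDomain {m m' : Fin a × Fin b →₀ ℕ}
    (h1 : m.mapDomain Prod.fst = m'.mapDomain Prod.fst)
    (h2 : m.mapDomain Prod.snd = m'.mapDomain Prod.snd) :
    Ideal.Quotient.mk (segreMinors a b) (monomial m 1) =
      Ideal.Quotient.mk (segreMinors a b) (monomial m' 1) := by
  rw [mk_monomial_eq_prod, mk_monomial_eq_prod]
  set L := m.toMultiset.toList with hL
  set L' := m'.toMultiset.toList with hL'
  have hp : ∀ {c : ℕ} (f : Fin a × Fin b → Fin c), m.mapDomain f = m'.mapDomain f →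
      (L.map f).Perm (L'.map f) := by
    intro c f h
    rw [← Multiset.coe_eq_coe, ← Multiset.map_coe, ← Multiset.map_coe, hL, hL',
      Multiset.coe_toList, Multiset.coe_toList, Finsupp.toMultiset_map, Finsupp.toMultiset_map, h]
  have hz : ∀ M : List (Fin a × Fin b), (M.map Prod.fst).zip (M.map Prod.snd) = M := by
    intro M
    induction M with
    | nil => rfl
    | cons x M ih => simp [ih]
  rw [← hz L, ← hz L', mk_prod_zip_eq_of_perm' _ (hp _ h1) (by simp),
    mk_prod_zip_eq_of_perm _ (hp _ h2)]
  have := (hp _ h1).length_eq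
  simp only [List.length_map] at this ⊢
  exact this.symm

theorem segreHom_monomial (m : Fin a × Fin b →₀ ℕ) (c : ℂ) :
    segreHom a b (monomial m c) = monomial
      ((m.mapDomain Prod.fst).mapDomain Sum.inl + (m.mapDomain Prod.snd).mapDomain Sum.inr) c := by
  have h1 : segreHom a b (monomial m 1) = monomial
      ((m.mapDomain Prod.fst).mapDomain Sum.inl + (m.mapDomain Prod.snd).mapDomain Sum.inr) 1 := by
    induction m using Finsupp.induction_linear with
    | zero => simp
    | add m n hm hn =>
      have : (monomial (m + n) (1 : ℂ)) = monomial m 1 * monomial n 1 := by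
        rw [monomial_mul, one_mul]
      rw [this, map_mul, hm, hn, monomial_mul, one_mul]
      simp only [Finsupp.mapDomain_add]
      rw [add_add_add_comm]
    | single ij k =>
      rw [← X_pow_eq_monomial, map_pow, segreHom, aeval_X, mul_pow, X_pow_eq_monomial,
        X_pow_eq_monomial, monomial_mul, one_mul]
      simp [Finsupp.mapDomain_single]
  have h2 : monomial m c = c • monomial m (1 : ℂ) := by simp [smul_monomial]
  rw [h2, map_smul, h1, smul_monomial, smul_eq_mul, mul_one]

/-- The ideal of the Segre variety is generated by the `2 × 2` minors of the generic matrix. -/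
theorem segreIdeal_eq_segreMinors : (segreIdeal a b).toIdeal = segreMinors a b := by
  classical
  refine le_antisymm (fun f hf => ?_) (Ideal.span_le.mpr ?_)
  · let im : (Fin a × Fin b →₀ ℕ) → (Fin a ⊕ Fin b →₀ ℕ) := fun m =>
      (m.mapDomain Prod.fst).mapDomain Sum.inl + (m.mapDomain Prod.snd).mapDomain Sum.inr
    have him : ∀ m m', im m = im m' → Ideal.Quotient.mk (segreMinors a b) (monomial m 1) =
      Ideal.Quotient.mk (segreMinors a b) (monomial m' 1) := by
      intro m m' h
      refine mk_monomial_eq_of_mapDomain (Finsupp.ext fun i => ?_) (Finsupp.ext fun j => ?_)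
      · have := DFunLike.congr_fun h (Sum.inl i)
        simpa [im, Finsupp.mapDomain_apply Sum.inl_injective, Finsupp.mapDomain_of_notMem_range]
          using this
      · have := DFunLike.congr_fun h (Sum.inr j)
        simpa [im, Finsupp.mapDomain_apply Sum.inr_injective, Finsupp.mapDomain_of_notMem_range]
          using this
    let N : (Fin a ⊕ Fin b →₀ ℕ) → MvPolynomial (Fin a × Fin b) ℂ ⧸ segreMinors a b := fun d =>
      if h : ∃ m, im m = d then Ideal.Quotient.mk _ (monomial h.choose 1) else 0
    have hN : ∀ m, N (im m) = Ideal.Quotient.mk _ (monomial m 1) := by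
      intro m
      have h : ∃ m', im m' = im m := ⟨m, rfl⟩
      simp only [N, dif_pos h]
      exact him _ _ h.choose_spec
    let T : MvPolynomial (Fin a ⊕ Fin b) ℂ →ₗ[ℂ] MvPolynomial (Fin a × Fin b) ℂ ⧸ segreMinors a b :=
      (basisMonomials _ ℂ).constr ℂ N
    have hT : T ∘ₗ (segreHom a b).toLinearMap = (Ideal.Quotient.mkₐ ℂ
      (segreMinors a b)).toLinearMap := by
      refine (basisMonomials _ ℂ).ext fun m => ?_
      rw [coe_basisMonomials]
      change T (segreHom a b (monomial m 1)) = Ideal.Quotient.mk _ (monomial m 1)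
      rw [segreHom_monomial, ← hN]
      have := (basisMonomials (Fin a ⊕ Fin b) ℂ).constr_basis ℂ N (im m)
      rwa [coe_basisMonomials] at this
    rw [← Ideal.Quotient.eq_zero_iff_mem]
    have h1 : segreHom a b f = 0 := hf
    have h2 : T (segreHom a b f) = Ideal.Quotient.mk _ f := congr($hT f)
    rw [← h2, h1, map_zero]
  · rintro _ ⟨i, j, k, l, rfl⟩
    change segreHom a b _ = 0
    simp only [segreHom, map_sub, map_mul, aeval_X]
    ring

end SegreIdeal

/-! ### Solutions of the nine equations and their symmetries -/

section KeySolutions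

variable {T : Type} [CommRing T]

/-- The nine equations for elements `p, p₄, q, r, u` of a ring containing the entries of `S` and
`t`. -/
structure IsKeySolution (S : Matrix (Fin 3) (Fin 3) T) (t p : Fin 3 → T) (p4 : T)
    (q : Fin 3 → T) (r u : T) : Prop where
  dot : p ⬝ᵥ q = 0
  cross : r • p + skewMat q *ᵥ (S *ᵥ p) + p4 • (skewMat q *ᵥ t) = 0
  quad : p ⬝ᵥ (S *ᵥ p) + p4 * (p ⬝ᵥ t) = 0
  smul : u • p - r • (skewMat q *ᵥ t) + skewMat q *ᵥ (S *ᵥ (skewMat q *ᵥ t)) = 0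
  mul : u * p4 + (r ^ 2 + q ⬝ᵥ (S.adjugate *ᵥ q)) = 0

theorem skewMat_mulVec (v w : Fin 3 → T) : skewMat v *ᵥ w =
    ![v 1 * w 2 - v 2 * w 1, v 2 * w 0 - v 0 * w 2, v 0 * w 1 - v 1 * w 0] := by
  ext i
  fin_cases i <;> simp [skewMat, Matrix.mulVec, dotProduct, Fin.sum_univ_three] <;> ring

theorem mulVec_fin_three (M : Matrix (Fin 3) (Fin 3) T) (w : Fin 3 → T) (i : Fin 3) :
    (M *ᵥ w) i = M i 0 * w 0 + M i 1 * w 1 + M i 2 * w 2 := by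
  simp [Matrix.mulVec, dotProduct, Fin.sum_univ_three]

theorem dotProduct_fin_three (v w : Fin 3 → T) :
    v ⬝ᵥ w = v 0 * w 0 + v 1 * w 1 + v 2 * w 2 := by
  simp [dotProduct, Fin.sum_univ_three]

theorem funext_fin_three_iff {T : Type} (v w : Fin 3 → T) : v = w ↔ v 0 = w 0 ∧ v 1 = w 1 ∧
    v 2 = w 2 := by
  rw [_root_.funext_iff, Fin.forall_fin_succ, Fin.forall_fin_succ, Fin.forall_fin_one]
  rfl

/-- The nine equations generate the ideal of relations between a universal solution. -/
theorem keyIdeal_le_ker_iff [Algebra ℂ T] (s : Sym2 (Fin 3) → ℂ) (t : Fin 3 → ℂ)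
    (f : MvPolynomial KeyVar ℂ →ₐ[ℂ] T) :
    (keyIdeal s t).toIdeal ≤ RingHom.ker f ↔
      IsKeySolution ((symMat s).map (algebraMap ℂ T)) (fun i => algebraMap ℂ T (t i))
        (fun i => f (X (.p i))) (f (X .p4)) (fun i => f (X (.q i))) (f (X .r)) (f (X .u)) := by
  have hC : ∀ a, f (C a) = algebraMap ℂ T a := fun a => f.commutes a
  have key : (keyIdeal s t).toIdeal ≤ RingHom.ker f ↔ ∀ g ∈ keyEqns s t, f g = 0 :=
    Ideal.span_le
  have hsplit : ∀ {S : Matrix (Fin 3) (Fin 3) T} {t p : Fin 3 → T} {p4 : T} {q : Fin 3 → T}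
    {r u : T}, IsKeySolution S t p p4 q r u ↔ (((_ ∧ _) ∧ _) ∧ _) ∧ _ :=
    ⟨fun h => ⟨⟨⟨⟨h.1, h.2⟩, h.3⟩, h.4⟩, h.5⟩,
      fun h => ⟨h.1.1.1.1, h.1.1.1.2, h.1.1.2, h.1.2, h.2⟩⟩
  rw [key, hsplit]
  simp only [keyEqns, Set.mem_union, or_imp, forall_and, Set.mem_singleton_iff, forall_eq,
    Set.forall_mem_range]
  refine and_congr (and_congr (and_congr (and_congr ?_ ?_) ?_) ?_) ?_
  · simp only [dotProduct_fin_three, map_add, map_mul]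
  · rw [_root_.funext_iff]
    refine forall_congr' fun i => Eq.congr ?_ rfl
    rw [Matrix.add_mulVec, Matrix.smul_mulVec, Matrix.one_mulVec, ← Matrix.mulVec_mulVec]
    fin_cases i <;>
    simp [skewMat_mulVec, mulVec_fin_three, symMat, hC, Matrix.vecHead, Matrix.vecTail,
      -Matrix.mulVec_mulVec]
  · simp [dotProduct_fin_three, mulVec_fin_three, symMat, hC]
  · rw [_root_.funext_iff]
    refine forall_congr' fun i => Eq.congr ?_ rfl
    rw [Matrix.sub_mulVec, Matrix.smul_mulVec, Matrix.one_mulVec, ← Matrix.mulVec_mulVec,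
      ← sub_add]
    fin_cases i <;>
    simp [skewMat_mulVec, mulVec_fin_three, symMat, hC, Matrix.vecHead, Matrix.vecTail,
      -Matrix.mulVec_mulVec] <;> ring
  · simp [symMat, hC, Matrix.adjugate_fin_three,
      Matrix.vecHead, Matrix.vecTail]

theorem skewMat_adjugate_transpose_mulVec (g : Matrix (Fin 3) (Fin 3) T) (q : Fin 3 → T) :
    skewMat (g.adjugateᵀ *ᵥ q) = g * skewMat q * gᵀ := by
  ext i j
  fin_cases i <;> fin_cases j <;>
    simp [skewMat, Matrix.adjugate_fin_three, Matrix.mul_apply, Fin.sum_univ_three,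
      Matrix.mulVec, dotProduct] <;> ring

/-- The action of a linear substitution on the solutions. -/
theorem IsKeySolution.linear {S : Matrix (Fin 3) (Fin 3) T} {t p q : Fin 3 → T} {p4 r u : T}
    (g : Matrix (Fin 3) (Fin 3) T) (h : IsKeySolution (gᵀ * S * g) (gᵀ *ᵥ t) p p4 q r u) :
    IsKeySolution S t (g *ᵥ p) p4 (g.adjugateᵀ *ᵥ q) r u := by
  have hA := skewMat_adjugate_transpose_mulVec g q
  refine ⟨?_, ?_, ?_, ?_, ?_⟩
  · rw [Matrix.dotProduct_mulVec, Matrix.vecMul_transpose, Matrix.mulVec_mulVec,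
      Matrix.adjugate_mul, Matrix.smul_mulVec, Matrix.one_mulVec, smul_dotProduct, h.dot,
      smul_zero]
  · have := congrArg (g *ᵥ ·) h.cross
    simp only [Matrix.mulVec_add, Matrix.mulVec_smul, Matrix.mulVec_mulVec, Matrix.mulVec_zero]
      at this ⊢
    rw [hA, ← this]
    simp only [Matrix.mul_assoc]
  · have := h.quad
    rw [← this]
    have e1 : (g *ᵥ p) ⬝ᵥ (S *ᵥ (g *ᵥ p)) = p ⬝ᵥ ((gᵀ * S * g) *ᵥ p) := by
      rw [← Matrix.mulVec_mulVec, ← Matrix.mulVec_mulVec, Matrix.dotProduct_mulVec p gᵀ,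
        Matrix.vecMul_transpose]
    have e2 : (g *ᵥ p) ⬝ᵥ t = p ⬝ᵥ (gᵀ *ᵥ t) := by
      rw [Matrix.dotProduct_mulVec p gᵀ, Matrix.vecMul_transpose]
    rw [e1, e2]
  · have := congrArg (g *ᵥ ·) h.smul
    simp only [Matrix.mulVec_add, Matrix.mulVec_sub, Matrix.mulVec_smul, Matrix.mulVec_mulVec,
      Matrix.mulVec_zero] at this ⊢
    rw [hA, ← this]
    simp only [Matrix.mul_assoc]
  · rw [← h.mul, Matrix.adjugate_mul_distrib, Matrix.adjugate_mul_distrib,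
      ← Matrix.adjugate_transpose, ← Matrix.mulVec_mulVec, ← Matrix.mulVec_mulVec,
      Matrix.dotProduct_mulVec q g.adjugate, Matrix.mulVec_transpose]

/-- The scalar form of the equations. -/
theorem isKeySolution_iff (S : Matrix (Fin 3) (Fin 3) T) (hS : S.IsSymm) (t p : Fin 3 → T) (p4 : T)
    (q : Fin 3 → T) (r u : T) : IsKeySolution S t p p4 q r u ↔
    p 0 * q 0 + p 1 * q 1 + p 2 * q 2 = 0 ∧
    (r * p 0 + q 1 * (S 0 2 * p 0 + S 1 2 * p 1 + S 2 2 * p 2)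
      - q 2 * (S 0 1 * p 0 + S 1 1 * p 1 + S 1 2 * p 2) + p4 * (q 1 * t 2 - q 2 * t 1) = 0 ∧
    r * p 1 + q 2 * (S 0 0 * p 0 + S 0 1 * p 1 + S 0 2 * p 2)
      - q 0 * (S 0 2 * p 0 + S 1 2 * p 1 + S 2 2 * p 2) + p4 * (q 2 * t 0 - q 0 * t 2) = 0 ∧
    r * p 2 + q 0 * (S 0 1 * p 0 + S 1 1 * p 1 + S 1 2 * p 2)
      - q 1 * (S 0 0 * p 0 + S 0 1 * p 1 + S 0 2 * p 2) + p4 * (q 0 * t 1 - q 1 * t 0) = 0) ∧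
    S 0 0 * p 0 ^ 2 + S 1 1 * p 1 ^ 2 + S 2 2 * p 2 ^ 2 + 2 * S 0 1 * p 0 * p 1
      + 2 * S 0 2 * p 0 * p 2 + 2 * S 1 2 * p 1 * p 2
      + p4 * (p 0 * t 0 + p 1 * t 1 + p 2 * t 2) = 0 ∧
    (u * p 0 - r * (q 1 * t 2 - q 2 * t 1)
      + q 1 * (S 0 2 * (q 1 * t 2 - q 2 * t 1) + S 1 2 * (q 2 * t 0 - q 0 * t 2)
        + S 2 2 * (q 0 * t 1 - q 1 * t 0))
      - q 2 * (S 0 1 * (q 1 * t 2 - q 2 * t 1) + S 1 1 * (q 2 * t 0 - q 0 * t 2)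
        + S 1 2 * (q 0 * t 1 - q 1 * t 0)) = 0 ∧
    u * p 1 - r * (q 2 * t 0 - q 0 * t 2)
      + q 2 * (S 0 0 * (q 1 * t 2 - q 2 * t 1) + S 0 1 * (q 2 * t 0 - q 0 * t 2)
        + S 0 2 * (q 0 * t 1 - q 1 * t 0))
      - q 0 * (S 0 2 * (q 1 * t 2 - q 2 * t 1) + S 1 2 * (q 2 * t 0 - q 0 * t 2)
        + S 2 2 * (q 0 * t 1 - q 1 * t 0)) = 0 ∧
    u * p 2 - r * (q 0 * t 1 - q 1 * t 0)
      + q 0 * (S 0 1 * (q 1 * t 2 - q 2 * t 1) + S 1 1 * (q 2 * t 0 - q 0 * t 2)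
        + S 1 2 * (q 0 * t 1 - q 1 * t 0))
      - q 1 * (S 0 0 * (q 1 * t 2 - q 2 * t 1) + S 0 1 * (q 2 * t 0 - q 0 * t 2)
        + S 0 2 * (q 0 * t 1 - q 1 * t 0)) = 0) ∧
    u * p4 + r ^ 2 + ((S 1 1 * S 2 2 - S 1 2 ^ 2) * q 0 ^ 2 + (S 0 0 * S 2 2 - S 0 2 ^ 2) * q 1 ^ 2
      + (S 0 0 * S 1 1 - S 0 1 ^ 2) * q 2 ^ 2 + 2 * (S 0 2 * S 1 2 - S 0 1 * S 2 2) * q 0 * q 1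
      + 2 * (S 0 1 * S 1 2 - S 0 2 * S 1 1) * q 0 * q 2
      + 2 * (S 0 1 * S 0 2 - S 0 0 * S 1 2) * q 1 * q 2) = 0 := by
  have h10 := hS.apply 0 1
  have h20 := hS.apply 0 2
  have h21 := hS.apply 1 2
  have hsplit : IsKeySolution S t p p4 q r u ↔ _ ∧ _ ∧ _ ∧ _ ∧ _ :=
    ⟨fun h => ⟨h.1, h.2, h.3, h.4, h.5⟩, fun h => ⟨h.1, h.2.1, h.2.2.1, h.2.2.2.1, h.2.2.2.2⟩⟩
  rw [hsplit, funext_fin_three_iff, funext_fin_three_iff]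
  refine and_congr ?_ (and_congr (and_congr ?_ (and_congr ?_ ?_)) (and_congr ?_
    (and_congr (and_congr ?_ (and_congr ?_ ?_)) ?_))) <;>
  · refine Eq.congr ?_ rfl
    simp [dotProduct_fin_three, mulVec_fin_three, skewMat_mulVec, Matrix.adjugate_fin_three,
      h10, h20, h21, Matrix.vecHead, Matrix.vecTail, -Matrix.mulVec_mulVec]
    try ring

/-- The solutions for `S` and for `S + t ᵗw + w ᵗt` correspond to each other. -/
theorem IsKeySolution.shift {S : Matrix (Fin 3) (Fin 3) T} (hS : S.IsSymm) {t p q : Fin 3 → T}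
    {p4 r u : T} (w : Fin 3 → T)
    (h : IsKeySolution (S + Matrix.vecMulVec t w + Matrix.vecMulVec w t) t p p4 q r u) :
    IsKeySolution S t p (p4 + 2 * (w ⬝ᵥ p)) q (r + q ⬝ᵥ (skewMat w *ᵥ t)) u := by
  have hS' : (S + Matrix.vecMulVec t w + Matrix.vecMulVec w t).IsSymm := by
    ext i j
    simp only [Matrix.transpose_apply, Matrix.add_apply, Matrix.vecMulVec_apply, hS.apply i j]
    ring
  rw [isKeySolution_iff _ hS'] at h
  rw [isKeySolution_iff _ hS]
  simp only [Matrix.add_apply, Matrix.vecMulVec_apply] at h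
  obtain ⟨h0, ⟨h1, h2, h3⟩, h4, ⟨h5, h6, h7⟩, h8⟩ := h
  simp only [dotProduct_fin_three, skewMat_mulVec, Matrix.cons_val_zero, Matrix.cons_val_one,
    Matrix.cons_val]
  refine ⟨h0, ⟨?_, ?_, ?_⟩, ?_, ⟨?_, ?_, ?_⟩, ?_⟩
  · linear_combination h1 + (w 1 * t 2 - w 2 * t 1) * h0
  · linear_combination h2 + (w 2 * t 0 - w 0 * t 2) * h0
  · linear_combination h3 + (w 0 * t 1 - w 1 * t 0) * h0
  · linear_combination h4
  · linear_combination h5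
  · linear_combination h6
  · linear_combination h7
  · linear_combination h8 + 2 * w 0 * h5 + 2 * w 1 * h6 + 2 * w 2 * h7

end KeySolutions

/-! ### Linear equivalences between the ideals of fibres -/

theorem LinEquivIdeal.of_substitutions {σ : Type} {I J : Ideal (MvPolynomial σ ℂ)}
    (F G : σ → MvPolynomial σ ℂ)
    (hF : ∀ i, (F i).IsHomogeneous 1) (hG : ∀ j, (G j).IsHomogeneous 1)
    (hGF : ∀ i, aeval G (F i) = X i) (hFG : ∀ j, aeval F (G j) = X j)
    (hIJ : I ≤ J.comap (aeval F)) (hJI : J ≤ I.comap (aeval G)) : LinEquivIdeal I J := by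
  have h1 : (aeval G).comp (aeval F) = AlgHom.id ℂ (MvPolynomial σ ℂ) :=
    MvPolynomial.algHom_ext fun i => by
    simp only [AlgHom.comp_apply, aeval_X, hGF, AlgHom.id_apply]
  have h2 : (aeval F).comp (aeval G) = AlgHom.id ℂ (MvPolynomial σ ℂ) :=
    MvPolynomial.algHom_ext fun i => by
    simp only [AlgHom.comp_apply, aeval_X, hFG, AlgHom.id_apply]
  refine ⟨AlgEquiv.ofAlgHom (aeval F) (aeval G) h2 h1, fun i => by simpa using hF i,
    fun i => by simpa using hG i, le_antisymm hIJ fun x hx => ?_⟩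
  have := hJI hx
  rw [Ideal.mem_comap] at this
  have h3 := DFunLike.congr_fun h1 x
  simp only [AlgHom.comp_apply, AlgHom.id_apply] at h3
  exact h3 ▸ this

theorem exists_symMat_eq (S : Matrix (Fin 3) (Fin 3) ℂ) (hS : S.IsSymm) :
    ∃ s : Sym2 (Fin 3) → ℂ, symMat s = S :=
  ⟨Sym2.lift ⟨fun i j => S i j, fun i j => (hS.apply i j).symm⟩, rfl⟩

theorem symMat_isSymm {R : Type} (s : Sym2 (Fin 3) → R) : (symMat s).IsSymm :=
  Matrix.IsSymm.ext fun _ _ => congrArg s Sym2.eq_swap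

/-- The substitution `p ↦ g p`, `q ↦ ᵗg† q` of the coordinates. -/
def linSubst (g : Matrix (Fin 3) (Fin 3) ℂ) : KeyVar → MvPolynomial KeyVar ℂ
  | .p i => ∑ j, C (g i j) * X (.p j)
  | .q i => ∑ j, C (g.adjugate j i) * X (.q j)
  | .p4 => X .p4
  | .r => X .r
  | .u => X .u

theorem linSubst_isHomogeneous (g : Matrix (Fin 3) (Fin 3) ℂ) (v : KeyVar) :
    (linSubst g v).IsHomogeneous 1 := by
  cases v
  case p i => exact IsHomogeneous.sum _ _ _ fun j _ => (isHomogeneous_X ℂ _).C_mul _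
  case q i => exact IsHomogeneous.sum _ _ _ fun j _ => (isHomogeneous_X ℂ _).C_mul _
  all_goals exact isHomogeneous_X ℂ _

theorem aeval_linSubst (g g' : Matrix (Fin 3) (Fin 3) ℂ) (v : KeyVar) :
    aeval (linSubst g') (linSubst g v) = linSubst (g * g') v := by
  cases v
  case p i =>
    simp [linSubst, Fin.sum_univ_three, Matrix.mul_apply]
    ring
  case q i =>
    simp [linSubst, Fin.sum_univ_three, Matrix.mul_apply, Matrix.adjugate_mul_distrib]
    ring
  all_goals simp [linSubst]

theorem linSubst_one (v : KeyVar) : linSubst 1 v = X v := by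
  cases v <;> simp [linSubst, Matrix.one_apply]

theorem le_comap_of_le_ker_comp {σ τ : Type} {I : Ideal (MvPolynomial σ ℂ)}
    {J : Ideal (MvPolynomial τ ℂ)} {f : MvPolynomial σ ℂ →ₐ[ℂ] MvPolynomial τ ℂ}
    (h : I ≤ RingHom.ker ((Ideal.Quotient.mkₐ ℂ J).comp f)) : I ≤ J.comap f :=
  fun _ hx => Ideal.mem_comap.2 (Ideal.Quotient.eq_zero_iff_mem.1 (h hx))

theorem keyIdeal_le_ker_comp_linSubst {T : Type} [CommRing T] [Algebra ℂ T]
    {s s' : Sym2 (Fin 3) → ℂ} {t t' : Fin 3 → ℂ} (g : Matrix (Fin 3) (Fin 3) ℂ)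
    (hs : symMat s' = gᵀ * symMat s * g) (ht : t' = gᵀ *ᵥ t)
    (f : MvPolynomial KeyVar ℂ →ₐ[ℂ] T) (hf : (keyIdeal s' t').toIdeal ≤ RingHom.ker f) :
    (keyIdeal s t).toIdeal ≤ RingHom.ker (f.comp (aeval (linSubst g))) := by
  have h := (keyIdeal_le_ker_iff s' t' f).1 hf
  have e1 : (symMat s').map (algebraMap ℂ T) = (g.map (algebraMap ℂ T))ᵀ *
      (symMat s).map (algebraMap ℂ T) * g.map (algebraMap ℂ T) := by
    rw [hs, Matrix.map_mul, Matrix.map_mul, Matrix.transpose_map]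
  have e2 : (fun i => algebraMap ℂ T (t' i)) =
      (g.map (algebraMap ℂ T))ᵀ *ᵥ (fun i => algebraMap ℂ T (t i)) := by
    ext i
    rw [ht, RingHom.map_mulVec, Matrix.transpose_map]
    rfl
  rw [e1, e2] at h
  have hc : ∀ a, f (C a) = algebraMap ℂ T a := fun a => f.commutes a
  have hadj : (g.map (algebraMap ℂ T)).adjugate = g.adjugate.map (algebraMap ℂ T) :=
    ((algebraMap ℂ T).map_adjugate g).symm
  have h2 := h.linear (g.map (algebraMap ℂ T))
  rw [hadj] at h2
  refine (keyIdeal_le_ker_iff s t _).2 ?_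
  convert h2 using 1
  · ext i
    simp only [AlgHom.comp_apply, aeval_X, linSubst, map_sum, map_mul, hc]
    rfl
  · simp only [AlgHom.comp_apply, aeval_X, linSubst]
  · ext i
    simp only [AlgHom.comp_apply, aeval_X, linSubst, map_sum, map_mul, hc]
    rfl
  · simp only [AlgHom.comp_apply, aeval_X, linSubst]
  · simp only [AlgHom.comp_apply, aeval_X, linSubst]

theorem keyIdeal_le_comap_linSubst {s s' : Sym2 (Fin 3) → ℂ} {t t' : Fin 3 → ℂ}
    (g : Matrix (Fin 3) (Fin 3) ℂ) (hs : symMat s' = gᵀ * symMat s * g) (ht : t' = gᵀ *ᵥ t) :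
    (keyIdeal s t).toIdeal ≤ (keyIdeal s' t').toIdeal.comap (aeval (linSubst g)) :=
  le_comap_of_le_ker_comp <|
    keyIdeal_le_ker_comp_linSubst g hs ht _ (Ideal.Quotient.mkₐ_ker ℂ _).ge

/-- Congruent pairs `(S, t)` have projectively equivalent fibres. -/
theorem linEquivIdeal_of_congruent {s s' : Sym2 (Fin 3) → ℂ} {t t' : Fin 3 → ℂ}
    (g : Matrix (Fin 3) (Fin 3) ℂ) (hg : IsUnit g.det)
    (hs : symMat s' = gᵀ * symMat s * g) (ht : t' = gᵀ *ᵥ t) :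
    LinEquivIdeal (keyIdeal s t).toIdeal (keyIdeal s' t').toIdeal := by
  have hg1 := Matrix.mul_nonsing_inv g hg
  have hg2 := Matrix.nonsing_inv_mul g hg
  have hg3 : (g⁻¹)ᵀ * gᵀ = 1 := by rw [← Matrix.transpose_mul, hg1, Matrix.transpose_one]
  refine .of_substitutions (linSubst g) (linSubst g⁻¹) (linSubst_isHomogeneous g)
    (linSubst_isHomogeneous _) (fun v => ?_) (fun v => ?_)
    (keyIdeal_le_comap_linSubst g hs ht) (keyIdeal_le_comap_linSubst g⁻¹ ?_ ?_)
  · rw [aeval_linSubst, hg1, linSubst_one]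
  · rw [aeval_linSubst, hg2, linSubst_one]
  · rw [hs, show (g⁻¹)ᵀ * (gᵀ * symMat s * g) * g⁻¹ = ((g⁻¹)ᵀ * gᵀ) * symMat s * (g * g⁻¹) by
      simp only [Matrix.mul_assoc], hg1, hg3, Matrix.one_mul, Matrix.mul_one]
  · rw [ht, Matrix.mulVec_mulVec, hg3, Matrix.one_mulVec]

/-- The substitution of the coordinates which corresponds to `S ↦ S + t ᵗw + w ᵗt`. -/
def shiftSubst (t w : Fin 3 → ℂ) : KeyVar → MvPolynomial KeyVar ℂ
  | .p i => X (.p i)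
  | .q i => X (.q i)
  | .p4 => X .p4 + ∑ i, C (2 * w i) * X (.p i)
  | .r => X .r + ∑ i, C ((skewMat w *ᵥ t) i) * X (.q i)
  | .u => X .u

theorem shiftSubst_isHomogeneous (t w : Fin 3 → ℂ) (v : KeyVar) :
    (shiftSubst t w v).IsHomogeneous 1 := by
  cases v
  case p4 =>
    refine IsHomogeneous.add (isHomogeneous_X ℂ _) ?_
    exact (IsHomogeneous.sum _ _ _ fun j _ => (isHomogeneous_X ℂ _).C_mul _)
  case r =>
    refine IsHomogeneous.add (isHomogeneous_X ℂ _) ?_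
    exact (IsHomogeneous.sum _ _ _ fun j _ => (isHomogeneous_X ℂ _).C_mul _)
  all_goals exact isHomogeneous_X ℂ _

theorem aeval_shiftSubst (t w : Fin 3 → ℂ) (v : KeyVar) :
    aeval (shiftSubst t (-w)) (shiftSubst t w v) = X v := by
  cases v
  case p4 =>
    simp [shiftSubst, Fin.sum_univ_three]
    ring
  case r =>
    simp [shiftSubst, Fin.sum_univ_three, skewMat_mulVec]
    ring
  all_goals simp [shiftSubst]

theorem keyIdeal_le_ker_comp_shiftSubst {T : Type} [CommRing T] [Algebra ℂ T]
    {s s' : Sym2 (Fin 3) → ℂ} {t : Fin 3 → ℂ} (w : Fin 3 → ℂ)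
    (hs : symMat s' = symMat s + Matrix.vecMulVec t w + Matrix.vecMulVec w t)
    (f : MvPolynomial KeyVar ℂ →ₐ[ℂ] T) (hf : (keyIdeal s' t).toIdeal ≤ RingHom.ker f) :
    (keyIdeal s t).toIdeal ≤ RingHom.ker (f.comp (aeval (shiftSubst t w))) := by
  have h := (keyIdeal_le_ker_iff s' t f).1 hf
  have e1 : (symMat s').map (algebraMap ℂ T) = (symMat s).map (algebraMap ℂ T) +
      Matrix.vecMulVec (fun i => algebraMap ℂ T (t i)) (fun i => algebraMap ℂ T (w i)) +
      Matrix.vecMulVec (fun i => algebraMap ℂ T (w i)) (fun i => algebraMap ℂ T (t i)) := by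
    rw [hs]
    ext i j
    simp [Matrix.vecMulVec_apply]
  rw [e1] at h
  have hc : ∀ a, f (C a) = algebraMap ℂ T a := fun a => f.commutes a
  have h2 := h.shift ((symMat_isSymm s).map _)
  refine (keyIdeal_le_ker_iff s t _).2 ?_
  convert h2 using 1
  · ext i
    simp only [AlgHom.comp_apply, aeval_X, shiftSubst]
  · simp only [AlgHom.comp_apply, aeval_X, shiftSubst, map_add, map_mul, hc,
      Fin.sum_univ_three, dotProduct_fin_three, map_ofNat]
    ring
  · ext i
    simp only [AlgHom.comp_apply, aeval_X, shiftSubst]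
  · simp only [AlgHom.comp_apply, aeval_X, shiftSubst, map_add, map_mul, hc,
      Fin.sum_univ_three, dotProduct_fin_three, skewMat_mulVec, map_sub, Matrix.cons_val]
    ring
  · simp only [AlgHom.comp_apply, aeval_X, shiftSubst]

theorem keyIdeal_le_comap_shiftSubst {s s' : Sym2 (Fin 3) → ℂ} {t : Fin 3 → ℂ}
    (w : Fin 3 → ℂ)
    (hs : symMat s' = symMat s + Matrix.vecMulVec t w + Matrix.vecMulVec w t) :
    (keyIdeal s t).toIdeal ≤ (keyIdeal s' t).toIdeal.comap (aeval (shiftSubst t w)) :=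
  le_comap_of_le_ker_comp <|
    keyIdeal_le_ker_comp_shiftSubst w hs _ (Ideal.Quotient.mkₐ_ker ℂ _).ge

theorem linEquivIdeal_of_shift {s s' : Sym2 (Fin 3) → ℂ} {t : Fin 3 → ℂ}
    (w : Fin 3 → ℂ)
    (hs : symMat s' = symMat s + Matrix.vecMulVec t w + Matrix.vecMulVec w t) :
    LinEquivIdeal (keyIdeal s t).toIdeal (keyIdeal s' t).toIdeal := by
  refine .of_substitutions (shiftSubst t w) (shiftSubst t (-w)) (shiftSubst_isHomogeneous t w)
    (shiftSubst_isHomogeneous t _) (aeval_shiftSubst t w) (fun v => ?_)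
    (keyIdeal_le_comap_shiftSubst w hs) (keyIdeal_le_comap_shiftSubst (-w) ?_)
  · simpa using aeval_shiftSubst t (-w) v
  · rw [hs]
    ext i j
    simp [Matrix.vecMulVec_apply]
    ring

/-! ### Normal forms of the pair formed by the matrix and the vector -/

/-- The fibres over the two points are projectively equivalent and the discrete invariants
of the two points agree. -/
structure SameType (s : Sym2 (Fin 3) → ℂ) (t : Fin 3 → ℂ) (s' : Sym2 (Fin 3) → ℂ)
    (t' : Fin 3 → ℂ) : Prop where
  linEquiv : LinEquivIdeal (keyIdeal s t).toIdeal (keyIdeal s' t').toIdeal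
  tSt_eq_zero_iff : tSt s t = 0 ↔ tSt s' t' = 0
  rank_eq : (matBSB s t).rank = (matBSB s' t').rank

theorem SameType.trans {s s' s'' : Sym2 (Fin 3) → ℂ} {t t' t'' : Fin 3 → ℂ}
    (h : SameType s t s' t') (h' : SameType s' t' s'' t'') : SameType s t s'' t'' :=
  ⟨h.1.trans h'.1, h.2.trans h'.2, h.3.trans h'.3⟩

theorem SameType.of_congruent {s s' : Sym2 (Fin 3) → ℂ} {t t' : Fin 3 → ℂ}
    (g : Matrix (Fin 3) (Fin 3) ℂ) (hg : g.det ≠ 0)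
    (hs : symMat s' = gᵀ * symMat s * g) (ht : t' = gᵀ *ᵥ t) : SameType s t s' t' := by
  have hu : IsUnit g.det := isUnit_iff_ne_zero.2 hg
  refine ⟨linEquivIdeal_of_congruent g hu hs ht, ?_, ?_⟩
  · have : tSt s' t' = g.det ^ 2 * tSt s t := by
      have h1 : g.adjugateᵀ *ᵥ (gᵀ *ᵥ t) = g.det • t := by
        rw [Matrix.mulVec_mulVec, ← Matrix.transpose_mul, Matrix.mul_adjugate,
          Matrix.transpose_smul, Matrix.transpose_one, Matrix.smul_mulVec, Matrix.one_mulVec]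
      rw [tSt, hs, ht, Matrix.adjugate_mul_distrib, Matrix.adjugate_mul_distrib,
        ← Matrix.mulVec_mulVec, ← Matrix.mulVec_mulVec, Matrix.dotProduct_mulVec,
        ← Matrix.mulVec_transpose, ← Matrix.adjugate_transpose, h1, Matrix.mulVec_smul,
        dotProduct_smul, smul_dotProduct, smul_eq_mul, smul_eq_mul, tSt]
      ring
    rw [this, mul_eq_zero, or_iff_right (pow_ne_zero 2 hg)]
  · have h1 : g.det • skewMat t = g * skewMat t' * gᵀ := by
      rw [← skewMat_adjugate_transpose_mulVec, ht, Matrix.mulVec_mulVec, ← Matrix.transpose_mul,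
        Matrix.mul_adjugate, Matrix.transpose_smul, Matrix.transpose_one, Matrix.smul_mulVec,
        Matrix.one_mulVec]
      ext i j
      fin_cases i <;> fin_cases j <;> simp [skewMat]
    have h2 : (g.det ^ 2) • matBSB s t = g * matBSB s' t' * gᵀ := by
      have : (g.det ^ 2) • matBSB s t = (g.det • skewMat t) * symMat s * (g.det • skewMat t) := by
        simp [matBSB, smul_smul, sq]
      rw [this, h1, matBSB, hs]
      simp only [Matrix.mul_assoc]
    have h3 : ((g.det ^ 2) • matBSB s t).rank = (matBSB s t).rank :=
      Matrix.rank_smul_of_mem_nonZeroDivisors _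
        (mem_nonZeroDivisors_of_ne_zero (pow_ne_zero 2 hg))
    rw [← h3, h2, Matrix.rank_mul_eq_left_of_isUnit_det _ _ (by simpa using hg),
      Matrix.rank_mul_eq_right_of_isUnit_det _ _ hu]

theorem SameType.of_shift {s s' : Sym2 (Fin 3) → ℂ} {t : Fin 3 → ℂ} (w : Fin 3 → ℂ)
    (hs : symMat s' = symMat s + Matrix.vecMulVec t w + Matrix.vecMulVec w t) :
    SameType s t s' t := by
  refine ⟨linEquivIdeal_of_shift w hs, iff_of_eq (congrArg (· = 0) ?_), congrArg _ ?_⟩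
  · have hS := symMat_isSymm s
    have h10 := hS.apply 0 1
    have h20 := hS.apply 0 2
    have h21 := hS.apply 1 2
    rw [tSt, tSt, hs]
    simp only [dotProduct_fin_three, mulVec_fin_three, Matrix.adjugate_fin_three, Matrix.of_apply,
      Matrix.cons_val', Matrix.cons_val_zero, Matrix.cons_val_one, Matrix.cons_val,
      Matrix.add_apply, Matrix.vecMulVec_apply, h10, h20, h21]
    ring
  · have h1 : skewMat t *ᵥ t = 0 := by
      rw [skewMat_mulVec]
      ext i
      fin_cases i <;> simp <;> ring
    have h2 : Matrix.vecMul t (skewMat t) = 0 := by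
      rw [← Matrix.mulVec_transpose]
      have : (skewMat t)ᵀ = -skewMat t := by
        ext i j
        fin_cases i <;> fin_cases j <;> simp [skewMat]
      rw [this, Matrix.neg_mulVec, h1, neg_zero]
    rw [matBSB, matBSB, hs, Matrix.mul_add, Matrix.mul_add, Matrix.add_mul, Matrix.add_mul,
      Matrix.mul_vecMulVec, Matrix.mul_vecMulVec, Matrix.vecMulVec_mul, Matrix.vecMulVec_mul, h1,
        h2]
    simp

theorem exists_transpose_mulVec_eq (t : Fin 3 → ℂ) (ht : t ≠ 0) :
    ∃ g : Matrix (Fin 3) (Fin 3) ℂ, g.det ≠ 0 ∧ ![1, 0, 0] = gᵀ *ᵥ t := by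
  by_cases h0 : t 0 = 0
  · by_cases h1 : t 1 = 0
    · have h2 : t 2 ≠ 0 := fun h2 => ht <| by
        ext i
        fin_cases i <;> assumption
      refine ⟨!![0, 1, 0; 0, 0, 1; (t 2)⁻¹, 0, 0], ?_, ?_⟩
      · simp [Matrix.det_fin_three, h2]
      · rw [funext_fin_three_iff]
        simp [mulVec_fin_three, h0, h1, h2]
    · refine ⟨!![0, 1, 0; (t 1)⁻¹, 0, -t 2 / t 1; 0, 0, 1], ?_, ?_⟩
      · simp [Matrix.det_fin_three, h1]
      · rw [funext_fin_three_iff]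
        simp [mulVec_fin_three, h0, h1]
  · refine ⟨!![(t 0)⁻¹, -t 1 / t 0, -t 2 / t 0; 0, 1, 0; 0, 0, 1], ?_, ?_⟩
    · simp [Matrix.det_fin_three, h0]
    · rw [funext_fin_three_iff]
      simp [mulVec_fin_three, h0]

/-- Normal forms of binary quadratic forms. -/
theorem exists_binary_normalForm (a b c : ℂ) : ∃ x y z w : ℂ, x * w - y * z ≠ 0 ∧
    ((a * c - b ^ 2 ≠ 0 ∧ a * x ^ 2 + 2 * b * x * z + c * z ^ 2 = 0 ∧
      a * x * y + b * (x * w + y * z) + c * z * w = 1 ∧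
      a * y ^ 2 + 2 * b * y * w + c * w ^ 2 = 0) ∨
     (a * c - b ^ 2 = 0 ∧ a * x ^ 2 + 2 * b * x * z + c * z ^ 2 = 0 ∧
      a * x * y + b * (x * w + y * z) + c * z * w = 0 ∧
      a * y ^ 2 + 2 * b * y * w + c * w ^ 2 = 1) ∨
     (a = 0 ∧ b = 0 ∧ c = 0)) := by
  by_cases hD : a * c - b ^ 2 = 0
  · by_cases hc : c = 0
    · have hb : b = 0 := by simpa [hc] using hD
      by_cases ha : a = 0
      · exact ⟨1, 0, 0, 1, by simp, Or.inr (Or.inr ⟨ha, hb, hc⟩)⟩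
      · obtain ⟨e, he⟩ := IsAlgClosed.exists_eq_mul_self a
        have he0 : e ≠ 0 := by rintro rfl; simp at he; exact ha he
        refine ⟨0, e⁻¹, 1, 0, by simp [he0], Or.inr
          (Or.inl ⟨hD, by simp [hc], by simp [hb, hc], ?_⟩)⟩
        rw [he]
        field_simp
        simp
    · obtain ⟨e, he⟩ := IsAlgClosed.exists_eq_mul_self c
      have he0 : e ≠ 0 := by rintro rfl; simp at he; exact hc he
      have ha : a = b ^ 2 / c := by field_simp; linear_combination hD
      refine ⟨1, 0, -b / c, e⁻¹, by simp [he0], Or.inr (Or.inl ⟨hD, ?_, ?_, ?_⟩)⟩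
      · rw [ha]
        field_simp
        ring
      · field_simp
        ring
      · rw [he]
        field_simp
        simp
  · obtain ⟨d, hd⟩ := IsAlgClosed.exists_eq_mul_self (b ^ 2 - a * c)
    have hd0 : d ≠ 0 := by
      rintro rfl
      exact hD (by linear_combination -hd)
    by_cases ha : a = 0
    · have hb : b ≠ 0 := by rintro rfl; simp [ha] at hD
      refine ⟨1, -c / (2 * b) / b, 0, 1 / b, by simp [hb], Or.inl ⟨hD, by simp [ha], ?_, ?_⟩⟩
      · rw [ha]
        field_simp
        ring
      · rw [ha]
        field_simp
        ring
    · refine ⟨-b + d, (-b - d) / (-2 * a * d ^ 2), a, a / (-2 * a * d ^ 2), ?_,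
        Or.inl ⟨hD, ?_, ?_, ?_⟩⟩
      · have : (-b + d) * (a / (-2 * a * d ^ 2)) - (-b - d) / (-2 * a * d ^ 2) * a = -1 / d := by
          field_simp
          ring
        rw [this]
        simp [hd0]
      · linear_combination -a * hd
      · field_simp
        linear_combination hd
      · field_simp
        linear_combination -hd

theorem rank_diagonal_fin_three (w : Fin 3 → ℂ) : (Matrix.diagonal w).rank =
    (if w 0 ≠ 0 then 1 else 0) + (if w 1 ≠ 0 then 1 else 0) + (if w 2 ≠ 0 then 1 else 0) := by
  classical
  rw [Matrix.rank_diagonal, Fintype.card_subtype, Finset.card_filter, Fin.sum_univ_three]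

theorem matrix_rank_eq_zero_iff (A : Matrix (Fin 3) (Fin 3) ℂ) : A.rank = 0 ↔ A = 0 := by
  refine ⟨fun h => ?_, fun h => by rw [h, Matrix.rank_zero]⟩
  rw [Matrix.rank, Submodule.finrank_eq_zero, LinearMap.range_eq_bot] at h
  exact Matrix.mulVec_injective (funext fun v => by simpa using LinearMap.congr_fun h v)

/-- Over points with `t ≠ 0` there are three types of fibres. -/
theorem exists_sameType_of_ne_zero (s : Sym2 (Fin 3) → ℂ) (t : Fin 3 → ℂ) (ht : t ≠ 0) :
    ∃ s' : Sym2 (Fin 3) → ℂ, SameType s t s' ![1, 0, 0] ∧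
      (symMat s' = !![0, 0, 0; 0, 0, 1; 0, 1, 0] ∨ symMat s' = !![0, 0, 0; 0, 0, 0; 0, 0, 1] ∨
        symMat s' = 0) := by
  obtain ⟨g, hg, hgt⟩ := exists_transpose_mulVec_eq t ht
  obtain ⟨s₁, hs₁⟩ := exists_symMat_eq (gᵀ * symMat s * g) (by
    rw [Matrix.IsSymm, Matrix.transpose_mul, Matrix.transpose_mul, Matrix.transpose_transpose,
      (symMat_isSymm s).eq, Matrix.mul_assoc])
  have h1 := SameType.of_congruent g hg hs₁ hgt
  have hS := symMat_isSymm s₁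
  have h10 := hS.apply 0 1
  have h20 := hS.apply 0 2
  have h21 := hS.apply 1 2
  have hdiag : symMat s₁ 0 0 - symMat s₁ 0 0 / 2 - symMat s₁ 0 0 / 2 = 0 := by ring
  obtain ⟨s₂, hs₂⟩ := exists_symMat_eq (!![0, 0, 0; 0, symMat s₁ 1 1, symMat s₁ 1 2;
    0, symMat s₁ 1 2, symMat s₁ 2 2]) (by
      ext i j
      fin_cases i <;> fin_cases j <;> rfl)
  have h2 : SameType s₁ ![1, 0, 0] s₂ ![1, 0, 0] := by
    refine SameType.of_shift ![-symMat s₁ 0 0 / 2, -symMat s₁ 0 1, -symMat s₁ 0 2] ?_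
    rw [hs₂]
    ext i j
    fin_cases i <;> fin_cases j <;> simp [h10, h20, h21]
    ring
  obtain ⟨x, y, z, w, hdet, h⟩ := exists_binary_normalForm (symMat s₁ 1 1) (symMat s₁ 1 2)
    (symMat s₁ 2 2)
  have key : ∀ (A B C : ℂ),
      symMat s₁ 1 1 * x ^ 2 + 2 * symMat s₁ 1 2 * x * z + symMat s₁ 2 2 * z ^ 2 = A →
      symMat s₁ 1 1 * x * y + symMat s₁ 1 2 * (x * w + y * z) + symMat s₁ 2 2 * z * w = B →
      symMat s₁ 1 1 * y ^ 2 + 2 * symMat s₁ 1 2 * y * w + symMat s₁ 2 2 * w ^ 2 = C →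
      ∃ s₃, SameType s t s₃ ![1, 0, 0] ∧ symMat s₃ = !![0, 0, 0; 0, A, B; 0, B, C] := by
    intro A B C hA hB hC
    obtain ⟨s₃, hs₃⟩ := exists_symMat_eq (!![0, 0, 0; 0, A, B; 0, B, C]) (by
      ext i j
      fin_cases i <;> fin_cases j <;> rfl)
    refine ⟨s₃, (h1.trans h2).trans
      (SameType.of_congruent !![1, 0, 0; 0, x, y; 0, z, w] ?_ ?_ ?_), hs₃⟩
    · simpa [Matrix.det_fin_three] using hdet
    · rw [hs₃, hs₂, ← hA, ← hB, ← hC]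
      ext i j
      fin_cases i <;> fin_cases j <;> simp [Matrix.mul_apply, Fin.sum_univ_three] <;> ring
    · rw [funext_fin_three_iff]
      simp [mulVec_fin_three]
  rcases h with ⟨-, hA, hB, hC⟩ | ⟨-, hA, hB, hC⟩ | ⟨hA, hB, hC⟩
  · obtain ⟨s₃, h, hs₃⟩ := key 0 1 0 hA hB hC
    exact ⟨s₃, h, Or.inl hs₃⟩
  · obtain ⟨s₃, h, hs₃⟩ := key 0 0 1 hA hB hC
    exact ⟨s₃, h, Or.inr (Or.inl hs₃)⟩
  · obtain ⟨s₃, h, hs₃⟩ := key 0 0 0 (by simp [hA, hB, hC]) (by simp [hA, hB, hC])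
      (by simp [hA, hB, hC])
    refine ⟨s₃, h, Or.inr (Or.inr ?_)⟩
    rw [hs₃]
    ext i j
    fin_cases i <;> fin_cases j <;> rfl

theorem tSt_of_hyperbolic {s : Sym2 (Fin 3) → ℂ} (hs : symMat s = !![0, 0, 0; 0, 0, 1; 0, 1, 0]) :
    tSt s ![1, 0, 0] = -1 := by
  simp [tSt, hs, Matrix.adjugate_fin_three, Matrix.vecHead]

theorem rank_matBSB_of_hyperbolic {s : Sym2 (Fin 3) → ℂ}
    (hs : symMat s = !![0, 0, 0; 0, 0, 1; 0, 1, 0]) : (matBSB s ![1, 0, 0]).rank = 2 := by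
  have : matBSB s ![1, 0, 0] = Matrix.diagonal ![0, 1, 1] * !![1, 0, 0; 0, 0, 1; 0, 1, 0] := by
    rw [matBSB, hs]
    ext i j
    fin_cases i <;> fin_cases j <;> simp [skewMat, Matrix.mul_apply, Fin.sum_univ_three]
  rw [this, Matrix.rank_mul_eq_left_of_isUnit_det _ _ (by simp [Matrix.det_fin_three]),
    rank_diagonal_fin_three]
  simp

theorem tSt_of_square {s : Sym2 (Fin 3) → ℂ} (hs : symMat s = !![0, 0, 0; 0, 0, 0; 0, 0, 1]) :
    tSt s ![1, 0, 0] = 0 := by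
  simp [tSt, hs, Matrix.adjugate_fin_three, Matrix.vecHead]

theorem rank_matBSB_of_square {s : Sym2 (Fin 3) → ℂ}
    (hs : symMat s = !![0, 0, 0; 0, 0, 0; 0, 0, 1]) : (matBSB s ![1, 0, 0]).rank = 1 := by
  have : matBSB s ![1, 0, 0] = Matrix.diagonal ![0, -1, 0] := by
    rw [matBSB, hs]
    ext i j
    fin_cases i <;> fin_cases j <;> simp [skewMat, Matrix.mul_apply, Fin.sum_univ_three]
  rw [this, rank_diagonal_fin_three]
  simp

/-- If `B S B = 0` and `t ≠ 0`, then `S` is not invertible. -/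
theorem matBSB_ne_zero_of_det_ne_zero {s : Sym2 (Fin 3) → ℂ} {t : Fin 3 → ℂ} (ht : t ≠ 0)
    (hs : (symMat s).det ≠ 0) : (matBSB s t).rank ≠ 0 := by
  obtain ⟨g, hg, hgt⟩ := exists_transpose_mulVec_eq t ht
  obtain ⟨s₁, hs₁⟩ := exists_symMat_eq (gᵀ * symMat s * g) (by
    rw [Matrix.IsSymm, Matrix.transpose_mul, Matrix.transpose_mul, Matrix.transpose_transpose,
      (symMat_isSymm s).eq, Matrix.mul_assoc])
  rw [(SameType.of_congruent g hg hs₁ hgt).rank_eq, Ne, matrix_rank_eq_zero_iff]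
  have hd : (symMat s₁).det ≠ 0 := by simp [hs₁, hg, hs]
  contrapose! hd
  rw [matBSB] at hd
  have h11 := congrFun (congrFun hd 2) 2
  have h12 := congrFun (congrFun hd 1) 2
  have h22 := congrFun (congrFun hd 1) 1
  have h21 := congrFun (congrFun hd 2) 1
  simp [skewMat, Matrix.mul_apply, Fin.sum_univ_three, Matrix.vecMul, dotProduct] at h11 h12 h22 h21
  simp [Matrix.det_fin_three, h11, h12, h22, h21]

theorem exists_congruent_diagonal (S : Matrix (Fin 3) (Fin 3) ℂ) (hS : S.IsSymm) :
    ∃ (g : Matrix (Fin 3) (Fin 3) ℂ) (w : Fin 3 → ℂ), g.det ≠ 0 ∧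
      gᵀ * S * g = Matrix.diagonal w := by
  let _ : Invertible (2 : ℂ) := invertibleOfNonzero two_ne_zero
  have hB : LinearMap.IsSymm (Matrix.toBilin' S) := ⟨fun x y => by
    rw [Matrix.toBilin'_apply', Matrix.toBilin'_apply', RingHom.id_apply, dotProduct_comm,
      ← Matrix.vecMul_transpose, hS.eq, Matrix.dotProduct_mulVec]⟩
  obtain ⟨b, hb⟩ := LinearMap.BilinForm.exists_orthogonal_basis hB
  have h3 : Module.finrank ℂ (Fin 3 → ℂ) = 3 := by simp
  let b' := b.reindex (finCongr h3)
  have hb' : ∀ i j, i ≠ j → b' i ⬝ᵥ (S *ᵥ b' j) = 0 := by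
    intro i j hij
    rw [← Matrix.toBilin'_apply']
    simp only [b', Module.Basis.reindex_apply]
    exact hb (fun h => hij ((finCongr h3).symm.injective h))
  refine ⟨(Pi.basisFun ℂ (Fin 3)).toMatrix b', fun i => b' i ⬝ᵥ (S *ᵥ b' i), ?_, ?_⟩
  · have := (Pi.basisFun ℂ (Fin 3)).invertibleToMatrix b'
    exact (Matrix.isUnit_det_of_invertible _).ne_zero
  · ext i j
    have : (((Pi.basisFun ℂ (Fin 3)).toMatrix b')ᵀ * S * (Pi.basisFun ℂ (Fin 3)).toMatrix b') i j =
        b' i ⬝ᵥ (S *ᵥ b' j) := by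
      rw [Matrix.mul_assoc, Matrix.mul_apply']
      congr 1
    rw [this, Matrix.diagonal_apply]
    split_ifs with h
    · rw [h]
    · exact hb' i j h

theorem exists_perm_antitone (ε : Fin 3 → Bool) : ∃ e : Equiv.Perm (Fin 3),
    ε ∘ e = ![true, true, true] ∨ ε ∘ e = ![true, true, false] ∨
    ε ∘ e = ![true, false, false] ∨ ε ∘ e = ![false, false, false] := by
  revert ε
  decide

/-- Complex symmetric matrices are classified by their rank. -/
theorem exists_congruent_normalForm (S : Matrix (Fin 3) (Fin 3) ℂ) (hS : S.IsSymm) :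
    ∃ g : Matrix (Fin 3) (Fin 3) ℂ, g.det ≠ 0 ∧
      ((S.rank = 3 ∧ gᵀ * S * g = Matrix.diagonal ![1, 1, 1]) ∨
      (S.rank = 2 ∧ gᵀ * S * g = Matrix.diagonal ![1, 1, 0]) ∨
      (S.rank = 1 ∧ gᵀ * S * g = Matrix.diagonal ![1, 0, 0]) ∨
      (S.rank = 0 ∧ gᵀ * S * g = 0)) := by
  classical
  obtain ⟨g, w, hg, h⟩ := exists_congruent_diagonal S hS
  obtain ⟨e, he⟩ := exists_perm_antitone (fun i => decide (w i ≠ 0))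
  have hsq : ∀ i, ∃ z : ℂ, z ≠ 0 ∧ z * w i * z = if w i ≠ 0 then 1 else 0 := by
    intro i
    by_cases hi : w i = 0
    · exact ⟨1, by simp, by simp [hi]⟩
    · obtain ⟨z, hz⟩ := IsAlgClosed.exists_eq_mul_self (w i)
      have hz0 : z ≠ 0 := by rintro rfl; simp at hz; exact hi hz
      refine ⟨z⁻¹, inv_ne_zero hz0, ?_⟩
      rw [if_pos hi, hz]
      field_simp
  choose z hz0 hz using hsq
  let P : Matrix (Fin 3) (Fin 3) ℂ := (Matrix.diagonal z).submatrix id e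
  have hP : P.det ≠ 0 := by
    have : P = Matrix.diagonal z * (1 : Matrix (Fin 3) (Fin 3) ℂ).submatrix id e := by
      ext i j
      simp [P, Matrix.diagonal_apply, Matrix.one_apply]
    rw [this, Matrix.det_mul, Matrix.det_permute']
    simp [Finset.prod_eq_zero_iff, hz0]
  have hgP : (g * P)ᵀ * S * (g * P) =
      Matrix.diagonal (fun i => if (decide (w (e i) ≠ 0)) = true then 1 else 0) := by
    have h1 : (g * P)ᵀ * S * (g * P) = Pᵀ * (gᵀ * S * g) * P := by
      rw [Matrix.transpose_mul]
      simp only [Matrix.mul_assoc]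
    rw [h1, h]
    have h2 : Pᵀ * Matrix.diagonal w * P =
        (Matrix.diagonal z * Matrix.diagonal w * Matrix.diagonal z).submatrix e e := by
      ext i j
      simp +contextual [P, Matrix.mul_apply, Matrix.diagonal_apply]
    rw [h2, Matrix.diagonal_mul_diagonal, Matrix.diagonal_mul_diagonal,
      Matrix.submatrix_diagonal_equiv]
    congr 1
    ext i
    simp [Function.comp, hz]
  have hdet : (g * P).det ≠ 0 := by
    rw [Matrix.det_mul]
    exact mul_ne_zero hg hP
  have hrank : S.rank = ((g * P)ᵀ * S * (g * P)).rank := by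
    rw [Matrix.rank_mul_eq_left_of_isUnit_det _ _ (isUnit_iff_ne_zero.2 hdet),
      Matrix.rank_mul_eq_right_of_isUnit_det _ _ (by
        rw [Matrix.det_transpose]
        exact isUnit_iff_ne_zero.2 hdet)]
  have hd : ∀ ε : Fin 3 → Bool, (fun i => decide (w i ≠ 0)) ∘ e = ε →
      (g * P)ᵀ * S * (g * P) = Matrix.diagonal (fun i => if ε i = true then (1 : ℂ) else 0) := by
    rintro _ rfl
    exact hgP
  refine ⟨g * P, hdet, ?_⟩
  rw [hrank]
  rcases he with he | he | he | he
  · left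
    have : (fun i => if (![true, true, true] : Fin 3 → Bool) i = true then (1 : ℂ) else 0) =
      ![1, 1, 1] := by ext i; fin_cases i <;> simp
    rw [hd _ he, this, rank_diagonal_fin_three]
    simp
  · right; left
    have : (fun i => if (![true, true, false] : Fin 3 → Bool) i = true then (1 : ℂ) else 0) =
      ![1, 1, 0] := by ext i; fin_cases i <;> simp
    rw [hd _ he, this, rank_diagonal_fin_three]
    simp
  · right; right; left
    have : (fun i => if (![true, false, false] : Fin 3 → Bool) i = true then (1 : ℂ) else 0) =
      ![1, 0, 0] := by ext i; fin_cases i <;> simp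
    rw [hd _ he, this, rank_diagonal_fin_three]
    simp
  · right; right; right
    have : (fun i => if (![false, false, false] : Fin 3 → Bool) i = true then (1 : ℂ) else 0) =
      0 := by ext i; fin_cases i <;> simp
    rw [hd _ he, this]
    simp

theorem tSt_eq_zero_of_rank_eq_one {s : Sym2 (Fin 3) → ℂ} (t : Fin 3 → ℂ)
    (hs : (symMat s).rank = 1) : tSt s t = 0 := by
  obtain ⟨g, hg, h⟩ := exists_congruent_normalForm _ (symMat_isSymm s)
  simp only [hs] at h
  norm_num at h
  obtain ⟨s', hs'⟩ := exists_symMat_eq (gᵀ * symMat s * g) (by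
    rw [h]
    exact Matrix.isSymm_diagonal _)
  rw [(SameType.of_congruent g hg hs' rfl).tSt_eq_zero_iff, tSt, hs', h, dotProduct_fin_three]
  simp [mulVec_fin_three, Matrix.adjugate_fin_three, -Matrix.adjugate_diagonal]

/-- Over points with `t = 0` the type of the fibre depends on the rank of `S`. -/
theorem exists_sameType_zero (s : Sym2 (Fin 3) → ℂ) :
    ∃ s' : Sym2 (Fin 3) → ℂ, SameType s 0 s' 0 ∧
      (((symMat s).rank = 3 ∧ symMat s' = !![0, 0, 1; 0, -2, 0; 1, 0, 0]) ∨
      ((symMat s).rank = 2 ∧ symMat s' = !![0, 1, 0; 1, 0, 0; 0, 0, 0]) ∨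
      ((symMat s).rank = 1 ∧ symMat s' = !![1, 0, 0; 0, 0, 0; 0, 0, 0]) ∨
      ((symMat s).rank = 0 ∧ symMat s' = 0)) := by
  obtain ⟨g, hg, h⟩ := exists_congruent_normalForm _ (symMat_isSymm s)
  have key : ∀ (k S' : Matrix (Fin 3) (Fin 3) ℂ), k.det ≠ 0 → S'.IsSymm →
      kᵀ * (gᵀ * symMat s * g) * k = S' → ∃ s', SameType s 0 s' 0 ∧ symMat s' = S' := by
    intro k S' hk hS' h
    obtain ⟨s', hs'⟩ := exists_symMat_eq S' hS'
    refine ⟨s', SameType.of_congruent (g * k) ?_ ?_ ?_, hs'⟩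
    · rw [Matrix.det_mul]
      exact mul_ne_zero hg hk
    · rw [hs', ← h, Matrix.transpose_mul]
      simp only [Matrix.mul_assoc]
    · simp
  have hI : Complex.I * Complex.I = -1 := Complex.I_mul_I
  rcases h with ⟨hr, h⟩ | ⟨hr, h⟩ | ⟨hr, h⟩ | ⟨hr, h⟩
  · obtain ⟨c, hc⟩ := IsAlgClosed.exists_eq_mul_self (-2 : ℂ)
    have hc0 : c ≠ 0 := by rintro rfl; simp at hc
    obtain ⟨s', h1, h2⟩ := key !![1, 0, 1 / 2; Complex.I, 0, -Complex.I / 2; 0, c, 0]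
      !![0, 0, 1; 0, -2, 0; 1, 0, 0] (by
        simp only [Matrix.det_fin_three, Matrix.of_apply, Matrix.cons_val', Matrix.cons_val_zero,
          Matrix.cons_val_one, Matrix.cons_val]
        have : (1 * 0 * 0 - 1 * (-Complex.I / 2) * c - 0 * Complex.I * 0 + 0 * (-Complex.I / 2) *
          0 + 1 / 2 * Complex.I * c - 1 / 2 * 0 * 0 : ℂ) = Complex.I * c := by ring
        rw [this]
        exact mul_ne_zero Complex.I_ne_zero hc0) (by
          ext i j
          fin_cases i <;> fin_cases j <;> rfl) (by
          rw [h]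
          ext i j
          fin_cases i <;> fin_cases j <;>
            simp [Matrix.mul_apply, Fin.sum_univ_three, ← hc] <;>
            first
            | linear_combination 0
            | linear_combination (-1 / 2) * hI
            | linear_combination (1 / 4) * hI)
    exact ⟨s', h1, Or.inl ⟨hr, h2⟩⟩
  · obtain ⟨s', h1, h2⟩ := key !![1, 1 / 2, 0; Complex.I, -Complex.I / 2, 0; 0, 0, 1]
      !![0, 1, 0; 1, 0, 0; 0, 0, 0] (by
        simp [Matrix.det_fin_three]
        ring_nf
        simp) (by
          ext i j
          fin_cases i <;> fin_cases j <;> rfl) (by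
          rw [h]
          ext i j
          fin_cases i <;> fin_cases j <;>
            simp [Matrix.mul_apply, Fin.sum_univ_three] <;>
            first
            | linear_combination 0
            | linear_combination (-1 / 2) * hI
            | linear_combination (1 / 4) * hI)
    exact ⟨s', h1, Or.inr (Or.inl ⟨hr, h2⟩)⟩
  · obtain ⟨s', h1, h2⟩ := key 1
      !![1, 0, 0; 0, 0, 0; 0, 0, 0] (by simp) (by
          ext i j
          fin_cases i <;> fin_cases j <;> rfl) (by
          rw [h]
          ext i j
          fin_cases i <;> fin_cases j <;> simp)
    exact ⟨s', h1, Or.inr (Or.inr (Or.inl ⟨hr, h2⟩))⟩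
  · obtain ⟨s', h1, h2⟩ := key 1 0 (by simp) (by simp) (by simp [h])
    exact ⟨s', h1, Or.inr (Or.inr (Or.inr ⟨hr, h2⟩))⟩

/-! ### The nine equations in coordinates -/

/-- The family, indexed by the coordinates of `ℙ⁸`, with the given components. -/
def keyFamily {T : Type*} (p : Fin 3 → T) (p4 : T) (q : Fin 3 → T) (r u : T) : KeyVar → T
  | .p i => p i
  | .p4 => p4
  | .q i => q i
  | .r => r
  | .u => u

section
variable {T : Type*} (p : Fin 3 → T) (p4 : T) (q : Fin 3 → T) (r u : T)
@[simp] theorem keyFamily_p (i : Fin 3) : keyFamily p p4 q r u (KeyVar.p i) = p i := rfl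
@[simp] theorem keyFamily_p4 : keyFamily p p4 q r u .p4 = p4 := rfl
@[simp] theorem keyFamily_q (i : Fin 3) : keyFamily p p4 q r u (KeyVar.q i) = q i := rfl
@[simp] theorem keyFamily_r : keyFamily p p4 q r u .r = r := rfl
@[simp] theorem keyFamily_u : keyFamily p p4 q r u .u = u := rfl

theorem KeyVar.forall_iff {P : KeyVar → Prop} : (∀ v, P v) ↔
    ((P (KeyVar.p 0) ∧ P (KeyVar.p 1) ∧ P (KeyVar.p 2)) ∧ P .p4 ∧
      (P (KeyVar.q 0) ∧ P (KeyVar.q 1) ∧ P (KeyVar.q 2)) ∧ P .r ∧ P .u) := by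
  refine ⟨fun h => ⟨⟨h _, h _, h _⟩, h _, ⟨h _, h _, h _⟩, h _, h _⟩, fun h v => ?_⟩
  obtain ⟨⟨h1, h2, h3⟩, h4, ⟨h5, h6, h7⟩, h8, h9⟩ := h
  rcases v with i | _ | i | _ | _
  · fin_cases i <;> assumption
  · assumption
  · fin_cases i <;> assumption
  · assumption
  · assumption
end

variable {T : Type} [CommRing T]

theorem segreMinors_le_ker_iff {a b : ℕ} [Algebra ℂ T]
    (f : MvPolynomial (Fin a × Fin b) ℂ →ₐ[ℂ] T) :
    segreMinors a b ≤ RingHom.ker f ↔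
      ∀ i j k l, f (X (i, k)) * f (X (j, l)) = f (X (i, l)) * f (X (j, k)) := by
  rw [segreMinors, Ideal.span_le]
  constructor
  · intro h i j k l
    have := h ⟨i, j, k, l, rfl⟩
    rwa [SetLike.mem_coe, RingHom.mem_ker, map_sub, map_mul, map_mul, sub_eq_zero] at this
  · rintro h _ ⟨i, j, k, l, rfl⟩
    rw [SetLike.mem_coe, RingHom.mem_ker, map_sub, map_mul, map_mul, sub_eq_zero, h]

theorem coneSegreSectionIdeal_le_ker_iff [Algebra ℂ T]
    (f : MvPolynomial (Option (Fin 2 × Fin 4)) ℂ →ₐ[ℂ] T) :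
    coneSegreSectionIdeal ≤ RingHom.ker f ↔
      (∀ i j k l, f (X (some (i, k))) * f (X (some (j, l))) =
        f (X (some (i, l))) * f (X (some (j, k)))) ∧
      f (X (some (0, 0))) + f (X (some (1, 1))) = 0 := by
  rw [coneSegreSectionIdeal, sup_le_iff, segreIdeal_eq_segreMinors, Ideal.map_le_iff_le_comap,
    Ideal.span_singleton_le_iff_mem, RingHom.mem_ker, map_add]
  have h := segreMinors_le_ker_iff (f.comp (rename some : MvPolynomial (Fin 2 × Fin 4) ℂ →ₐ[ℂ] _))
  simp only [AlgHom.comp_apply, rename_X] at h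
  rw [← h]
  rfl

/-- A `3 × 3` matrix has rank at most one if its nine complementary minors vanish. -/
theorem minors_three_three {N : Fin 3 → Fin 3 → T}
    (h00 : N 1 1 * N 2 2 = N 1 2 * N 2 1) (h01 : N 1 0 * N 2 2 = N 1 2 * N 2 0)
    (h02 : N 1 0 * N 2 1 = N 1 1 * N 2 0) (h10 : N 0 1 * N 2 2 = N 0 2 * N 2 1)
    (h11 : N 0 0 * N 2 2 = N 0 2 * N 2 0) (h12 : N 0 0 * N 2 1 = N 0 1 * N 2 0)
    (h20 : N 0 1 * N 1 2 = N 0 2 * N 1 1) (h21 : N 0 0 * N 1 2 = N 0 2 * N 1 0)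
    (h22 : N 0 0 * N 1 1 = N 0 1 * N 1 0) (i j k l : Fin 3) :
    N i k * N j l = N i l * N j k := by
  -- it suffices to treat `i < j` and `k < l`
  have key : ∀ i j k l : Fin 3, i < j → k < l → N i k * N j l = N i l * N j k := by
    intro i j k l hij hkl
    fin_cases i <;> fin_cases j <;> fin_cases k <;> fin_cases l <;>
      first
      | exact absurd hij (by decide)
      | exact absurd hkl (by decide)
      | assumption
  rcases lt_trichotomy i j with hij | rfl | hij
  · rcases lt_trichotomy k l with hkl | rfl | hkl
    · exact key i j k l hij hkl
    · rfl
    · exact (key i j l k hij hkl).symm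
  · exact mul_comm _ _
  · rcases lt_trichotomy k l with hkl | rfl | hkl
    · linear_combination -key j i k l hij hkl
    · rfl
    · linear_combination key j i l k hij hkl

theorem minors_two_four {N : Fin 2 → Fin 4 → T}
    (h01 : N 0 0 * N 1 1 = N 0 1 * N 1 0) (h02 : N 0 0 * N 1 2 = N 0 2 * N 1 0)
    (h03 : N 0 0 * N 1 3 = N 0 3 * N 1 0) (h12 : N 0 1 * N 1 2 = N 0 2 * N 1 1)
    (h13 : N 0 1 * N 1 3 = N 0 3 * N 1 1) (h23 : N 0 2 * N 1 3 = N 0 3 * N 1 2)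
    (i j : Fin 2) (k l : Fin 4) : N i k * N j l = N i l * N j k := by
  have key : ∀ k l : Fin 4, k < l → N 0 k * N 1 l = N 0 l * N 1 k := by
    intro k l hkl
    fin_cases k <;> fin_cases l <;>
      first
      | exact absurd hkl (by decide)
      | assumption
  have key' : N 0 k * N 1 l = N 0 l * N 1 k := by
    rcases lt_trichotomy k l with hkl | rfl | hkl
    · exact key k l hkl
    · rfl
    · exact (key l k hkl).symm
  fin_cases i <;> fin_cases j
  · exact mul_comm _ _
  · exact key'
  · change N 1 k * N 0 l = N 1 l * N 0 k
    linear_combination -key'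
  · exact mul_comm _ _

theorem pTwoTwoIdeal_le_ker_iff [Algebra ℂ T]
    (f : MvPolynomial (Sym2 (Fin 3) ⊕ Fin 3) ℂ →ₐ[ℂ] T) :
    pTwoTwoIdeal.toIdeal ≤ RingHom.ker f ↔
      (symMat fun e => f (X (Sum.inl e))).adjugate = 0 ∧
      (symMat fun e => f (X (Sum.inl e))) *ᵥ (fun i => f (X (Sum.inr i))) = 0 := by
  have h0 : pTwoTwoIdeal.toIdeal ≤ RingHom.ker f ↔ ∀ g ∈ pTwoTwoEqns, f g = 0 := Ideal.span_le
  rw [h0]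
  simp only [pTwoTwoEqns, Set.mem_union, or_imp, forall_and, Set.forall_mem_range]
  refine and_congr ?_ ?_
  · have h1 : (symMat fun e => f (X (Sum.inl e))).adjugate =
        ((symMat fun e => (X (Sum.inl e) : MvPolynomial
          (Sym2 (Fin 3) ⊕ Fin 3) ℂ)).adjugate).map f :=
      (f.map_adjugate _).symm
    rw [h1, ← Matrix.ext_iff]
    exact ⟨fun h i j => h (i, j), fun h ij => h ij.1 ij.2⟩
  · rw [_root_.funext_iff]
    refine forall_congr' fun i => Eq.congr ?_ rfl
    simp only [mulVec_fin_three, map_add, map_mul]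
    rfl

/-- The nine equations, when the entries of `S` and `t` are given complex numbers. -/
theorem keyIdeal_le_ker_iff_scalar [Algebra ℂ T] {s : Sym2 (Fin 3) → ℂ}
    {t : Fin 3 → ℂ} {a00 a01 a02 a11 a12 a22 t0 t1 t2 : ℂ}
    (hs : symMat s = !![a00, a01, a02; a01, a11, a12; a02, a12, a22]) (ht : t = ![t0, t1, t2])
    (f : MvPolynomial KeyVar ℂ →ₐ[ℂ] T) (p0 p1 p2 p4 q0 q1 q2 r u : T)
    (hf : (fun v => f (X v)) = keyFamily ![p0, p1, p2] p4 ![q0, q1, q2] r u) :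
    (keyIdeal s t).toIdeal ≤ RingHom.ker f ↔
    p0 * q0 + p1 * q1 + p2 * q2 = 0 ∧
    (r * p0 + q1 * (a02 • p0 + a12 • p1 + a22 • p2)
      - q2 * (a01 • p0 + a11 • p1 + a12 • p2) + p4 * (t2 • q1 - t1 • q2) = 0 ∧
    r * p1 + q2 * (a00 • p0 + a01 • p1 + a02 • p2)
      - q0 * (a02 • p0 + a12 • p1 + a22 • p2) + p4 * (t0 • q2 - t2 • q0) = 0 ∧
    r * p2 + q0 * (a01 • p0 + a11 • p1 + a12 • p2)
      - q1 * (a00 • p0 + a01 • p1 + a02 • p2) + p4 * (t1 • q0 - t0 • q1) = 0) ∧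
    a00 • p0 ^ 2 + a11 • p1 ^ 2 + a22 • p2 ^ 2 + 2 * a01 • (p0 * p1)
      + 2 * a02 • (p0 * p2) + 2 * a12 • (p1 * p2)
      + p4 * (t0 • p0 + t1 • p1 + t2 • p2) = 0 ∧
    (u * p0 - r * (t2 • q1 - t1 • q2)
      + q1 * (a02 • (t2 • q1 - t1 • q2) + a12 • (t0 • q2 - t2 • q0) + a22 • (t1 • q0 - t0 • q1))
      - q2 * (a01 • (t2 • q1 - t1 • q2) + a11 • (t0 • q2 - t2 • q0)
        + a12 • (t1 • q0 - t0 • q1)) = 0 ∧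
    u * p1 - r * (t0 • q2 - t2 • q0)
      + q2 * (a00 • (t2 • q1 - t1 • q2) + a01 • (t0 • q2 - t2 • q0) + a02 • (t1 • q0 - t0 • q1))
      - q0 * (a02 • (t2 • q1 - t1 • q2) + a12 • (t0 • q2 - t2 • q0)
        + a22 • (t1 • q0 - t0 • q1)) = 0 ∧
    u * p2 - r * (t1 • q0 - t0 • q1)
      + q0 * (a01 • (t2 • q1 - t1 • q2) + a11 • (t0 • q2 - t2 • q0) + a12 • (t1 • q0 - t0 • q1))
      - q1 * (a00 • (t2 • q1 - t1 • q2) + a01 • (t0 • q2 - t2 • q0)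
        + a02 • (t1 • q0 - t0 • q1)) = 0) ∧
    u * p4 + r ^ 2 + ((a11 * a22 - a12 ^ 2) • q0 ^ 2 + (a00 * a22 - a02 ^ 2) • q1 ^ 2
      + (a00 * a11 - a01 ^ 2) • q2 ^ 2 + 2 * (a02 * a12 - a01 * a22) • (q0 * q1)
      + 2 * (a01 * a12 - a02 * a11) • (q0 * q2)
      + 2 * (a01 * a02 - a00 * a12) • (q1 * q2)) = 0 := by
  have hf' := fun v => congrFun hf v
  rw [KeyVar.forall_iff] at hf'
  simp only [keyFamily_p, keyFamily_p4, keyFamily_q, keyFamily_r, keyFamily_u,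
    Matrix.cons_val_zero, Matrix.cons_val_one, Matrix.cons_val] at hf'
  obtain ⟨⟨h1, h2, h3⟩, h4, ⟨h5, h6, h7⟩, h8, h9⟩ := hf'
  rw [keyIdeal_le_ker_iff, isKeySolution_iff _ ((symMat_isSymm s).map _), hs, ht]
  simp only [h1, h2, h3, h4, h5, h6, h7, h8, h9, Matrix.map_apply, Matrix.of_apply,
    Matrix.cons_val', Matrix.cons_val_zero, Matrix.cons_val_one, Matrix.cons_val,
    Algebra.smul_def, map_sub, map_mul, map_pow]
  refine and_congr ?_ (and_congr (and_congr ?_ (and_congr ?_ ?_)) (and_congr ?_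
    (and_congr (and_congr ?_ (and_congr ?_ ?_)) ?_))) <;>
  exact Eq.congr (by ring) rfl

theorem zero_fin_three : (0 : Matrix (Fin 3) (Fin 3) ℂ) = !![0, 0, 0; 0, 0, 0; 0, 0, 0] := by
  ext i j
  fin_cases i <;> fin_cases j <;> rfl

theorem zero_vec_fin_three : (0 : Fin 3 → ℂ) = ![0, 0, 0] := by
  ext i
  fin_cases i <;> rfl

theorem keyIdeal_le_ker_iff_hyperbolic [Algebra ℂ T] {s : Sym2 (Fin 3) → ℂ}
    (hs : symMat s = !![0, 0, 0; 0, 0, 1; 0, 1, 0]) (f : MvPolynomial KeyVar ℂ →ₐ[ℂ] T)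
    {p0 p1 p2 p4 q0 q1 q2 r u : T}
    (hf : (fun v => f (X v)) = keyFamily ![p0, p1, p2] p4 ![q0, q1, q2] r u) :
    (keyIdeal s ![1, 0, 0]).toIdeal ≤ RingHom.ker f ↔
      p0 * q0 + p1 * q1 + p2 * q2 = 0 ∧
      (r * p0 + q1 * p1 - q2 * p2 = 0 ∧ r * p1 - q0 * p1 + p4 * q2 = 0 ∧
        r * p2 + q0 * p2 - p4 * q1 = 0) ∧
      2 * (p1 * p2) + p4 * p0 = (0 : T) ∧
      (u * p0 + 2 * (q1 * q2) = 0 ∧ u * p1 - r * q2 - q0 * q2 = 0 ∧ u * p2 + r * q1 - q0 * q1 = 0) ∧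
      u * p4 + r ^ 2 - q0 ^ 2 = 0 := by
  rw [keyIdeal_le_ker_iff_scalar hs rfl f _ _ _ _ _ _ _ _ _ hf]
  simp only [Algebra.smul_def, map_sub, map_mul, map_pow, map_zero, map_one]
  refine and_congr ?_ (and_congr (and_congr ?_ (and_congr ?_ ?_)) (and_congr ?_
    (and_congr (and_congr ?_ (and_congr ?_ ?_)) ?_))) <;>
  exact Eq.congr (by ring) rfl

theorem keyIdeal_le_ker_iff_square [Algebra ℂ T] {s : Sym2 (Fin 3) → ℂ}
    (hs : symMat s = !![0, 0, 0; 0, 0, 0; 0, 0, 1]) (f : MvPolynomial KeyVar ℂ →ₐ[ℂ] T)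
    {p0 p1 p2 p4 q0 q1 q2 r u : T}
    (hf : (fun v => f (X v)) = keyFamily ![p0, p1, p2] p4 ![q0, q1, q2] r u) :
    (keyIdeal s ![1, 0, 0]).toIdeal ≤ RingHom.ker f ↔
      p0 * q0 + p1 * q1 + p2 * q2 = 0 ∧
      (r * p0 + q1 * p2 = 0 ∧ r * p1 - q0 * p2 + p4 * q2 = 0 ∧
        r * p2 - p4 * q1 = 0) ∧
      p2 ^ 2 + p4 * p0 = (0 : T) ∧
      (u * p0 - q1 ^ 2 = 0 ∧ u * p1 - r * q2 + q0 * q1 = 0 ∧ u * p2 + r * q1 = 0) ∧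
      u * p4 + r ^ 2 = 0 := by
  rw [keyIdeal_le_ker_iff_scalar hs rfl f _ _ _ _ _ _ _ _ _ hf]
  simp only [Algebra.smul_def, map_sub, map_mul, map_pow, map_zero, map_one]
  refine and_congr ?_ (and_congr (and_congr ?_ (and_congr ?_ ?_)) (and_congr ?_
    (and_congr (and_congr ?_ (and_congr ?_ ?_)) ?_))) <;>
  exact Eq.congr (by ring) rfl

theorem keyIdeal_le_ker_iff_zero [Algebra ℂ T] {s : Sym2 (Fin 3) → ℂ}
    (hs : symMat s = 0) (f : MvPolynomial KeyVar ℂ →ₐ[ℂ] T)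
    {p0 p1 p2 p4 q0 q1 q2 r u : T}
    (hf : (fun v => f (X v)) = keyFamily ![p0, p1, p2] p4 ![q0, q1, q2] r u) :
    (keyIdeal s ![1, 0, 0]).toIdeal ≤ RingHom.ker f ↔
      p0 * q0 + p1 * q1 + p2 * q2 = 0 ∧
      (r * p0 = 0 ∧ r * p1 + p4 * q2 = 0 ∧
        r * p2 - p4 * q1 = 0) ∧
      p4 * p0 = (0 : T) ∧
      (u * p0 = 0 ∧ u * p1 - r * q2 = 0 ∧ u * p2 + r * q1 = 0) ∧
      u * p4 + r ^ 2 = 0 := by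
  rw [keyIdeal_le_ker_iff_scalar (hs.trans zero_fin_three) rfl f _ _ _ _ _ _ _ _ _ hf]
  simp only [Algebra.smul_def, map_sub, map_mul, map_pow, map_zero, map_one]
  refine and_congr ?_ (and_congr (and_congr ?_ (and_congr ?_ ?_)) (and_congr ?_
    (and_congr (and_congr ?_ (and_congr ?_ ?_)) ?_))) <;>
  exact Eq.congr (by ring) rfl

theorem keyIdeal_le_ker_iff_rank_three [Algebra ℂ T] {s : Sym2 (Fin 3) → ℂ}
    (hs : symMat s = !![0, 0, 1; 0, -2, 0; 1, 0, 0]) (f : MvPolynomial KeyVar ℂ →ₐ[ℂ] T)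
    {p0 p1 p2 p4 q0 q1 q2 r u : T}
    (hf : (fun v => f (X v)) = keyFamily ![p0, p1, p2] p4 ![q0, q1, q2] r u) :
    (keyIdeal s 0).toIdeal ≤ RingHom.ker f ↔
      p0 * q0 + p1 * q1 + p2 * q2 = 0 ∧
      (r * p0 + q1 * p0 + 2 * (q2 * p1) = 0 ∧ r * p1 + q2 * p2 - q0 * p0 = 0 ∧
        r * p2 - 2 * (q0 * p1) - q1 * p2 = 0) ∧
      2 * (p0 * p2 - p1 ^ 2) = (0 : T) ∧
      (u * p0 = 0 ∧ u * p1 = 0 ∧ u * p2 = 0) ∧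
      u * p4 + (r ^ 2 + 4 * (q0 * q2) - q1 ^ 2) = 0 := by
  rw [keyIdeal_le_ker_iff_scalar hs zero_vec_fin_three f _ _ _ _ _ _ _ _ _ hf]
  simp only [Algebra.smul_def, map_sub, map_mul, map_pow, map_zero, map_one, map_neg, map_ofNat]
  refine and_congr ?_ (and_congr (and_congr ?_ (and_congr ?_ ?_)) (and_congr ?_
    (and_congr (and_congr ?_ (and_congr ?_ ?_)) ?_))) <;>
  exact Eq.congr (by ring) rfl

theorem keyIdeal_le_ker_iff_rank_two [Algebra ℂ T] {s : Sym2 (Fin 3) → ℂ}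
    (hs : symMat s = !![0, 1, 0; 1, 0, 0; 0, 0, 0]) (f : MvPolynomial KeyVar ℂ →ₐ[ℂ] T)
    {p0 p1 p2 p4 q0 q1 q2 r u : T}
    (hf : (fun v => f (X v)) = keyFamily ![p0, p1, p2] p4 ![q0, q1, q2] r u) :
    (keyIdeal s 0).toIdeal ≤ RingHom.ker f ↔
      p0 * q0 + p1 * q1 + p2 * q2 = 0 ∧
      (r * p0 - q2 * p0 = 0 ∧ r * p1 + q2 * p1 = 0 ∧
        r * p2 + q0 * p0 - q1 * p1 = 0) ∧
      2 * (p0 * p1) = (0 : T) ∧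
      (u * p0 = 0 ∧ u * p1 = 0 ∧ u * p2 = 0) ∧
      u * p4 + (r ^ 2 - q2 ^ 2) = 0 := by
  rw [keyIdeal_le_ker_iff_scalar hs zero_vec_fin_three f _ _ _ _ _ _ _ _ _ hf]
  simp only [Algebra.smul_def, map_sub, map_mul, map_pow, map_zero, map_one]
  refine and_congr ?_ (and_congr (and_congr ?_ (and_congr ?_ ?_)) (and_congr ?_
    (and_congr (and_congr ?_ (and_congr ?_ ?_)) ?_))) <;>
  exact Eq.congr (by ring) rfl

theorem keyIdeal_le_ker_iff_rank_one [Algebra ℂ T] {s : Sym2 (Fin 3) → ℂ}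
    (hs : symMat s = !![1, 0, 0; 0, 0, 0; 0, 0, 0]) (f : MvPolynomial KeyVar ℂ →ₐ[ℂ] T)
    {p0 p1 p2 p4 q0 q1 q2 r u : T}
    (hf : (fun v => f (X v)) = keyFamily ![p0, p1, p2] p4 ![q0, q1, q2] r u) :
    (keyIdeal s 0).toIdeal ≤ RingHom.ker f ↔
      p0 * q0 + p1 * q1 + p2 * q2 = 0 ∧
      (r * p0 = 0 ∧ r * p1 + q2 * p0 = 0 ∧
        r * p2 - q1 * p0 = 0) ∧
      p0 ^ 2 = (0 : T) ∧
      (u * p0 = 0 ∧ u * p1 = 0 ∧ u * p2 = 0) ∧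
      u * p4 + r ^ 2 = 0 := by
  rw [keyIdeal_le_ker_iff_scalar hs zero_vec_fin_three f _ _ _ _ _ _ _ _ _ hf]
  simp only [Algebra.smul_def, map_sub, map_mul, map_pow, map_zero, map_one]
  refine and_congr ?_ (and_congr (and_congr ?_ (and_congr ?_ ?_)) (and_congr ?_
    (and_congr (and_congr ?_ (and_congr ?_ ?_)) ?_))) <;>
  exact Eq.congr (by ring) rfl

theorem keyIdeal_le_ker_iff_rank_zero [Algebra ℂ T] {s : Sym2 (Fin 3) → ℂ}
    (hs : symMat s = 0) (f : MvPolynomial KeyVar ℂ →ₐ[ℂ] T)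
    {p0 p1 p2 p4 q0 q1 q2 r u : T}
    (hf : (fun v => f (X v)) = keyFamily ![p0, p1, p2] p4 ![q0, q1, q2] r u) :
    (keyIdeal s 0).toIdeal ≤ RingHom.ker f ↔
      p0 * q0 + p1 * q1 + p2 * q2 = 0 ∧
      (r * p0 = 0 ∧ r * p1 = 0 ∧
        r * p2 = 0) ∧
      (u * p0 = 0 ∧ u * p1 = 0 ∧ u * p2 = 0) ∧
      u * p4 + r ^ 2 = 0 := by
  rw [keyIdeal_le_ker_iff_scalar
    (hs.trans zero_fin_three) zero_vec_fin_three f _ _ _ _ _ _ _ _ _ hf]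
  simp only [Algebra.smul_def, map_sub, map_mul, map_pow, map_zero]
  refine and_congr ?_ (and_congr (and_congr ?_ (and_congr ?_ ?_)) ((and_iff_right ?_).trans
    (and_congr (and_congr ?_ (and_congr ?_ ?_)) ?_)))
  case refine_5 => ring
  all_goals exact Eq.congr (by ring) rfl

/-! ### The two irreducible types of fibres -/

theorem comp_aeval_keyFamily {A T : Type} [CommRing A] [Algebra ℂ A] [CommRing T] [Algebra ℂ T]
    (f : A →ₐ[ℂ] T) (p0 p1 p2 p4 q0 q1 q2 r u : A) :
    (fun v => (f.comp (aeval (keyFamily ![p0, p1, p2] p4 ![q0, q1, q2] r u))) (X v)) =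
      keyFamily ![f p0, f p1, f p2] (f p4) ![f q0, f q1, f q2] (f r) (f u) := by
  rw [_root_.funext_iff, KeyVar.forall_iff]
  simp

theorem apply_X_eq_keyFamily {T : Type} (f : MvPolynomial KeyVar ℂ → T) :
    (fun v => f (X v)) = keyFamily ![f (X (KeyVar.p 0)), f (X (KeyVar.p 1)), f (X (KeyVar.p 2))]
      (f (X KeyVar.p4))
      ![f (X (KeyVar.q 0)), f (X (KeyVar.q 1)), f (X (KeyVar.q 2))] (f (X KeyVar.r))
        (f (X KeyVar.u)) := by
  rw [_root_.funext_iff, KeyVar.forall_iff]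
  simp

theorem keyFamily_isHomogeneous {τ : Type} {p0 p1 p2 p4 q0 q1 q2 r u : MvPolynomial τ ℂ} {n : ℕ}
    (h : (p0.IsHomogeneous n ∧ p1.IsHomogeneous n ∧ p2.IsHomogeneous n) ∧ p4.IsHomogeneous n ∧
      (q0.IsHomogeneous n ∧ q1.IsHomogeneous n ∧ q2.IsHomogeneous n) ∧ r.IsHomogeneous n ∧
      u.IsHomogeneous n) (v : KeyVar) :
    (keyFamily ![p0, p1, p2] p4 ![q0, q1, q2] r u v).IsHomogeneous n := by
  revert v
  rwa [KeyVar.forall_iff]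

theorem isHomogeneous_smul {τ : Type} {f : MvPolynomial τ ℂ} {n : ℕ} (c : ℂ)
    (h : f.IsHomogeneous n) : (c • f).IsHomogeneous n :=
  (homogeneousSubmodule τ ℂ n).smul_mem c h

theorem isHomogeneous_neg {τ : Type} {f : MvPolynomial τ ℂ} {n : ℕ}
    (h : f.IsHomogeneous n) : (-f).IsHomogeneous n :=
  (homogeneousSubmodule τ ℂ n).neg_mem h

theorem two_mul_cancel {T : Type} [CommRing T] [Algebra ℂ T] {x y : T} (h : 2 * x = 2 * y) :
    x = y := by
  have h2 : algebraMap ℂ T (1 / 2) * 2 = 1 := by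
    rw [← map_ofNat (algebraMap ℂ T) 2, ← map_mul]
    norm_num
  calc x = algebraMap ℂ T (1 / 2) * 2 * x := by rw [h2, one_mul]
    _ = algebraMap ℂ T (1 / 2) * 2 * y := by rw [mul_assoc, h, mul_assoc]
    _ = y := by rw [h2, one_mul]

theorem eq_two_mul_half {T : Type} [CommRing T] [Algebra ℂ T] (x : T) :
    x = 2 * ((1 / 2 : ℂ) • x) := by
  rw [Algebra.smul_def, ← mul_assoc, ← map_ofNat (algebraMap ℂ T) 2, ← map_mul]
  norm_num

theorem sub_mem_of_eq {A : Type} [CommRing A] {I : Ideal A} {x y : A} (h : x = y) : x - y ∈ I := by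
  rw [h, sub_self]
  exact I.zero_mem

/-- For `t = e₀` and `S = 2 x₁x₂` the nine equations span the `2 × 2` minors of a `3 × 3` matrix
with independent linear entries; its entry `-p₀ / 2` makes a minor of `2 p₁p₂ + p₄p₀`. -/
theorem isP2P2_of_hyperbolic {s : Sym2 (Fin 3) → ℂ}
    (hs : symMat s = !![0, 0, 0; 0, 0, 1; 0, 1, 0]) : IsP2P2 (keyIdeal s ![1, 0, 0]).toIdeal := by
  rw [IsP2P2, segreIdeal_eq_segreMinors]
  let N : Fin 3 → Fin 3 → MvPolynomial (Fin 3 × Fin 3) ℂ := fun i j => X (i, j)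
  let M : Fin 3 → Fin 3 → MvPolynomial KeyVar ℂ :=
    ![![X KeyVar.p4, X (KeyVar.p 1), X (KeyVar.q 0) + X KeyVar.r],
      ![X (KeyVar.p 2), -((1 / 2 : ℂ) • X (KeyVar.p 0)), X (KeyVar.q 1)],
      ![X (KeyVar.q 0) - X KeyVar.r, X (KeyVar.q 2), X KeyVar.u]]
  have hN : ∀ i j, (N i j).IsHomogeneous 1 := fun i j => isHomogeneous_X ℂ _
  have hX : ∀ v : KeyVar, (X v : MvPolynomial KeyVar ℂ).IsHomogeneous 1 := isHomogeneous_X ℂ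
  refine ProjEquiv.of_substitutions
    (keyFamily ![-(N 1 1 + N 1 1), N 0 1, N 1 0] (N 0 0)
      ![(1 / 2 : ℂ) • N 0 2 + (1 / 2 : ℂ) • N 2 0, N 1 2, N 2 1]
      ((1 / 2 : ℂ) • N 0 2 - (1 / 2 : ℂ) • N 2 0) (N 2 2))
    (fun ij => M ij.1 ij.2)
    (keyFamily_isHomogeneous ⟨⟨isHomogeneous_neg ((hN _ _).add (hN _ _)), hN _ _, hN _ _⟩, hN _ _,
      ⟨.add (isHomogeneous_smul _ (hN _ _)) (isHomogeneous_smul _ (hN _ _)), hN _ _, hN _ _⟩,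
      .sub (isHomogeneous_smul _ (hN _ _)) (isHomogeneous_smul _ (hN _ _)), hN _ _⟩)
    ?_ (le_comap_of_le_ker_comp ?_) (le_comap_of_le_ker_comp ?_) ?_ ?_
  · rintro ⟨i, j⟩
    fin_cases i <;> fin_cases j
    exacts [hX _, hX _, (hX _).add (hX _), hX _, isHomogeneous_neg (isHomogeneous_smul _ (hX _)),
      hX _, (hX _).sub (hX _), hX _, hX _]
  · set f := Ideal.Quotient.mkₐ ℂ (segreMinors 3 3)
    have h := (segreMinors_le_ker_iff f).1 (Ideal.Quotient.mkₐ_ker ℂ _).ge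
    rw [keyIdeal_le_ker_iff_hyperbolic hs _ (comp_aeval_keyFamily f ..)]
    have ha := eq_two_mul_half (f (X (0, 2)))
    have hb := eq_two_mul_half (f (X (2, 0)))
    have h00 := h 1 2 1 2
    have h01 := h 1 2 0 2
    have h02 := h 1 2 0 1
    have h10 := h 0 2 1 2
    have h11 := h 0 2 0 2
    have h12 := h 0 2 0 1
    have h20 := h 0 1 1 2
    have h21 := h 0 1 0 2
    have h22 := h 0 1 0 1
    simp only [N, map_add, map_sub, map_smul, map_neg]
    set a := (1 / 2 : ℂ) • f (X (0, 2))
    set b := (1 / 2 : ℂ) • f (X (2, 0))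
    rw [ha] at h20 h21 h10 h11
    rw [hb] at h01 h02 h12 h11
    refine ⟨?_, ⟨?_, ?_, ?_⟩, ?_, ⟨?_, ?_, ?_⟩, ?_⟩
    · linear_combination h20 + h02
    · linear_combination h20 - h02
    · linear_combination h12
    · linear_combination -h21
    · linear_combination -2 * h22
    · linear_combination -2 * h00
    · linear_combination h10
    · linear_combination h01
    · linear_combination h11
  · set f := Ideal.Quotient.mkₐ ℂ (keyIdeal s ![1, 0, 0]).toIdeal
    obtain ⟨h1, ⟨h2, h3, h4⟩, h5, ⟨h6, h7, h8⟩, h9⟩ := (keyIdeal_le_ker_iff_hyperbolic hs _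
      (apply_X_eq_keyFamily f)).1 (Ideal.Quotient.mkₐ_ker ℂ _).ge
    rw [segreMinors_le_ker_iff]
    have hp := eq_two_mul_half (f (X (KeyVar.p 0)))
    refine minors_three_three (N := fun i j => (f.comp
      (aeval fun ij : Fin 3 × Fin 3 => M ij.1 ij.2))
      (X (i, j))) ?_ ?_ ?_ ?_ ?_ ?_ ?_ ?_ ?_ <;>
    simp only [M, AlgHom.comp_apply, aeval_X, Matrix.cons_val_zero, Matrix.cons_val_one,
      Matrix.cons_val, map_add, map_sub, map_smul, map_neg] <;>
    set c := (1 / 2 : ℂ) • f (X (KeyVar.p 0)) <;>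
    rw [hp] at h1 h2 h5 h6 <;>
    apply two_mul_cancel
    · linear_combination -h6
    · linear_combination 2 * h8
    · linear_combination h1 - h2
    · linear_combination 2 * h7
    · linear_combination 2 * h9
    · linear_combination 2 * h3
    · linear_combination h1 + h2
    · linear_combination -2 * h4
    · linear_combination -h5
  · refine fun v => sub_mem_of_eq ?_
    revert v
    rw [KeyVar.forall_iff]
    simp only [keyFamily_p, keyFamily_p4, keyFamily_q, keyFamily_r, keyFamily_u, N, M,
      Matrix.cons_val_zero, Matrix.cons_val_one, Matrix.cons_val, map_add, map_sub, map_neg,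
      map_smul, aeval_X, and_self, true_and, and_true]
    refine ⟨?_, ?_, ?_⟩ <;> module
  · rintro ⟨i, j⟩
    refine sub_mem_of_eq ?_
    fin_cases i <;> fin_cases j <;>
    simp only [Fin.zero_eta, Fin.mk_one, Fin.reduceFinMk, keyFamily_p, keyFamily_p4, keyFamily_q,
      keyFamily_r, keyFamily_u, N, M, Matrix.cons_val_zero, Matrix.cons_val_one, Matrix.cons_val,
      map_add, map_sub, map_neg, map_smul, aeval_X] <;>
    module

/-- For `t = e₀` and `S = x₂²` six of the nine equations are the `2 × 2` minors of a symmetric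
`3 × 3` matrix `M` with independent linear entries, and the three others are `M σ = 0` for
`σ = (q₂, q₀, -p₁)`. -/
theorem isP22_of_square {s : Sym2 (Fin 3) → ℂ}
    (hs : symMat s = !![0, 0, 0; 0, 0, 0; 0, 0, 1]) : IsP22 (keyIdeal s ![1, 0, 0]).toIdeal := by
  let M : Matrix (Fin 3) (Fin 3) (MvPolynomial KeyVar ℂ) :=
    !![-X KeyVar.p4, X (KeyVar.p 2), X KeyVar.r; X (KeyVar.p 2), X (KeyVar.p 0), -X
      (KeyVar.q 1); X KeyVar.r, -X (KeyVar.q 1), X KeyVar.u]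
  have hM : ∀ i j, M i j = M j i := by
    intro i j
    fin_cases i <;> fin_cases j <;> rfl
  let E : Sym2 (Fin 3) → MvPolynomial KeyVar ℂ := Sym2.lift ⟨fun i j => M i j, hM⟩
  let v : Fin 3 → MvPolynomial KeyVar ℂ := ![X (KeyVar.q 2), X (KeyVar.q 0), -X (KeyVar.p 1)]
  let N : Fin 3 → Fin 3 → MvPolynomial (Sym2 (Fin 3) ⊕ Fin 3) ℂ := fun i j => X (Sum.inl s(i, j))
  let w : Fin 3 → MvPolynomial (Sym2 (Fin 3) ⊕ Fin 3) ℂ := fun i => X (Sum.inr i)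
  have hN : ∀ i j, (N i j).IsHomogeneous 1 := fun i j => isHomogeneous_X ℂ _
  have hw : ∀ i, (w i).IsHomogeneous 1 := fun i => isHomogeneous_X ℂ _
  have hX : ∀ v : KeyVar, (X v : MvPolynomial KeyVar ℂ).IsHomogeneous 1 := isHomogeneous_X ℂ
  have hE : ∀ i j, E s(i, j) = M i j := fun i j => rfl
  refine ProjEquiv.of_substitutions
    (keyFamily ![N 1 1, -w 2, N 0 1] (-N 0 0) ![w 1, -N 1 2, w 0] (N 0 2) (N 2 2))
    (Sum.elim E v)
    (keyFamily_isHomogeneous ⟨⟨hN _ _, isHomogeneous_neg (hw _), hN _ _⟩,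
      isHomogeneous_neg (hN _ _), ⟨hw _, isHomogeneous_neg (hN _ _), hw _⟩, hN _ _, hN _ _⟩)
    ?_ (le_comap_of_le_ker_comp ?_) (le_comap_of_le_ker_comp ?_) ?_ ?_
  · rintro (e | i)
    · induction e using Sym2.ind with | _ i j
      rw [Sum.elim_inl, hE]
      fin_cases i <;> fin_cases j
      exacts [isHomogeneous_neg (hX _), hX _, hX _, hX _, hX _, isHomogeneous_neg (hX _), hX _,
        isHomogeneous_neg (hX _), hX _]
    · fin_cases i
      exacts [hX _, hX _, isHomogeneous_neg (hX _)]
  · set f := Ideal.Quotient.mkₐ ℂ pTwoTwoIdeal.toIdeal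
    obtain ⟨h1, h2⟩ := (pTwoTwoIdeal_le_ker_iff f).1 (Ideal.Quotient.mkₐ_ker ℂ _).ge
    rw [keyIdeal_le_ker_iff_square hs _ (comp_aeval_keyFamily f ..)]
    have h10 : f (N 1 0) = f (N 0 1) := by simp only [N, Sym2.eq_swap]
    have h20 : f (N 2 0) = f (N 0 2) := by simp only [N, Sym2.eq_swap]
    have h21 : f (N 2 1) = f (N 1 2) := by simp only [N, Sym2.eq_swap]
    have hadj := fun i j => congrFun (congrFun h1 i) j
    have hmul := fun i => congrFun h2 i
    have a00 := hadj 0 0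
    have a01 := hadj 0 1
    have a02 := hadj 0 2
    have a11 := hadj 1 1
    have a12 := hadj 1 2
    have a22 := hadj 2 2
    have m0 := hmul 0
    have m1 := hmul 1
    have m2 := hmul 2
    simp only [mulVec_fin_three, Matrix.adjugate_fin_three, symMat, Matrix.of_apply,
      Matrix.cons_val', Matrix.cons_val_zero, Matrix.cons_val_one, Matrix.cons_val,
      Matrix.zero_apply, Pi.zero_apply] at a00 a01 a02 a11 a12 a22 m0 m1 m2
    change f (N _ _) * f (N _ _) - f (N _ _) * f (N _ _) = 0 at a00 a11 a22
    change -(f (N _ _) * f (N _ _)) + f (N _ _) * f (N _ _) = 0 at a01 a12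
    change f (N _ _) * f (N _ _) - f (N _ _) * f (N _ _) = 0 at a02
    change f (N _ _) * f (w _) + f (N _ _) * f (w _) + f (N _ _) * f (w _) = 0 at m0 m1 m2
    rw [h21] at a00
    rw [h21] at a01
    rw [h20] at a11
    rw [h10] at a12
    rw [h10] at a22
    rw [h10] at m1
    rw [h20, h21] at m2
    simp only [map_neg]
    refine ⟨?_, ⟨?_, ?_, ?_⟩, ?_, ⟨?_, ?_, ?_⟩, ?_⟩
    · linear_combination m1
    · linear_combination -a02
    · linear_combination -m0
    · linear_combination a12
    · linear_combination -a22
    · linear_combination a00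
    · linear_combination -m2
    · linear_combination -a01
    · linear_combination -a11
  · set f := Ideal.Quotient.mkₐ ℂ (keyIdeal s ![1, 0, 0]).toIdeal
    obtain ⟨h1, ⟨h2, h3, h4⟩, h5, ⟨h6, h7, h8⟩, h9⟩ := (keyIdeal_le_ker_iff_square hs _
      (apply_X_eq_keyFamily f)).1 (Ideal.Quotient.mkₐ_ker ℂ _).ge
    rw [pTwoTwoIdeal_le_ker_iff]
    have e1 : (symMat fun e => (f.comp (aeval (Sum.elim E v))) (X (Sum.inl e))) = M.map f := by
      ext i j
      simp [symMat, hE]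
    rw [e1]
    constructor
    · ext i j
      fin_cases i <;> fin_cases j <;>
        simp [Matrix.adjugate_fin_three, M] <;>
        first
        | linear_combination h6
        | linear_combination -h8
        | linear_combination -h2
        | linear_combination -h9
        | linear_combination h4
        | linear_combination -h5
    · rw [funext_fin_three_iff]
      simp [mulVec_fin_three, v, M]
      refine ⟨?_, ?_, ?_⟩
      · linear_combination -h3
      · linear_combination h1
      · linear_combination -h7
  · refine fun v => sub_mem_of_eq ?_
    revert v
    rw [KeyVar.forall_iff]
    simp [N, w, v, E, M]
  · rintro (e | i)
    · induction e using Sym2.ind with | _ i j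
      refine sub_mem_of_eq ?_
      rw [Sum.elim_inl, hE]
      fin_cases i <;> fin_cases j <;> simp [M, N, Sym2.eq_swap]
    · refine sub_mem_of_eq ?_
      fin_cases i <;> simp [v, w]

/-! ### The quadrics among the components -/

theorem span_X_image_eq_ker {σ : Type} (s : Set σ) [DecidablePred (· ∈ s)] :
    Ideal.span (X '' s) = RingHom.ker (aeval (R := ℂ) fun i =>
      if i ∈ s then (0 : MvPolynomial σ ℂ) else X i) := by
  refine le_antisymm (Ideal.span_le.2 ?_) fun f hf => ?_
  · rintro _ ⟨i, hi, rfl⟩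
    simp [RingHom.mem_ker, hi]
  · have h : (Ideal.Quotient.mkₐ ℂ (Ideal.span (X '' s))).comp
        (aeval fun i => if i ∈ s then (0 : MvPolynomial σ ℂ) else X i) =
        Ideal.Quotient.mkₐ ℂ (Ideal.span (X '' s)) := by
      refine MvPolynomial.algHom_ext fun i => ?_
      rw [AlgHom.comp_apply, aeval_X]
      split_ifs with hi
      · rw [map_zero]
        exact (Ideal.Quotient.eq_zero_iff_mem.2 (Ideal.subset_span
          (Set.mem_image_of_mem X hi))).symm
      · rfl
    have h2 := DFunLike.congr_fun h f
    rw [AlgHom.comp_apply, RingHom.mem_ker.1 hf, map_zero] at h2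
    exact Ideal.Quotient.eq_zero_iff_mem.1 h2.symm

theorem isPrime_span_X_image {σ : Type} (s : Set σ) :
    (Ideal.span (X '' s) : Ideal (MvPolynomial σ ℂ)).IsPrime := by
  classical
  rw [span_X_image_eq_ker s]
  exact RingHom.ker_isPrime _

/-- A quadratic form which contains a hyperbolic plane, and is not the product of its coordinates,
is irreducible. -/
theorem irreducible_hyperbolic_add {n : ℕ} {g : MvPolynomial (Fin n) ℂ} (hg : g ≠ 0) :
    Irreducible (X 0 * X 1 + rename (fun k : Fin n => k.succ.succ) g :
      MvPolynomial (Fin (n + 2)) ℂ) := by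
  have hinj : Function.Injective (fun k : Fin n => k.succ.succ) :=
    (Fin.succ_injective _).comp (Fin.succ_injective _)
  have hvars : ∀ i ∈ (rename (fun k : Fin n => k.succ.succ) g).vars, i ≠ 0 := by
    classical
    intro i hi
    obtain ⟨k, -, rfl⟩ := Finset.mem_image.1 (vars_rename _ g hi)
    exact Fin.succ_ne_zero _
  rw [mul_comm]
  refine irreducible_mul_X_add _ _ 0 (X_ne_zero 1) ?_ (fun h => hvars 0 h rfl) ?_
  · simp [vars_X]
  · have hX : Prime (X 1 : MvPolynomial (Fin (n + 2)) ℂ) := X_prime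
    refine (hX.irreducible.isRelPrime_iff_not_dvd).2 fun ⟨h, hh⟩ => hg ?_
    apply rename_injective _ hinj
    have := congrArg (aeval fun i : Fin (n + 2) =>
      if i = 1 then (0 : MvPolynomial (Fin (n + 2)) ℂ) else X i) hh
    rw [map_mul, aeval_X, if_pos rfl, zero_mul, aeval_rename] at this
    rw [map_zero, ← this, rename_eq_aeval]
    congr 2

theorem isQuadric_of_substitutions {n : ℕ} {g : MvPolynomial (Fin n) ℂ} (hg : g ≠ 0)
    (hg2 : g.IsHomogeneous 2) {J : Ideal (MvPolynomial KeyVar ℂ)}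
    (F : KeyVar → MvPolynomial (Fin (n + 2)) ℂ) (G : Fin (n + 2) → MvPolynomial KeyVar ℂ)
    (hF : ∀ i, (F i).IsHomogeneous 1) (hG : ∀ j, (G j).IsHomogeneous 1)
    (hJ : J ≤ (Ideal.span {X 0 * X 1 + rename (fun k : Fin n => k.succ.succ) g}).comap (aeval F))
    (hq : G 0 * G 1 + aeval (fun k : Fin n => G k.succ.succ) g ∈ J)
    (hGF : ∀ i, aeval G (F i) - X i ∈ J) (hFG : ∀ j, aeval F (G j) = X j) : IsQuadric n J := by
  refine ⟨_, ?_, irreducible_hyperbolic_add hg,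
    ProjEquiv.of_substitutions F G hF hG hJ ?_ hGF fun j => sub_mem_of_eq (hFG j)⟩
  · exact ((isHomogeneous_X ℂ _).mul (isHomogeneous_X ℂ _)).add hg2.rename_isHomogeneous
  · rw [Ideal.span_singleton_le_iff_mem, Ideal.mem_comap, map_add, map_mul, aeval_X, aeval_X,
      aeval_rename]
    exact hq

section
variable {A B : Type} [CommRing A] [CommRing B] [Algebra ℂ A] [Algebra ℂ B]

theorem mem_comap_of_eq_zero {I : Ideal B} {f : A →ₐ[ℂ] B} {x : A} (h : f x = 0) :
    x ∈ I.comap f := by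
  rw [Ideal.mem_comap, h]
  exact I.zero_mem

theorem mem_comap_span_of_eq {f : A →ₐ[ℂ] B} {x : A} {y : B} (h : f x = y) :
    x ∈ (Ideal.span {y}).comap f := by
  rw [Ideal.mem_comap, h]
  exact Ideal.mem_span_singleton_self y

theorem notMem_span_of_eval {σ : Type} {s : Set (MvPolynomial σ ℂ)} (P : σ → ℂ)
    {x : MvPolynomial σ ℂ} (h : ∀ g ∈ s, eval P g = 0) (hx : eval P x ≠ 0) :
    x ∉ Ideal.span s := fun hmem =>
  hx ((Ideal.span_le (I := RingHom.ker (eval P))).2 h hmem)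
end

theorem isQuadric_hyperbolic_six : IsQuadric 4 (Ideal.span {X KeyVar.r, X KeyVar.p4, X KeyVar.u,
    X (KeyVar.p 0) * X (KeyVar.q 0) + (X (KeyVar.p 1) * X (KeyVar.q 1) + X (KeyVar.p 2) *
      X (KeyVar.q 2))} :
    Ideal (MvPolynomial KeyVar ℂ)) := by
  have hg : (X 0 * X 1 + X 2 * X 3 : MvPolynomial (Fin 4) ℂ) ≠ 0 := fun h => by
    simpa using congrArg (eval ![1, 1, 0, 0]) h
  set J : Ideal (MvPolynomial KeyVar ℂ) := Ideal.span {X KeyVar.r, X KeyVar.p4, X KeyVar.u,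
    X (KeyVar.p 0) * X (KeyVar.q 0) + (X (KeyVar.p 1) * X (KeyVar.q 1) + X (KeyVar.p 2) *
      X (KeyVar.q 2))} with hJ
  have h0 : X KeyVar.r ∈ J := Ideal.subset_span (by simp)
  have h1 : X KeyVar.p4 ∈ J := Ideal.subset_span (by simp)
  have h2 : X KeyVar.u ∈ J := Ideal.subset_span (by simp)
  have h3 : X (KeyVar.p 0) * X (KeyVar.q 0) + (X (KeyVar.p 1) * X (KeyVar.q 1) + X (KeyVar.p 2) *
    X (KeyVar.q 2)) ∈ J := Ideal.subset_span (by simp)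
  refine isQuadric_of_substitutions hg (((isHomogeneous_X ℂ _).mul (isHomogeneous_X ℂ _)).add
    ((isHomogeneous_X ℂ _).mul (isHomogeneous_X ℂ _)))
    (keyFamily ![X 0, X 2, X 4] (0) ![X 1, X 3, X 5] (0) (0))
    ![X (KeyVar.p 0), X (KeyVar.q 0), X (KeyVar.p 1), X (KeyVar.q 1), X (KeyVar.p 2),
      X (KeyVar.q 2)]
    (keyFamily_isHomogeneous ⟨⟨isHomogeneous_X ℂ _, isHomogeneous_X ℂ _, isHomogeneous_X ℂ _⟩,
      isHomogeneous_zero _ _ _,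
      ⟨isHomogeneous_X ℂ _, isHomogeneous_X ℂ _, isHomogeneous_X ℂ _⟩, isHomogeneous_zero _ _ _,
        isHomogeneous_zero _ _ _⟩)
    (fun j => ?_) ?_ ?_ ?_ fun j => ?_
  · fin_cases j <;> exact isHomogeneous_X ℂ _
  · refine Ideal.span_le.2 ?_
    simp only [Set.insert_subset_iff, Set.singleton_subset_iff, SetLike.mem_coe]
    refine ⟨mem_comap_of_eq_zero ?_, mem_comap_of_eq_zero ?_, mem_comap_of_eq_zero ?_,
      mem_comap_span_of_eq ?_⟩ <;> simp
  · convert h3 using 1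
    simp
  · rw [KeyVar.forall_iff]
    simp [h0, h1, h2]
  · fin_cases j <;> simp

theorem isQuadric_rank_six : IsQuadric 4 (Ideal.span {X (KeyVar.p 0), X (KeyVar.p 1),
    X (KeyVar.p 2), X KeyVar.u * X KeyVar.p4 + (X KeyVar.r ^ 2 + 4 *
      (X (KeyVar.q 0) * X (KeyVar.q 2)) - X (KeyVar.q 1) ^ 2)} :
    Ideal (MvPolynomial KeyVar ℂ)) := by
  have hg : (X 0 ^ 2 + 4 * (X 1 * X 3) - X 2 ^ 2 : MvPolynomial (Fin 4) ℂ) ≠ 0 := fun h => by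
    simpa using congrArg (eval ![1, 0, 0, 0]) h
  set J : Ideal (MvPolynomial KeyVar ℂ) := Ideal.span {X (KeyVar.p 0), X (KeyVar.p 1),
    X (KeyVar.p 2), X KeyVar.u * X KeyVar.p4 + (X KeyVar.r ^ 2 + 4 *
      (X (KeyVar.q 0) * X (KeyVar.q 2)) - X (KeyVar.q 1) ^ 2)} with hJ
  have h0 : X (KeyVar.p 0) ∈ J := Ideal.subset_span (by simp)
  have h1 : X (KeyVar.p 1) ∈ J := Ideal.subset_span (by simp)
  have h2 : X (KeyVar.p 2) ∈ J := Ideal.subset_span (by simp)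
  have h3 : X KeyVar.u * X KeyVar.p4 + (X KeyVar.r ^ 2 + 4 * (X (KeyVar.q 0) * X (KeyVar.q 2)) -
    X (KeyVar.q 1) ^ 2) ∈ J := Ideal.subset_span (by simp)
  refine isQuadric_of_substitutions hg ((((isHomogeneous_X ℂ _).pow 2).add
    ((isHomogeneous_C _ 4).mul ((isHomogeneous_X ℂ _).mul (isHomogeneous_X ℂ _)))).sub
      ((isHomogeneous_X ℂ _).pow 2))
    (keyFamily ![0, 0, 0] (X 1) ![X 3, X 4, X 5] (X 2) (X 0))
    ![X KeyVar.u, X KeyVar.p4, X KeyVar.r, X (KeyVar.q 0), X (KeyVar.q 1), X (KeyVar.q 2)]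
    (keyFamily_isHomogeneous ⟨⟨isHomogeneous_zero _ _ _, isHomogeneous_zero _ _ _,
      isHomogeneous_zero _ _ _⟩, isHomogeneous_X ℂ _,
      ⟨isHomogeneous_X ℂ _, isHomogeneous_X ℂ _, isHomogeneous_X ℂ _⟩, isHomogeneous_X ℂ _,
        isHomogeneous_X ℂ _⟩)
    (fun j => ?_) ?_ ?_ ?_ fun j => ?_
  · fin_cases j <;> exact isHomogeneous_X ℂ _
  · refine Ideal.span_le.2 ?_
    simp only [Set.insert_subset_iff, Set.singleton_subset_iff, SetLike.mem_coe]
    refine ⟨mem_comap_of_eq_zero ?_, mem_comap_of_eq_zero ?_, mem_comap_of_eq_zero ?_,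
      mem_comap_span_of_eq ?_⟩ <;> simp [map_ofNat]
  · convert h3 using 1
    simp [map_ofNat]
  · rw [KeyVar.forall_iff]
    simp [h0, h1, h2]
  · fin_cases j <;> simp

theorem isQuadric_rank_four : IsQuadric 4 (Ideal.span {X (KeyVar.p 0), X (KeyVar.p 1),
    X (KeyVar.p 2), X KeyVar.u * X KeyVar.p4 + (X KeyVar.r ^ 2 - X (KeyVar.q 2) ^ 2)} :
    Ideal (MvPolynomial KeyVar ℂ)) := by
  have hg : (X 0 ^ 2 - X 3 ^ 2 : MvPolynomial (Fin 4) ℂ) ≠ 0 := fun h => by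
    simpa using congrArg (eval ![1, 0, 0, 0]) h
  set J : Ideal (MvPolynomial KeyVar ℂ) := Ideal.span {X (KeyVar.p 0), X (KeyVar.p 1),
    X (KeyVar.p 2), X KeyVar.u * X KeyVar.p4 + (X KeyVar.r ^ 2 - X (KeyVar.q 2) ^ 2)} with hJ
  have h0 : X (KeyVar.p 0) ∈ J := Ideal.subset_span (by simp)
  have h1 : X (KeyVar.p 1) ∈ J := Ideal.subset_span (by simp)
  have h2 : X (KeyVar.p 2) ∈ J := Ideal.subset_span (by simp)
  have h3 : X KeyVar.u * X KeyVar.p4 + (X KeyVar.r ^ 2 - X (KeyVar.q 2) ^ 2) ∈ J :=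
    Ideal.subset_span (by simp)
  refine isQuadric_of_substitutions hg (((isHomogeneous_X ℂ _).pow 2).sub
    ((isHomogeneous_X ℂ _).pow 2))
    (keyFamily ![0, 0, 0] (X 1) ![X 3, X 4, X 5] (X 2) (X 0))
    ![X KeyVar.u, X KeyVar.p4, X KeyVar.r, X (KeyVar.q 0), X (KeyVar.q 1), X (KeyVar.q 2)]
    (keyFamily_isHomogeneous ⟨⟨isHomogeneous_zero _ _ _, isHomogeneous_zero _ _ _,
      isHomogeneous_zero _ _ _⟩, isHomogeneous_X ℂ _,
      ⟨isHomogeneous_X ℂ _, isHomogeneous_X ℂ _, isHomogeneous_X ℂ _⟩, isHomogeneous_X ℂ _,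
        isHomogeneous_X ℂ _⟩)
    (fun j => ?_) ?_ ?_ ?_ fun j => ?_
  · fin_cases j <;> exact isHomogeneous_X ℂ _
  · refine Ideal.span_le.2 ?_
    simp only [Set.insert_subset_iff, Set.singleton_subset_iff, SetLike.mem_coe]
    refine ⟨mem_comap_of_eq_zero ?_, mem_comap_of_eq_zero ?_, mem_comap_of_eq_zero ?_,
      mem_comap_span_of_eq ?_⟩ <;> simp
  · convert h3 using 1
    simp
  · rw [KeyVar.forall_iff]
    simp [h0, h1, h2]
  · fin_cases j <;> simp

theorem isQuadric_rank_three : IsQuadric 4 (Ideal.span {X (KeyVar.p 0), X (KeyVar.p 1),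
    X (KeyVar.p 2), X KeyVar.u * X KeyVar.p4 + X KeyVar.r ^ 2} :
    Ideal (MvPolynomial KeyVar ℂ)) := by
  have hg : (X 0 ^ 2 : MvPolynomial (Fin 4) ℂ) ≠ 0 := fun h => by
    simpa using congrArg (eval ![1, 0, 0, 0]) h
  set J : Ideal (MvPolynomial KeyVar ℂ) := Ideal.span {X (KeyVar.p 0), X (KeyVar.p 1),
    X (KeyVar.p 2), X KeyVar.u * X KeyVar.p4 + X KeyVar.r ^ 2} with hJ
  have h0 : X (KeyVar.p 0) ∈ J := Ideal.subset_span (by simp)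
  have h1 : X (KeyVar.p 1) ∈ J := Ideal.subset_span (by simp)
  have h2 : X (KeyVar.p 2) ∈ J := Ideal.subset_span (by simp)
  have h3 : X KeyVar.u * X KeyVar.p4 + X KeyVar.r ^ 2 ∈ J := Ideal.subset_span (by simp)
  refine isQuadric_of_substitutions hg ((isHomogeneous_X ℂ _).pow 2)
    (keyFamily ![0, 0, 0] (X 1) ![X 3, X 4, X 5] (X 2) (X 0))
    ![X KeyVar.u, X KeyVar.p4, X KeyVar.r, X (KeyVar.q 0), X (KeyVar.q 1), X (KeyVar.q 2)]
    (keyFamily_isHomogeneous ⟨⟨isHomogeneous_zero _ _ _, isHomogeneous_zero _ _ _,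
      isHomogeneous_zero _ _ _⟩, isHomogeneous_X ℂ _,
      ⟨isHomogeneous_X ℂ _, isHomogeneous_X ℂ _, isHomogeneous_X ℂ _⟩, isHomogeneous_X ℂ _,
        isHomogeneous_X ℂ _⟩)
    (fun j => ?_) ?_ ?_ ?_ fun j => ?_
  · fin_cases j <;> exact isHomogeneous_X ℂ _
  · refine Ideal.span_le.2 ?_
    simp only [Set.insert_subset_iff, Set.singleton_subset_iff, SetLike.mem_coe]
    refine ⟨mem_comap_of_eq_zero ?_, mem_comap_of_eq_zero ?_, mem_comap_of_eq_zero ?_,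
      mem_comap_span_of_eq ?_⟩ <;> simp
  · convert h3 using 1
    simp
  · rw [KeyVar.forall_iff]
    simp [h0, h1, h2]
  · fin_cases j <;> simp

theorem isQuadric_split_pos : IsQuadric 4 (Ideal.span {X KeyVar.u, X (KeyVar.q 2) - X KeyVar.r,
    X (KeyVar.p 1), X (KeyVar.p 0) * X (KeyVar.q 0) + X (KeyVar.p 2) * X (KeyVar.q 2)} :
    Ideal (MvPolynomial KeyVar ℂ)) := by
  have hg : (X 0 * X 1 : MvPolynomial (Fin 4) ℂ) ≠ 0 := fun h => by
    simpa using congrArg (eval ![1, 1, 0, 0]) h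
  set J : Ideal (MvPolynomial KeyVar ℂ) := Ideal.span {X KeyVar.u, X (KeyVar.q 2) - X KeyVar.r,
    X (KeyVar.p 1), X (KeyVar.p 0) * X (KeyVar.q 0) + X (KeyVar.p 2) * X (KeyVar.q 2)} with hJ
  have h0 : X KeyVar.u ∈ J := Ideal.subset_span (by simp)
  have h1 : X (KeyVar.q 2) - X KeyVar.r ∈ J := Ideal.subset_span (by simp)
  have h2 : X (KeyVar.p 1) ∈ J := Ideal.subset_span (by simp)
  have h3 : X (KeyVar.p 0) * X (KeyVar.q 0) + X (KeyVar.p 2) * X (KeyVar.q 2) ∈ J :=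
    Ideal.subset_span (by simp)
  refine isQuadric_of_substitutions hg ((isHomogeneous_X ℂ _).mul (isHomogeneous_X ℂ _))
    (keyFamily ![X 0, 0, X 2] (X 4) ![X 1, X 5, X 3] (X 3) (0))
    ![X (KeyVar.p 0), X (KeyVar.q 0), X (KeyVar.p 2), X (KeyVar.q 2), X KeyVar.p4, X (KeyVar.q 1)]
    (keyFamily_isHomogeneous ⟨⟨isHomogeneous_X ℂ _, isHomogeneous_zero _ _ _, isHomogeneous_X ℂ _⟩,
      isHomogeneous_X ℂ _,
      ⟨isHomogeneous_X ℂ _, isHomogeneous_X ℂ _, isHomogeneous_X ℂ _⟩, isHomogeneous_X ℂ _,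
        isHomogeneous_zero _ _ _⟩)
    (fun j => ?_) ?_ ?_ ?_ fun j => ?_
  · fin_cases j <;> exact isHomogeneous_X ℂ _
  · refine Ideal.span_le.2 ?_
    simp only [Set.insert_subset_iff, Set.singleton_subset_iff, SetLike.mem_coe]
    refine ⟨mem_comap_of_eq_zero ?_, mem_comap_of_eq_zero ?_, mem_comap_of_eq_zero ?_,
      mem_comap_span_of_eq ?_⟩ <;> simp
  · convert h3 using 1
    simp
  · rw [KeyVar.forall_iff]
    simp [h0, h1, h2]
  · fin_cases j <;> simp

theorem isQuadric_split_neg : IsQuadric 4 (Ideal.span {X KeyVar.u, -X (KeyVar.q 2) - X KeyVar.r,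
    X (KeyVar.p 0), X (KeyVar.p 1) * X (KeyVar.q 1) + X (KeyVar.p 2) * X (KeyVar.q 2)} :
    Ideal (MvPolynomial KeyVar ℂ)) := by
  have hg : (X 0 * X 1 : MvPolynomial (Fin 4) ℂ) ≠ 0 := fun h => by
    simpa using congrArg (eval ![1, 1, 0, 0]) h
  set J : Ideal (MvPolynomial KeyVar ℂ) := Ideal.span {X KeyVar.u, -X (KeyVar.q 2) - X KeyVar.r,
    X (KeyVar.p 0), X (KeyVar.p 1) * X (KeyVar.q 1) + X (KeyVar.p 2) * X (KeyVar.q 2)} with hJ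
  have h0 : X KeyVar.u ∈ J := Ideal.subset_span (by simp)
  have h1 : -X (KeyVar.q 2) - X KeyVar.r ∈ J := Ideal.subset_span (by simp)
  have h2 : X (KeyVar.p 0) ∈ J := Ideal.subset_span (by simp)
  have h3 : X (KeyVar.p 1) * X (KeyVar.q 1) + X (KeyVar.p 2) * X (KeyVar.q 2) ∈ J :=
    Ideal.subset_span (by simp)
  refine isQuadric_of_substitutions hg ((isHomogeneous_X ℂ _).mul (isHomogeneous_X ℂ _))
    (keyFamily ![0, X 0, X 2] (X 4) ![X 5, X 1, X 3] (-X 3) (0))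
    ![X (KeyVar.p 1), X (KeyVar.q 1), X (KeyVar.p 2), X (KeyVar.q 2), X KeyVar.p4, X (KeyVar.q 0)]
    (keyFamily_isHomogeneous ⟨⟨isHomogeneous_zero _ _ _, isHomogeneous_X ℂ _, isHomogeneous_X ℂ _⟩,
      isHomogeneous_X ℂ _,
      ⟨isHomogeneous_X ℂ _, isHomogeneous_X ℂ _, isHomogeneous_X ℂ _⟩, isHomogeneous_neg
        (isHomogeneous_X ℂ _), isHomogeneous_zero _ _ _⟩)
    (fun j => ?_) ?_ ?_ ?_ fun j => ?_
  · fin_cases j <;> exact isHomogeneous_X ℂ _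
  · refine Ideal.span_le.2 ?_
    simp only [Set.insert_subset_iff, Set.singleton_subset_iff, SetLike.mem_coe]
    refine ⟨mem_comap_of_eq_zero ?_, mem_comap_of_eq_zero ?_, mem_comap_of_eq_zero ?_,
      mem_comap_span_of_eq ?_⟩ <;> simp
  · convert h3 using 1
    simp
  · rw [KeyVar.forall_iff]
    simp [h0, h1, h2]
  · fin_cases j <;> simp

theorem isQuadric_split : IsQuadric 4 (Ideal.span {X KeyVar.u, X KeyVar.r, X (KeyVar.p 0),
    X (KeyVar.p 1) * X (KeyVar.q 1) + X (KeyVar.p 2) * X (KeyVar.q 2)} :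
    Ideal (MvPolynomial KeyVar ℂ)) := by
  have hg : (X 0 * X 1 : MvPolynomial (Fin 4) ℂ) ≠ 0 := fun h => by
    simpa using congrArg (eval ![1, 1, 0, 0]) h
  set J : Ideal (MvPolynomial KeyVar ℂ) := Ideal.span {X KeyVar.u, X KeyVar.r, X (KeyVar.p 0),
    X (KeyVar.p 1) * X (KeyVar.q 1) + X (KeyVar.p 2) * X (KeyVar.q 2)} with hJ
  have h0 : X KeyVar.u ∈ J := Ideal.subset_span (by simp)
  have h1 : X KeyVar.r ∈ J := Ideal.subset_span (by simp)
  have h2 : X (KeyVar.p 0) ∈ J := Ideal.subset_span (by simp)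
  have h3 : X (KeyVar.p 1) * X (KeyVar.q 1) + X (KeyVar.p 2) * X (KeyVar.q 2) ∈ J :=
    Ideal.subset_span (by simp)
  refine isQuadric_of_substitutions hg ((isHomogeneous_X ℂ _).mul (isHomogeneous_X ℂ _))
    (keyFamily ![0, X 0, X 2] (X 4) ![X 5, X 1, X 3] (0) (0))
    ![X (KeyVar.p 1), X (KeyVar.q 1), X (KeyVar.p 2), X (KeyVar.q 2), X KeyVar.p4, X (KeyVar.q 0)]
    (keyFamily_isHomogeneous ⟨⟨isHomogeneous_zero _ _ _, isHomogeneous_X ℂ _, isHomogeneous_X ℂ _⟩,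
      isHomogeneous_X ℂ _,
      ⟨isHomogeneous_X ℂ _, isHomogeneous_X ℂ _, isHomogeneous_X ℂ _⟩, isHomogeneous_zero _ _ _,
        isHomogeneous_zero _ _ _⟩)
    (fun j => ?_) ?_ ?_ ?_ fun j => ?_
  · fin_cases j <;> exact isHomogeneous_X ℂ _
  · refine Ideal.span_le.2 ?_
    simp only [Set.insert_subset_iff, Set.singleton_subset_iff, SetLike.mem_coe]
    refine ⟨mem_comap_of_eq_zero ?_, mem_comap_of_eq_zero ?_, mem_comap_of_eq_zero ?_,
      mem_comap_span_of_eq ?_⟩ <;> simp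
  · convert h3 using 1
    simp
  · rw [KeyVar.forall_iff]
    simp [h0, h1, h2]
  · fin_cases j <;> simp

theorem isQuadric_five : IsQuadric 5 (Ideal.span {X KeyVar.r, X KeyVar.u, X (KeyVar.p 0) *
    X (KeyVar.q 0) + (X (KeyVar.p 1) * X (KeyVar.q 1) + X (KeyVar.p 2) * X (KeyVar.q 2))} :
    Ideal (MvPolynomial KeyVar ℂ)) := by
  have hg : (X 0 * X 1 + X 2 * X 3 : MvPolynomial (Fin 5) ℂ) ≠ 0 := fun h => by
    simpa using congrArg (eval ![1, 1, 0, 0, 0]) h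
  set J : Ideal (MvPolynomial KeyVar ℂ) := Ideal.span {X KeyVar.r, X KeyVar.u, X (KeyVar.p 0) *
    X (KeyVar.q 0) + (X (KeyVar.p 1) * X (KeyVar.q 1) + X (KeyVar.p 2) * X (KeyVar.q 2))} with hJ
  have h0 : X KeyVar.r ∈ J := Ideal.subset_span (by simp)
  have h1 : X KeyVar.u ∈ J := Ideal.subset_span (by simp)
  have h2 : X (KeyVar.p 0) * X (KeyVar.q 0) + (X (KeyVar.p 1) * X (KeyVar.q 1) + X (KeyVar.p 2) *
    X (KeyVar.q 2)) ∈ J := Ideal.subset_span (by simp)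
  refine isQuadric_of_substitutions hg (((isHomogeneous_X ℂ _).mul (isHomogeneous_X ℂ _)).add
    ((isHomogeneous_X ℂ _).mul (isHomogeneous_X ℂ _)))
    (keyFamily ![X 0, X 2, X 4] (X 6) ![X 1, X 3, X 5] (0) (0))
    ![X (KeyVar.p 0), X (KeyVar.q 0), X (KeyVar.p 1), X (KeyVar.q 1), X (KeyVar.p 2),
      X (KeyVar.q 2), X KeyVar.p4]
    (keyFamily_isHomogeneous ⟨⟨isHomogeneous_X ℂ _, isHomogeneous_X ℂ _, isHomogeneous_X ℂ _⟩,
      isHomogeneous_X ℂ _,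
      ⟨isHomogeneous_X ℂ _, isHomogeneous_X ℂ _, isHomogeneous_X ℂ _⟩, isHomogeneous_zero _ _ _,
        isHomogeneous_zero _ _ _⟩)
    (fun j => ?_) ?_ ?_ ?_ fun j => ?_
  · fin_cases j <;> exact isHomogeneous_X ℂ _
  · refine Ideal.span_le.2 ?_
    simp only [Set.insert_subset_iff, Set.singleton_subset_iff, SetLike.mem_coe]
    refine ⟨mem_comap_of_eq_zero ?_, mem_comap_of_eq_zero ?_, mem_comap_span_of_eq ?_⟩ <;> simp
  · convert h2 using 1
    simp
  · rw [KeyVar.forall_iff]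
    simp [h0, h1]
  · fin_cases j <;> simp

/-! ### The cones over hyperplane sections of a Segre variety -/

theorem sup_span_singleton_le_ker_iff {A T : Type} [CommRing A] [CommRing T] {I : Ideal A} {x : A}
    (f : A →+* T) : I ⊔ Ideal.span {x} ≤ RingHom.ker f ↔ I ≤ RingHom.ker f ∧ f x = 0 := by
  rw [sup_le_iff, Ideal.span_singleton_le_iff_mem, RingHom.mem_ker]

/-- The `2 × 4` matrix with the coordinates of `ℙ⁷`. -/
def coneVar (i : Fin 2) (j : Fin 4) : MvPolynomial (Option (Fin 2 × Fin 4)) ℂ := X (some (i, j))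

theorem coneVar_isHomogeneous (i : Fin 2) (j : Fin 4) : (coneVar i j).IsHomogeneous 1 :=
  isHomogeneous_X ℂ _

theorem mk_coneVar_minor (i j : Fin 2) (k l : Fin 4) :
    Ideal.Quotient.mkₐ ℂ coneSegreSectionIdeal (coneVar i k) *
      Ideal.Quotient.mkₐ ℂ coneSegreSectionIdeal (coneVar j l) =
    Ideal.Quotient.mkₐ ℂ coneSegreSectionIdeal (coneVar i l) *
      Ideal.Quotient.mkₐ ℂ coneSegreSectionIdeal (coneVar j k) :=
  ((coneSegreSectionIdeal_le_ker_iff _).1 (Ideal.Quotient.mkₐ_ker ℂ _).ge).1 i j k l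

theorem mk_coneVar_add : Ideal.Quotient.mkₐ ℂ coneSegreSectionIdeal (coneVar 0 0) +
      Ideal.Quotient.mkₐ ℂ coneSegreSectionIdeal (coneVar 1 1) = 0 :=
  ((coneSegreSectionIdeal_le_ker_iff _).1 (Ideal.Quotient.mkₐ_ker ℂ _).ge).2

theorem coneVar_add_mem : coneVar 0 0 + coneVar 1 1 ∈ coneSegreSectionIdeal :=
  Ideal.mem_sup_right (Ideal.mem_span_singleton_self _)

/-- The component of the fibre for `t = e₀` and `S = 0` inside `p₀ = 0`. There `q₀` does not occur
in the equations, so it is the variable of the cone. -/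
theorem isConeSegreSection_of_zero {s : Sym2 (Fin 3) → ℂ} (hs : symMat s = 0) :
    IsConeSegreSection ((keyIdeal s ![1, 0, 0]).toIdeal ⊔ Ideal.span {X (KeyVar.p 0)}) := by
  let N := coneVar
  have hN := coneVar_isHomogeneous
  have hX : ∀ v : KeyVar, (X v : MvPolynomial KeyVar ℂ).IsHomogeneous 1 := isHomogeneous_X ℂ
  let M : Fin 2 → Fin 4 → MvPolynomial KeyVar ℂ :=
    ![![X KeyVar.r, -X KeyVar.p4, X (KeyVar.p 1), X (KeyVar.p 2)],
      ![-X KeyVar.u, -X KeyVar.r, -X (KeyVar.q 2), X (KeyVar.q 1)]]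
  refine ProjEquiv.of_substitutions
    (keyFamily ![0, N 0 2, N 0 3] (-N 0 1) ![X none, N 1 3, -N 1 2] (N 0 0) (-N 1 0))
    (fun o => o.elim (X (KeyVar.q 0)) fun ij => M ij.1 ij.2)
    (keyFamily_isHomogeneous ⟨⟨isHomogeneous_zero _ _ _, hN _ _, hN _ _⟩,
      isHomogeneous_neg (hN _ _), ⟨isHomogeneous_X ℂ _, hN _ _, isHomogeneous_neg (hN _ _)⟩, hN _ _,
      isHomogeneous_neg (hN _ _)⟩)
    ?_ (le_comap_of_le_ker_comp ?_) (le_comap_of_le_ker_comp ?_) ?_ ?_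
  · rintro (_ | ⟨i, j⟩)
    · exact hX _
    · fin_cases i <;> fin_cases j
      exacts [hX _, isHomogeneous_neg (hX _), hX _, hX _, isHomogeneous_neg (hX _),
        isHomogeneous_neg (hX _), isHomogeneous_neg (hX _), hX _]
  · have h := mk_coneVar_minor
    have hadd := mk_coneVar_add
    set f := Ideal.Quotient.mkₐ ℂ coneSegreSectionIdeal
    refine (sup_span_singleton_le_ker_iff (RingHomClass.toRingHom (f.comp _))).2 ⟨?_, by simp⟩
    refine (keyIdeal_le_ker_iff_zero hs _ (comp_aeval_keyFamily f ..)).2 ?_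
    simp only [map_neg, map_zero, N]
    refine ⟨?_, ⟨?_, ?_, ?_⟩, ?_, ⟨?_, ?_, ?_⟩, ?_⟩
    · linear_combination h 0 1 2 3
    · ring
    · linear_combination h 0 1 1 2 + f (coneVar 0 2) * hadd
    · linear_combination h 0 1 1 3 + f (coneVar 0 3) * hadd
    · ring
    · ring
    · linear_combination h 0 1 0 2
    · linear_combination h 0 1 0 3
    · linear_combination -h 0 1 0 1 + f (coneVar 0 0) * hadd
  · set f := Ideal.Quotient.mkₐ ℂ ((keyIdeal s ![1, 0, 0]).toIdeal ⊔ Ideal.span {X (KeyVar.p 0)})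
    obtain ⟨h, hx⟩ := (sup_span_singleton_le_ker_iff (RingHomClass.toRingHom f)).1
      (Ideal.Quotient.mkₐ_ker ℂ _).ge
    obtain ⟨h1, ⟨h2, h3, h4⟩, h5, ⟨h6, h7, h8⟩, h9⟩ := (keyIdeal_le_ker_iff_zero hs f
      (apply_X_eq_keyFamily f)).1 h
    change f _ = 0 at hx
    rw [coneSegreSectionIdeal_le_ker_iff]
    constructor
    · refine minors_two_four (N := fun i j => (f.comp (aeval fun o : Option (Fin 2 × Fin 4) =>
        o.elim (X (KeyVar.q 0)) fun ij => M ij.1 ij.2)) (X (some (i, j)))) ?_ ?_ ?_ ?_ ?_ ?_ <;>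
      simp only [M, AlgHom.comp_apply, aeval_X, Matrix.cons_val_zero, Matrix.cons_val_one,
        Matrix.cons_val, map_neg, Option.elim_some]
      · linear_combination -h9
      · linear_combination h7
      · linear_combination h8
      · linear_combination h3
      · linear_combination h4
      · linear_combination h1 - f (X (KeyVar.q 0)) * hx
    · simp [M]
  · rw [KeyVar.forall_iff]
    refine ⟨⟨?_, ?_, ?_⟩, ?_, ⟨?_, ?_, ?_⟩, ?_, ?_⟩
    · simpa using Ideal.mem_sup_right (Ideal.mem_span_singleton_self _)
    all_goals
      refine sub_mem_of_eq ?_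
      simp [N, M, coneVar]
  · rintro (_ | ⟨i, j⟩)
    · refine sub_mem_of_eq ?_
      simp
    · by_cases hij : i = 1 ∧ j = 1
      · obtain ⟨rfl, rfl⟩ := hij
        have := coneSegreSectionIdeal.neg_mem coneVar_add_mem
        convert this using 1
        simp [M, N, coneVar]
        ring
      · refine sub_mem_of_eq ?_
        revert hij
        fin_cases i <;> fin_cases j <;> simp [M, N, coneVar]

/-- The component inside `u = 0` of the fibre for `t = 0` and a nondegenerate `S`. There `p₄` does
not occur in the equations, so it is the variable of the cone. The conic `ᵗp S p = 0` is put in the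
form `p₀p₂ = p₁²` in order to be a minor. -/
theorem isConeSegreSection_of_rank_three {s : Sym2 (Fin 3) → ℂ}
    (hs : symMat s = !![0, 0, 1; 0, -2, 0; 1, 0, 0]) :
    IsConeSegreSection ((keyIdeal s 0).toIdeal ⊔ Ideal.span {X KeyVar.u}) := by
  let N := coneVar
  have hN := coneVar_isHomogeneous
  have hN' : ∀ i j, ((1 / 2 : ℂ) • N i j).IsHomogeneous 1 := fun i j => isHomogeneous_smul _
    (hN i j)
  have hX : ∀ v : KeyVar, (X v : MvPolynomial KeyVar ℂ).IsHomogeneous 1 := isHomogeneous_X ℂ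
  let M : Fin 2 → Fin 4 → MvPolynomial KeyVar ℂ :=
    ![![X (KeyVar.p 1), -X (KeyVar.p 0), X (KeyVar.q 2) + X (KeyVar.q 2), X KeyVar.r -
      X (KeyVar.q 1)],
      ![X (KeyVar.p 2), -X (KeyVar.p 1), -(X KeyVar.r + X (KeyVar.q 1)), X (KeyVar.q 0) +
        X (KeyVar.q 0)]]
  refine ProjEquiv.of_substitutions
    (keyFamily ![-N 0 1, N 0 0, N 1 0] (X none)
      ![(1 / 2 : ℂ) • N 1 3, -((1 / 2 : ℂ) • N 1 2 + (1 / 2 : ℂ) • N 0 3), (1 / 2 : ℂ) • N 0 2]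
      ((1 / 2 : ℂ) • N 0 3 - (1 / 2 : ℂ) • N 1 2) 0)
    (fun o => o.elim (X KeyVar.p4) fun ij => M ij.1 ij.2)
    (keyFamily_isHomogeneous ⟨⟨isHomogeneous_neg (hN _ _), hN _ _, hN _ _⟩,
      isHomogeneous_X ℂ _, ⟨hN' _ _, isHomogeneous_neg ((hN' _ _).add (hN' _ _)), hN' _ _⟩,
      (hN' _ _).sub (hN' _ _), isHomogeneous_zero _ _ _⟩)
    ?_ (le_comap_of_le_ker_comp ?_) (le_comap_of_le_ker_comp ?_) ?_ ?_
  · rintro (_ | ⟨i, j⟩)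
    · exact hX _
    · fin_cases i <;> fin_cases j
      exacts [hX _, isHomogeneous_neg (hX _), (hX _).add (hX _), (hX _).sub (hX _), hX _,
        isHomogeneous_neg (hX _), isHomogeneous_neg ((hX _).add (hX _)), (hX _).add (hX _)]
  · have h := mk_coneVar_minor
    have hadd := mk_coneVar_add
    set f := Ideal.Quotient.mkₐ ℂ coneSegreSectionIdeal
    refine (sup_span_singleton_le_ker_iff (RingHomClass.toRingHom (f.comp _))).2 ⟨?_, by simp⟩
    refine (keyIdeal_le_ker_iff_rank_three hs _ (comp_aeval_keyFamily f ..)).2 ?_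
    have h01 := h 0 1 0 1
    have h02 := h 0 1 0 2
    have h03 := h 0 1 0 3
    have h12 := h 0 1 1 2
    have h13 := h 0 1 1 3
    have h23 := h 0 1 2 3
    have ea := eq_two_mul_half (f (coneVar 0 2))
    have eb := eq_two_mul_half (f (coneVar 0 3))
    have ec := eq_two_mul_half (f (coneVar 1 2))
    have ed := eq_two_mul_half (f (coneVar 1 3))
    simp only [map_neg, map_zero, map_add, map_sub, map_smul, N]
    set a := (1 / 2 : ℂ) • f (coneVar 0 2)
    set b := (1 / 2 : ℂ) • f (coneVar 0 3)
    set c := (1 / 2 : ℂ) • f (coneVar 1 2)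
    set d := (1 / 2 : ℂ) • f (coneVar 1 3)
    rw [ea, ec] at h02 h12
    rw [eb, ed] at h03 h13
    rw [ea, eb, ec, ed] at h23
    refine ⟨two_mul_cancel ?_, ⟨?_, two_mul_cancel ?_, ?_⟩, ?_, ⟨?_, ?_, ?_⟩, ?_⟩
    · linear_combination -h13 - h02 - 2 * b * hadd
    · linear_combination h12 + 2 * a * hadd
    · linear_combination h13 - h02 + 2 * b * hadd
    · linear_combination -h03
    · linear_combination 2 * h01 - 2 * f (coneVar 0 0) * hadd
    · ring
    · ring
    · ring
    · linear_combination h23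
  · set f := Ideal.Quotient.mkₐ ℂ ((keyIdeal s 0).toIdeal ⊔ Ideal.span {X KeyVar.u})
    obtain ⟨h, hx⟩ := (sup_span_singleton_le_ker_iff (RingHomClass.toRingHom f)).1
      (Ideal.Quotient.mkₐ_ker ℂ _).ge
    obtain ⟨h1, ⟨h2, h3, h4⟩, h5, -, h9⟩ := (keyIdeal_le_ker_iff_rank_three hs f
      (apply_X_eq_keyFamily f)).1 h
    change f _ = 0 at hx
    rw [coneSegreSectionIdeal_le_ker_iff]
    constructor
    · refine minors_two_four (N := fun i j => (f.comp (aeval fun o : Option (Fin 2 × Fin 4) =>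
        o.elim (X KeyVar.p4) fun ij => M ij.1 ij.2)) (X (some (i, j)))) ?_ ?_ ?_ ?_ ?_ ?_ <;>
      simp only [M, AlgHom.comp_apply, aeval_X, Matrix.cons_val_zero, Matrix.cons_val_one,
        Matrix.cons_val, map_neg, map_add, map_sub, Option.elim_some]
      · exact two_mul_cancel (by linear_combination h5)
      · linear_combination -h3 - h1
      · linear_combination -h4
      · linear_combination h2
      · linear_combination h3 - h1
      · linear_combination h9 - f (X KeyVar.p4) * hx
    · simp [M]
  · rw [KeyVar.forall_iff]
    refine ⟨⟨?_, ?_, ?_⟩, ?_, ⟨?_, ?_, ?_⟩, ?_, ?_⟩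
    case refine_9 => simpa using Ideal.mem_sup_right (Ideal.mem_span_singleton_self _)
    all_goals
      refine sub_mem_of_eq ?_
      simp only [keyFamily_p, keyFamily_p4, keyFamily_q, keyFamily_r, N, M, coneVar,
        Matrix.cons_val_zero, Matrix.cons_val_one, Matrix.cons_val, map_add, map_sub, map_neg,
        map_smul, aeval_X, Option.elim_some, Option.elim_none]
      try module
  · rintro (_ | ⟨i, j⟩)
    · refine sub_mem_of_eq ?_
      simp
    · by_cases hij : i = 1 ∧ j = 1
      · obtain ⟨rfl, rfl⟩ := hij
        have := coneSegreSectionIdeal.neg_mem coneVar_add_mem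
        convert this using 1
        simp [M, N, coneVar]
        ring
      · refine sub_mem_of_eq ?_
        revert hij
        fin_cases i <;> fin_cases j <;> intro hij <;>
        simp only [Fin.zero_eta, Fin.mk_one, Fin.reduceFinMk, keyFamily_p, keyFamily_q,
          keyFamily_r, N, M, Matrix.cons_val_zero, Matrix.cons_val_one, Matrix.cons_val,
          map_add, map_sub, map_neg, aeval_X, Option.elim_some, coneVar]
        all_goals first
          | module
          | simp at hij

/-! ### Fibres with two components -/

theorem mem_of_mkₐ_eq_zero {A : Type} [CommRing A] [Algebra ℂ A] {I : Ideal A} {x : A}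
    (h : Ideal.Quotient.mkₐ ℂ I x = 0) : x ∈ I :=
  Ideal.Quotient.eq_zero_iff_mem.1 h

theorem mkₐ_eq_zero {A : Type} [CommRing A] [Algebra ℂ A] {I : Ideal A} {x : A}
    (h : x ∈ I) : Ideal.Quotient.mkₐ ℂ I x = 0 :=
  Ideal.Quotient.eq_zero_iff_mem.2 h

theorem X_mem_span_X_image_iff {σ : Type} {s : Set σ} {v : σ} :
    (X v : MvPolynomial σ ℂ) ∈ Ideal.span (X '' s) ↔ v ∈ s := by
  classical
  refine ⟨fun h => ?_, fun h => Ideal.subset_span (Set.mem_image_of_mem X h)⟩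
  rw [span_X_image_eq_ker, RingHom.mem_ker, aeval_X] at h
  by_contra hv
  rw [if_neg hv] at h
  exact X_ne_zero v h

/-- Two distinct variables form a regular sequence modulo a set of other variables. -/
theorem exists_of_X_mul_sub_X_mul_mem {σ : Type} {s : Set σ} {v w : σ} (hv : v ∉ s) (hw : w ∉ s)
    (hvw : v ≠ w) {a b : MvPolynomial σ ℂ} (h : X v * a - X w * b ∈ Ideal.span (X '' s)) :
    ∃ m, a - X w * m ∈ Ideal.span (X '' s) ∧ b - X v * m ∈ Ideal.span (X '' s) := by
  have hs : Ideal.span (X '' insert w s) = Ideal.span {X w} ⊔ (Ideal.span (X '' s) :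
      Ideal (MvPolynomial σ ℂ)) := by
    rw [Set.image_insert_eq, Ideal.span_insert]
  have h1 : X v * a ∈ Ideal.span (X '' insert w s) := by
    rw [hs]
    have : X v * a = X w * b + (X v * a - X w * b) := by ring
    rw [this]
    exact add_mem (Ideal.mem_sup_left (Ideal.mul_mem_right _ _ (Ideal.mem_span_singleton_self _)))
      (Ideal.mem_sup_right h)
  have h2 := ((isPrime_span_X_image (insert w s)).mem_or_mem h1).resolve_left fun h => by
    rw [X_mem_span_X_image_iff] at h
    exact h.elim hvw hv
  rw [hs] at h2
  obtain ⟨y, hy, z, hz, rfl⟩ := Submodule.mem_sup.1 h2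
  obtain ⟨m, rfl⟩ := Ideal.mem_span_singleton'.1 hy
  have hz' : m * X w + z - X w * m ∈ Ideal.span (X '' s) := by
    convert hz using 1
    ring
  refine ⟨m, hz', ((isPrime_span_X_image s).mem_or_mem (x := X w) ?_).resolve_left fun h =>
    hw (X_mem_span_X_image_iff.1 h)⟩
  have : X w * (b - X v * m) = X v * z - (X v * (m * X w + z) - X w * b) := by ring
  rw [this]
  exact sub_mem (Ideal.mul_mem_left _ _ hz) h

/-- Each product `pᵢqᵢ` becomes a sum of two squares through `x² + y² = (x + i y)(x - i y)`. -/
theorem isSmoothQuadric_hyperbolic_six : IsSmoothQuadric 4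
    (Ideal.span {X KeyVar.r, X KeyVar.p4, X KeyVar.u,
    X (KeyVar.p 0) * X (KeyVar.q 0) + (X (KeyVar.p 1) * X (KeyVar.q 1) + X (KeyVar.p 2) *
      X (KeyVar.q 2))} :
    Ideal (MvPolynomial KeyVar ℂ)) := by
  set J : Ideal (MvPolynomial KeyVar ℂ) := Ideal.span {X KeyVar.r, X KeyVar.p4, X KeyVar.u,
    X (KeyVar.p 0) * X (KeyVar.q 0) + (X (KeyVar.p 1) * X (KeyVar.q 1) + X (KeyVar.p 2) *
      X (KeyVar.q 2))} with hJ
  have h0 : X KeyVar.r ∈ J := Ideal.subset_span (by simp)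
  have h1 : X KeyVar.p4 ∈ J := Ideal.subset_span (by simp)
  have h2 : X KeyVar.u ∈ J := Ideal.subset_span (by simp)
  have h3 : X (KeyVar.p 0) * X (KeyVar.q 0) + (X (KeyVar.p 1) * X (KeyVar.q 1) + X (KeyVar.p 2) *
    X (KeyVar.q 2)) ∈ J :=
    Ideal.subset_span (by simp)
  have hI : ∀ τ : Type, (C Complex.I : MvPolynomial τ ℂ) * C Complex.I = -1 := fun τ => by
    rw [← C_mul, Complex.I_mul_I, C_neg, C_1]
  have ha : (2 : MvPolynomial KeyVar ℂ) * C (1 / 2) = 1 := by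
    rw [← map_ofNat C 2, ← C_mul, ← C_1]
    norm_num
  have ha' : (2 : MvPolynomial (Fin 6) ℂ) * C (1 / 2) = 1 := by
    rw [← map_ofNat C 2, ← C_mul, ← C_1]
    norm_num
  have hX : ∀ i, (X i : MvPolynomial (Fin 6) ℂ).IsHomogeneous 1 := isHomogeneous_X ℂ
  have hY : ∀ i, (X i : MvPolynomial KeyVar ℂ).IsHomogeneous 1 := isHomogeneous_X ℂ
  change ProjEquiv J (Ideal.span {(∑ i : Fin 6, X i ^ 2 : MvPolynomial (Fin 6) ℂ)})
  rw [Fin.sum_univ_six]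
  refine ProjEquiv.of_substitutions
    (keyFamily ![X 0 + C Complex.I * X 1, X 2 + C Complex.I * X 3, X 4 + C Complex.I * X 5] 0
      ![X 0 - C Complex.I * X 1, X 2 - C Complex.I * X 3, X 4 - C Complex.I * X 5] 0 0)
    ![C (1 / 2) * (X (KeyVar.p 0) + X (KeyVar.q 0)),
      -(C Complex.I * (C (1 / 2) * (X (KeyVar.p 0) - X (KeyVar.q 0)))),
      C (1 / 2) * (X (KeyVar.p 1) + X (KeyVar.q 1)),
        -(C Complex.I * (C (1 / 2) * (X (KeyVar.p 1) - X (KeyVar.q 1)))),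
      C (1 / 2) * (X (KeyVar.p 2) + X (KeyVar.q 2)),
        -(C Complex.I * (C (1 / 2) * (X (KeyVar.p 2) - X (KeyVar.q 2))))]
    (keyFamily_isHomogeneous ⟨⟨(hX _).add ((hX _).C_mul _), (hX _).add ((hX _).C_mul _),
      (hX _).add ((hX _).C_mul _)⟩, isHomogeneous_zero _ _ _, ⟨(hX _).sub ((hX _).C_mul _),
      (hX _).sub ((hX _).C_mul _), (hX _).sub ((hX _).C_mul _)⟩, isHomogeneous_zero _ _ _,
      isHomogeneous_zero _ _ _⟩) (fun j => ?_) ?_ ?_ ?_ fun j => sub_mem_of_eq ?_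
  · fin_cases j
    exacts [((hY _).add (hY _)).C_mul _, isHomogeneous_neg ((((hY _).sub (hY _)).C_mul _).C_mul _),
      ((hY _).add (hY _)).C_mul _, isHomogeneous_neg ((((hY _).sub (hY _)).C_mul _).C_mul _),
      ((hY _).add (hY _)).C_mul _, isHomogeneous_neg ((((hY _).sub (hY _)).C_mul _).C_mul _)]
  · refine Ideal.span_le.2 ?_
    simp only [Set.insert_subset_iff, Set.singleton_subset_iff, SetLike.mem_coe]
    refine ⟨mem_comap_of_eq_zero ?_, mem_comap_of_eq_zero ?_, mem_comap_of_eq_zero ?_,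
      mem_comap_span_of_eq ?_⟩
    · simp
    · simp
    · simp
    · simp only [map_add, map_mul, aeval_X, keyFamily_p, keyFamily_q, Matrix.cons_val_zero,
        Matrix.cons_val_one, Matrix.cons_val]
      linear_combination (-X 1 ^ 2 - X 3 ^ 2 - X 5 ^ 2) * hI (Fin 6)
  · rw [Ideal.span_singleton_le_iff_mem, Ideal.mem_comap]
    convert h3 using 1
    simp only [map_add, map_pow, aeval_X, Matrix.cons_val_zero,
      Matrix.cons_val_one, Matrix.cons_val]
    set a : MvPolynomial KeyVar ℂ := C (1 / 2)
    linear_combination (a ^ 2 * ((X (KeyVar.p 0) - X (KeyVar.q 0)) ^ 2 +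
      (X (KeyVar.p 1) - X (KeyVar.q 1)) ^ 2 +
      (X (KeyVar.p 2) - X (KeyVar.q 2)) ^ 2)) * hI KeyVar + (2 * a + 1) *
        (X (KeyVar.p 0) * X (KeyVar.q 0) +
        (X (KeyVar.p 1) * X (KeyVar.q 1) + X (KeyVar.p 2) * X (KeyVar.q 2))) * ha
  · have key : ∀ P Q : MvPolynomial KeyVar ℂ, C (1 / 2) * (P + Q) +
        C Complex.I * -(C Complex.I * (C (1 / 2) * (P - Q))) = P := fun P Q => by
      linear_combination -C (1 / 2) * (P - Q) * hI KeyVar + P * ha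
    have key' : ∀ P Q : MvPolynomial KeyVar ℂ, C (1 / 2) * (P + Q) -
        C Complex.I * -(C Complex.I * (C (1 / 2) * (P - Q))) = Q := fun P Q => by
      linear_combination C (1 / 2) * (P - Q) * hI KeyVar + Q * ha
    rw [KeyVar.forall_iff]
    simp only [keyFamily_p, keyFamily_p4, keyFamily_q, keyFamily_r, keyFamily_u,
      Matrix.cons_val_zero, Matrix.cons_val_one, Matrix.cons_val, map_add, map_sub, map_mul,
      aeval_X, aeval_C, algebraMap_eq, key, key', sub_self, map_zero, zero_sub, neg_mem_iff,
      h0, h1, h2, J.zero_mem, and_self]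
  · have key : ∀ P Q : MvPolynomial (Fin 6) ℂ, C (1 / 2) * (P + C Complex.I * Q +
        (P - C Complex.I * Q)) = P := fun P Q => by
      linear_combination P * ha'
    have key' : ∀ P Q : MvPolynomial (Fin 6) ℂ, -(C Complex.I * (C (1 / 2) * (P + C Complex.I * Q -
        (P - C Complex.I * Q)))) = Q := fun P Q => by
      linear_combination -2 * C (1 / 2) * Q * hI (Fin 6) + Q * ha'
    fin_cases j <;>
    simp only [Fin.zero_eta, Fin.mk_one, Fin.reduceFinMk, keyFamily_p, keyFamily_q,
      Matrix.cons_val_zero, Matrix.cons_val_one, Matrix.cons_val, map_add, map_sub, map_mul,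
      map_neg, aeval_X, aeval_C, algebraMap_eq, key, key']

/-- The linear form `p₀` multiplies the ideal of the quadric into that of the fibre. -/
theorem exists_decomposition_of_zero {s : Sym2 (Fin 3) → ℂ} (hs : symMat s = 0) :
    ∃ J₁ J₂ : Ideal (MvPolynomial KeyVar ℂ), IsConeSegreSection J₁ ∧ IsSmoothQuadric 4 J₂ ∧
      IsQuadric 4 J₂ ∧ (keyIdeal s ![1, 0, 0]).toIdeal = J₁ ⊓ J₂ := by
  refine ⟨_, _, isConeSegreSection_of_zero hs, isSmoothQuadric_hyperbolic_six,
    isQuadric_hyperbolic_six, ?_⟩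
  have hprime := isQuadric_hyperbolic_six.isPrime
  rw [inf_comm]
  refine (inf_sup_span_singleton_eq ?_ ?_ ?_).symm
  · set f := Ideal.Quotient.mkₐ ℂ (Ideal.span {X KeyVar.r, X KeyVar.p4, X KeyVar.u,
      X (KeyVar.p 0) * X (KeyVar.q 0) + (X (KeyVar.p 1) * X (KeyVar.q 1) + X (KeyVar.p 2) *
        X (KeyVar.q 2))} :
      Ideal (MvPolynomial KeyVar ℂ))
    have h0 : f (X KeyVar.r) = 0 := mkₐ_eq_zero (Ideal.subset_span (by simp))
    have h1 : f (X KeyVar.p4) = 0 := mkₐ_eq_zero (Ideal.subset_span (by simp))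
    have h2 : f (X KeyVar.u) = 0 := mkₐ_eq_zero (Ideal.subset_span (by simp))
    have h3 : f (X (KeyVar.p 0) * X (KeyVar.q 0) +
      (X (KeyVar.p 1) * X (KeyVar.q 1) + X (KeyVar.p 2) * X (KeyVar.q 2))) = 0 :=
      mkₐ_eq_zero (Ideal.subset_span (by simp))
    have h := (keyIdeal_le_ker_iff_zero hs f (apply_X_eq_keyFamily f)).2 (by
      simp only [map_add, map_mul] at h3
      simp only [h0, h1, h2, zero_mul, zero_add, sub_self, and_self, and_true, mul_zero,
        zero_pow, ne_eq, OfNat.ofNat_ne_zero, not_false_eq_true]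
      linear_combination h3)
    exact fun x hx => mem_of_mkₐ_eq_zero (h hx)
  · refine notMem_span_of_eval (keyFamily ![1, 0, 0] 0 ![0, 0, 0] 0 0) ?_ (by simp)
    simp
  · set f := Ideal.Quotient.mkₐ ℂ (keyIdeal s ![1, 0, 0]).toIdeal
    obtain ⟨h1, ⟨h2, h3, h4⟩, h5, ⟨h6, h7, h8⟩, h9⟩ := (keyIdeal_le_ker_iff_zero hs f
      (apply_X_eq_keyFamily f)).1 (Ideal.Quotient.mkₐ_ker ℂ _).ge
    refine forall_mem_span_mul_mem ?_
    simp only [Set.mem_insert_iff, Set.mem_singleton_iff, forall_eq_or_imp, forall_eq]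
    refine ⟨?_, ?_, ?_, ?_⟩ <;> refine mem_of_mkₐ_eq_zero ?_ <;> change f _ = 0 <;>
      simp only [map_mul, map_add]
    · linear_combination h2
    · linear_combination h5
    · linear_combination h6
    · linear_combination f (X (KeyVar.p 0)) * h1

/-- The linear form `u` multiplies the ideal of the quadric into that of the fibre. -/
theorem isConeUnionQuadric_of_rank_three {s : Sym2 (Fin 3) → ℂ}
    (hs : symMat s = !![0, 0, 1; 0, -2, 0; 1, 0, 0]) :
    IsConeUnionQuadric (keyIdeal s 0).toIdeal := by
  refine ⟨_, _, isConeSegreSection_of_rank_three hs, isQuadric_rank_six, ?_⟩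
  have hprime := isQuadric_rank_six.isPrime
  rw [inf_comm]
  refine (inf_sup_span_singleton_eq ?_ ?_ ?_).symm
  · set f := Ideal.Quotient.mkₐ ℂ (Ideal.span {X (KeyVar.p 0), X (KeyVar.p 1), X (KeyVar.p 2),
      X KeyVar.u * X KeyVar.p4 + (X KeyVar.r ^ 2 + 4 * (X (KeyVar.q 0) * X (KeyVar.q 2)) -
        X (KeyVar.q 1) ^ 2)} :
      Ideal (MvPolynomial KeyVar ℂ))
    have h0 : f (X (KeyVar.p 0)) = 0 := mkₐ_eq_zero (Ideal.subset_span (by simp))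
    have h1 : f (X (KeyVar.p 1)) = 0 := mkₐ_eq_zero (Ideal.subset_span (by simp))
    have h2 : f (X (KeyVar.p 2)) = 0 := mkₐ_eq_zero (Ideal.subset_span (by simp))
    have h3 : f (X KeyVar.u * X KeyVar.p4 + (X KeyVar.r ^ 2 + 4 *
      (X (KeyVar.q 0) * X (KeyVar.q 2)) - X (KeyVar.q 1) ^ 2)) = 0 :=
      mkₐ_eq_zero (Ideal.subset_span (by simp))
    have h := (keyIdeal_le_ker_iff_rank_three hs f (apply_X_eq_keyFamily f)).2 (by
      simp only [map_add, map_mul, map_sub, map_pow, map_ofNat] at h3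
      simp only [h0, h1, h2, zero_mul, zero_add, sub_self, and_self, true_and, mul_zero,
        zero_pow, ne_eq, OfNat.ofNat_ne_zero, not_false_eq_true]
      linear_combination h3)
    exact fun x hx => mem_of_mkₐ_eq_zero (h hx)
  · refine notMem_span_of_eval (keyFamily ![0, 0, 0] 0 ![0, 0, 0] 0 1) ?_ (by simp)
    simp
  · set f := Ideal.Quotient.mkₐ ℂ (keyIdeal s 0).toIdeal
    obtain ⟨-, -, -, ⟨h6, h7, h8⟩, h9⟩ := (keyIdeal_le_ker_iff_rank_three hs f
      (apply_X_eq_keyFamily f)).1 (Ideal.Quotient.mkₐ_ker ℂ _).ge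
    refine forall_mem_span_mul_mem ?_
    simp only [Set.mem_insert_iff, Set.mem_singleton_iff, forall_eq_or_imp, forall_eq]
    refine ⟨?_, ?_, ?_, ?_⟩ <;> refine mem_of_mkₐ_eq_zero ?_ <;> change f _ = 0 <;>
      simp only [map_mul, map_add, map_sub, map_pow, map_ofNat]
    · linear_combination h6
    · linear_combination h7
    · linear_combination h8
    · linear_combination f (X KeyVar.u) * h9

/-- The fibre for `S = 0` and `t = 0`. The equations include `r p = 0` and `u p = 0`; that the
intersection of the two ideals is not larger follows from `r, u` being a regular sequence modulo
`p₀, p₁, p₂`. -/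
theorem exists_decomposition_of_rank_zero {s : Sym2 (Fin 3) → ℂ} (hs : symMat s = 0) :
    ∃ J₁ J₂ : Ideal (MvPolynomial KeyVar ℂ),
      J₁ = Ideal.span {X KeyVar.r, X KeyVar.u, ∑ i, X (KeyVar.p i) * X (KeyVar.q i)} ∧
      J₂ = Ideal.span {X (KeyVar.p 0), X (KeyVar.p 1), X (KeyVar.p 2),
        X KeyVar.r ^ 2 + X KeyVar.p4 * X KeyVar.u} ∧
      IsQuadric 5 J₁ ∧ IsQuadric 4 J₂ ∧ (keyIdeal s 0).toIdeal = J₁ ⊓ J₂ := by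
  have e1 : (∑ i, X (KeyVar.p i) * X (KeyVar.q i) : MvPolynomial KeyVar ℂ) =
      X (KeyVar.p 0) * X (KeyVar.q 0) + (X (KeyVar.p 1) * X (KeyVar.q 1) + X (KeyVar.p 2) *
        X (KeyVar.q 2)) := by
    rw [Fin.sum_univ_three, add_assoc]
  have e2 : (X KeyVar.r ^ 2 + X KeyVar.p4 * X KeyVar.u : MvPolynomial KeyVar ℂ) =
      X KeyVar.u * X KeyVar.p4 + X KeyVar.r ^ 2 := by ring
  rw [e1, e2]
  refine ⟨_, _, rfl, rfl, isQuadric_five, isQuadric_rank_three, ?_⟩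
  set J₁ : Ideal (MvPolynomial KeyVar ℂ) := Ideal.span {X KeyVar.r, X KeyVar.u,
    X (KeyVar.p 0) * X (KeyVar.q 0) + (X (KeyVar.p 1) * X (KeyVar.q 1) + X (KeyVar.p 2) *
      X (KeyVar.q 2))}
  set J₂ : Ideal (MvPolynomial KeyVar ℂ) := Ideal.span {X (KeyVar.p 0), X (KeyVar.p 1),
    X (KeyVar.p 2),
    X KeyVar.u * X KeyVar.p4 + X KeyVar.r ^ 2}
  set I := (keyIdeal s 0).toIdeal
  obtain ⟨h1, ⟨h2, h3, h4⟩, ⟨h6, h7, h8⟩, h9⟩ := (keyIdeal_le_ker_iff_rank_zero hs _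
    (apply_X_eq_keyFamily (Ideal.Quotient.mkₐ ℂ I))).1 (Ideal.Quotient.mkₐ_ker ℂ _).ge
  have hdot : X (KeyVar.p 0) * X (KeyVar.q 0) + (X (KeyVar.p 1) * X (KeyVar.q 1) + X (KeyVar.p 2) *
    X (KeyVar.q 2)) ∈ I := by
    refine mem_of_mkₐ_eq_zero ?_
    simp only [map_mul, map_add]
    linear_combination h1
  have hquad : X KeyVar.u * X KeyVar.p4 + X KeyVar.r ^ 2 ∈ I := by
    refine mem_of_mkₐ_eq_zero ?_
    simp only [map_mul, map_add, map_pow]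
    linear_combination h9
  have hp : ∀ y ∈ Ideal.span (X '' {KeyVar.p 0, KeyVar.p 1, KeyVar.p 2}),
      X KeyVar.r * y ∈ I ∧ X KeyVar.u * y ∈ I := by
    intro y hy
    refine ⟨forall_mem_span_mul_mem ?_ y hy, forall_mem_span_mul_mem ?_ y hy⟩
    · rintro _ ⟨v, (rfl | rfl | rfl), rfl⟩
      exacts [mem_of_mkₐ_eq_zero h2, mem_of_mkₐ_eq_zero h3, mem_of_mkₐ_eq_zero h4]
    · rintro _ ⟨v, (rfl | rfl | rfl), rfl⟩
      exacts [mem_of_mkₐ_eq_zero h6, mem_of_mkₐ_eq_zero h7, mem_of_mkₐ_eq_zero h8]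
  refine le_antisymm (le_inf ?_ ?_) ?_
  · have g0 : Ideal.Quotient.mkₐ ℂ J₁ (X KeyVar.r) = 0 := mkₐ_eq_zero (Ideal.subset_span (by simp))
    have g1 : Ideal.Quotient.mkₐ ℂ J₁ (X KeyVar.u) = 0 := mkₐ_eq_zero (Ideal.subset_span (by simp))
    have g2 : Ideal.Quotient.mkₐ ℂ J₁ (X (KeyVar.p 0) * X (KeyVar.q 0) +
      (X (KeyVar.p 1) * X (KeyVar.q 1) +
      X (KeyVar.p 2) * X (KeyVar.q 2))) = 0 := mkₐ_eq_zero (Ideal.subset_span (by simp))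
    have h := (keyIdeal_le_ker_iff_rank_zero hs _
      (apply_X_eq_keyFamily (Ideal.Quotient.mkₐ ℂ J₁))).2 (by
        simp only [map_add, map_mul] at g2
        simp only [g0, g1, zero_mul, zero_add, and_self, and_true, zero_pow, ne_eq,
          OfNat.ofNat_ne_zero, not_false_eq_true]
        linear_combination g2)
    exact fun x hx => mem_of_mkₐ_eq_zero (h hx)
  · have g0 : Ideal.Quotient.mkₐ ℂ J₂ (X (KeyVar.p 0)) = 0 :=
      mkₐ_eq_zero (Ideal.subset_span (by simp))
    have g1 : Ideal.Quotient.mkₐ ℂ J₂ (X (KeyVar.p 1)) = 0 :=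
      mkₐ_eq_zero (Ideal.subset_span (by simp))
    have g2 : Ideal.Quotient.mkₐ ℂ J₂ (X (KeyVar.p 2)) = 0 :=
      mkₐ_eq_zero (Ideal.subset_span (by simp))
    have g3 : Ideal.Quotient.mkₐ ℂ J₂ (X KeyVar.u * X KeyVar.p4 + X KeyVar.r ^ 2) = 0 :=
      mkₐ_eq_zero (Ideal.subset_span (by simp))
    have h := (keyIdeal_le_ker_iff_rank_zero hs _
      (apply_X_eq_keyFamily (Ideal.Quotient.mkₐ ℂ J₂))).2 (by
        simp only [map_add, map_mul, map_pow] at g3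
        simp only [g0, g1, g2, zero_mul, mul_zero, zero_add, and_self, true_and]
        exact g3)
    exact fun x hx => mem_of_mkₐ_eq_zero (h hx)
  · rintro f ⟨hf1, hf2⟩
    obtain ⟨a, y, hy, rfl⟩ := Ideal.mem_span_insert.1 hf1
    obtain ⟨b, z, hz, rfl⟩ := Ideal.mem_span_insert.1 hy
    obtain ⟨c, rfl⟩ := Ideal.mem_span_singleton'.1 hz
    have hJ₂ : J₂ ≤ Ideal.span {X KeyVar.u * X KeyVar.p4 + X KeyVar.r ^ 2} ⊔
        Ideal.span (X '' {KeyVar.p 0, KeyVar.p 1, KeyVar.p 2}) := by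
      refine Ideal.span_le.2 ?_
      simp only [Set.insert_subset_iff, Set.singleton_subset_iff, SetLike.mem_coe]
      exact ⟨Ideal.mem_sup_right (Ideal.subset_span ⟨_, by simp, rfl⟩),
        Ideal.mem_sup_right (Ideal.subset_span ⟨_, by simp, rfl⟩),
        Ideal.mem_sup_right (Ideal.subset_span ⟨_, by simp, rfl⟩),
        Ideal.mem_sup_left (Ideal.mem_span_singleton_self _)⟩
    obtain ⟨g, hg, y, hy, hgy⟩ := Submodule.mem_sup.1 (hJ₂ hf2)
    obtain ⟨e, rfl⟩ := Ideal.mem_span_singleton'.1 hg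
    have hdot' : X (KeyVar.p 0) * X (KeyVar.q 0) +
      (X (KeyVar.p 1) * X (KeyVar.q 1) + X (KeyVar.p 2) * X (KeyVar.q 2)) ∈
        (Ideal.span (X '' {KeyVar.p 0, KeyVar.p 1, KeyVar.p 2}) :
          Ideal (MvPolynomial KeyVar ℂ)) := by
      refine add_mem (Ideal.mul_mem_right _ _ ?_) (add_mem (Ideal.mul_mem_right _ _ ?_)
        (Ideal.mul_mem_right _ _ ?_)) <;>
      exact X_mem_span_X_image_iff.2 (by simp)
    obtain ⟨m, hm1, hm2⟩ := exists_of_X_mul_sub_X_mul_mem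
      (s := {KeyVar.p 0, KeyVar.p 1, KeyVar.p 2})
      (v := .r) (w := .u) (by simp) (by simp) (by simp) (a := a - e * X KeyVar.r)
        (b := e * X KeyVar.p4 - b) (by
        have := sub_mem hy (Ideal.mul_mem_left _ c hdot')
        convert this using 1
        linear_combination -hgy)
    have e3 : a * X KeyVar.r + (b * X KeyVar.u + c *
      (X (KeyVar.p 0) * X (KeyVar.q 0) + (X (KeyVar.p 1) * X (KeyVar.q 1) +
        X (KeyVar.p 2) * X (KeyVar.q 2)))) = X KeyVar.r * (a - e * X KeyVar.r - X KeyVar.u * m) -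
          X KeyVar.u * (e * X KeyVar.p4 - b - X KeyVar.r * m) + e *
            (X KeyVar.u * X KeyVar.p4 + X KeyVar.r ^ 2) +
          c * (X (KeyVar.p 0) * X (KeyVar.q 0) + (X (KeyVar.p 1) * X (KeyVar.q 1) +
            X (KeyVar.p 2) * X (KeyVar.q 2))) := by ring
    rw [e3]
    exact add_mem (add_mem (sub_mem (hp _ hm1).1 (hp _ hm2).2) (Ideal.mul_mem_left _ _ hquad))
      (Ideal.mul_mem_left _ _ hdot)

/-! ### The fibre over a zero vector and a matrix of rank two -/

/-- The fibre for `t = 0` and `S = 2 x₀x₁`. The linear form `u` splits off the quadric inside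
`p = 0`, and then `q₂ - r` splits off one of the two quadrics inside `u = 0`. -/
theorem exists_decomposition_of_rank_two {s : Sym2 (Fin 3) → ℂ}
    (hs : symMat s = !![0, 1, 0; 1, 0, 0; 0, 0, 0]) :
    ∃ J₁ J₂ J₃ : Ideal (MvPolynomial KeyVar ℂ),
        IsQuadric 4 J₁ ∧ IsQuadric 4 J₂ ∧ IsQuadric 4 J₃ ∧
        J₁ ≠ J₂ ∧ J₁ ≠ J₃ ∧ J₂ ≠ J₃ ∧ (keyIdeal s 0).toIdeal = J₁ ⊓ J₂ ⊓ J₃ := by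
  have hq₁ := isQuadric_rank_four
  have hq₂ := isQuadric_split_pos
  have hq₃ := isQuadric_split_neg
  have hu₁ : X KeyVar.u ∉ (Ideal.span {X (KeyVar.p 0), X (KeyVar.p 1), X (KeyVar.p 2),
      X KeyVar.u * X KeyVar.p4 + (X KeyVar.r ^ 2 - X (KeyVar.q 2) ^ 2)} : Ideal
        (MvPolynomial KeyVar ℂ)) :=
    notMem_span_of_eval (keyFamily ![0, 0, 0] 0 ![0, 0, 0] 0 1) (by simp) (by simp)
  have hx₃ : X (KeyVar.q 2) - X KeyVar.r ∉ (Ideal.span {X KeyVar.u, -X (KeyVar.q 2) - X KeyVar.r,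
    X (KeyVar.p 0),
      X (KeyVar.p 1) * X (KeyVar.q 1) + X (KeyVar.p 2) * X (KeyVar.q 2)} : Ideal
        (MvPolynomial KeyVar ℂ)) :=
    notMem_span_of_eval (keyFamily ![0, 0, 0] 0 ![0, 0, 1] (-1) 0) (by simp) (by simp)
  set J₁ : Ideal (MvPolynomial KeyVar ℂ) := Ideal.span {X (KeyVar.p 0), X (KeyVar.p 1),
    X (KeyVar.p 2),
    X KeyVar.u * X KeyVar.p4 + (X KeyVar.r ^ 2 - X (KeyVar.q 2) ^ 2)}
  set J₂ : Ideal (MvPolynomial KeyVar ℂ) := Ideal.span {X KeyVar.u, X (KeyVar.q 2) - X KeyVar.r,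
    X (KeyVar.p 1),
    X (KeyVar.p 0) * X (KeyVar.q 0) + X (KeyVar.p 2) * X (KeyVar.q 2)}
  set J₃ : Ideal (MvPolynomial KeyVar ℂ) := Ideal.span {X KeyVar.u, -X (KeyVar.q 2) - X KeyVar.r,
    X (KeyVar.p 0),
    X (KeyVar.p 1) * X (KeyVar.q 1) + X (KeyVar.p 2) * X (KeyVar.q 2)}
  set I := (keyIdeal s 0).toIdeal with hI
  have hp₁ := hq₁.isPrime
  have hp₃ := hq₃.isPrime
  have hu₂ : X KeyVar.u ∈ J₂ := Ideal.subset_span (by simp)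
  have hu₃ : X KeyVar.u ∈ J₃ := Ideal.subset_span (by simp)
  have hx₂ : X (KeyVar.q 2) - X KeyVar.r ∈ J₂ := Ideal.subset_span (by simp)
  refine ⟨J₁, J₂, J₃, hq₁, hq₂, hq₃, fun h => hu₁ (h ▸ hu₂), fun h => hu₁ (h ▸ hu₃),
    fun h => hx₃ (h ▸ hx₂), ?_⟩
  have hker : ∀ J : Ideal (MvPolynomial KeyVar ℂ), RingHom.ker (Ideal.Quotient.mkₐ ℂ J) = J :=
    fun J => Ideal.ext fun _ => Ideal.Quotient.eq_zero_iff_mem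
  have hle := fun J : Ideal (MvPolynomial KeyVar ℂ) =>
    keyIdeal_le_ker_iff_rank_two hs _ (apply_X_eq_keyFamily (Ideal.Quotient.mkₐ ℂ J))
  simp only [hker] at hle
  -- the component outside `u = 0`
  have e₁ : J₁ ⊓ (I ⊔ Ideal.span {X KeyVar.u}) = I := by
    refine inf_sup_span_singleton_eq ?_ hu₁ ?_
    · have hle' := hle J₁
      set f := Ideal.Quotient.mkₐ ℂ J₁
      have h0 : f (X (KeyVar.p 0)) = 0 := mkₐ_eq_zero (Ideal.subset_span (by simp))
      have h1 : f (X (KeyVar.p 1)) = 0 := mkₐ_eq_zero (Ideal.subset_span (by simp))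
      have h2 : f (X (KeyVar.p 2)) = 0 := mkₐ_eq_zero (Ideal.subset_span (by simp))
      have h3 : f (X KeyVar.u * X KeyVar.p4 + (X KeyVar.r ^ 2 - X (KeyVar.q 2) ^ 2)) = 0 :=
        mkₐ_eq_zero (Ideal.subset_span (by simp))
      refine hle'.2 ?_
      simp only [map_add, map_mul, map_sub, map_pow] at h3
      simp only [h0, h1, h2, zero_mul, zero_add, sub_self, and_self, true_and, mul_zero]
      linear_combination h3
    · set f := Ideal.Quotient.mkₐ ℂ I
      obtain ⟨-, -, -, ⟨h6, h7, h8⟩, h9⟩ := (hle I).1 le_rfl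
      refine forall_mem_span_mul_mem ?_
      simp only [Set.mem_insert_iff, Set.mem_singleton_iff, forall_eq_or_imp, forall_eq]
      refine ⟨mem_of_mkₐ_eq_zero h6, mem_of_mkₐ_eq_zero h7, mem_of_mkₐ_eq_zero h8,
        Ideal.mul_mem_left _ _ (mem_of_mkₐ_eq_zero h9)⟩
  set K := I ⊔ Ideal.span {X KeyVar.u} with hK
  have hIK : I ≤ K := le_sup_left
  have huK : X KeyVar.u ∈ K := Ideal.mem_sup_right (Ideal.mem_span_singleton_self _)
  have e₃ : J₃ ⊓ (K ⊔ Ideal.span {X (KeyVar.q 2) - X KeyVar.r}) = K := by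
    refine inf_sup_span_singleton_eq (sup_le ((hle J₃).2 ?_) ?_) hx₃ ?_
    · set f := Ideal.Quotient.mkₐ ℂ J₃
      have h0 : f (X KeyVar.u) = 0 := mkₐ_eq_zero (Ideal.subset_span (by simp))
      have h1 : f (-X (KeyVar.q 2) - X KeyVar.r) = 0 := mkₐ_eq_zero (Ideal.subset_span (by simp))
      have h2 : f (X (KeyVar.p 0)) = 0 := mkₐ_eq_zero (Ideal.subset_span (by simp))
      have h3 : f (X (KeyVar.p 1) * X (KeyVar.q 1) + X (KeyVar.p 2) * X (KeyVar.q 2)) = 0 :=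
        mkₐ_eq_zero (Ideal.subset_span (by simp))
      simp only [map_add, map_mul, map_sub, map_neg] at h3 h1
      simp only [h0, h2, zero_mul, zero_add, sub_self, and_self, true_and, mul_zero, add_zero]
      refine ⟨h3, ⟨?_, ?_⟩, ?_⟩
      · linear_combination -f (X (KeyVar.p 1)) * h1
      · linear_combination -f (X (KeyVar.p 2)) * h1 - h3
      · linear_combination (f (X (KeyVar.q 2)) - f (X KeyVar.r)) * h1
    · rwa [Ideal.span_singleton_le_iff_mem]
    · obtain ⟨h1, ⟨h2, h3, h4⟩, h5, ⟨h6, h7, h8⟩, h9⟩ := (hle K).1 hIK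
      have h10 := mkₐ_eq_zero huK
      set f := Ideal.Quotient.mkₐ ℂ K
      refine forall_mem_span_mul_mem ?_
      simp only [Set.mem_insert_iff, Set.mem_singleton_iff, forall_eq_or_imp, forall_eq]
      refine ⟨Ideal.mul_mem_left _ _ huK, ?_, ?_, ?_⟩ <;> refine mem_of_mkₐ_eq_zero ?_ <;>
        change f _ = 0 <;> simp only [map_mul, map_add, map_sub, map_neg]
      · linear_combination h9 - f (X KeyVar.p4) * h10
      · linear_combination -h2
      · linear_combination (f (X (KeyVar.q 2)) - f (X KeyVar.r)) * h1 + f (X (KeyVar.q 0)) * h2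
  set L := K ⊔ Ideal.span {X (KeyVar.q 2) - X KeyVar.r} with hL
  have hIL : I ≤ L := hIK.trans le_sup_left
  have huL : X KeyVar.u ∈ L := Ideal.mem_sup_left huK
  have hxL : X (KeyVar.q 2) - X KeyVar.r ∈ L := Ideal.mem_sup_right
    (Ideal.mem_span_singleton_self _)
  -- `L` has an embedded component inside the third quadric
  set s' : Set KeyVar := {.u, .r, .q 2, .q 1, .p 0}
  set E : Ideal (MvPolynomial KeyVar ℂ) := Ideal.span (X '' s') with hE
  have hpE : E.IsPrime := isPrime_span_X_image s'
  have hE' : ∀ v ∈ s', Ideal.Quotient.mkₐ ℂ E (X v) = 0 := fun v hv =>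
    mkₐ_eq_zero (X_mem_span_X_image_iff.2 hv)
  have g0 := hE' .u (by simp [s'])
  have g1 := hE' .r (by simp [s'])
  have g2 := hE' (KeyVar.q 2) (by simp [s'])
  have g3 := hE' (KeyVar.q 1) (by simp [s'])
  have g4 := hE' (KeyVar.p 0) (by simp [s'])
  have hJE : J₃ ≤ E := by
    refine Ideal.span_le.2 ?_
    simp only [Set.insert_subset_iff, Set.singleton_subset_iff, SetLike.mem_coe]
    refine ⟨?_, ?_, ?_, ?_⟩ <;> refine mem_of_mkₐ_eq_zero ?_ <;>
      simp only [map_add, map_sub, map_neg, map_mul, g0, g1, g2, g3, g4] <;> ring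
  have hLE : L ≤ E := by
    refine sup_le (sup_le ((hle E).2 ?_) ?_) ?_
    · simp only [g0, g1, g2, g3, g4]
      ring_nf
      simp only [and_self]
    · rw [Ideal.span_singleton_le_iff_mem]
      exact mem_of_mkₐ_eq_zero g0
    · rw [Ideal.span_singleton_le_iff_mem]
      refine mem_of_mkₐ_eq_zero ?_
      rw [map_sub, g1, g2, sub_zero]
  obtain ⟨h1, ⟨h2, h3, h4⟩, h5, ⟨h6, h7, h8⟩, h9⟩ := (hle L).1 hIL
  have h10 := mkₐ_eq_zero huL
  have h11 := mkₐ_eq_zero hxL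
  set f := Ideal.Quotient.mkₐ ℂ L with hf
  rw [map_sub] at h11
  -- `p₁` splits off the embedded component `E`, and only the second quadric is left
  have e₂ : E ⊓ (L ⊔ Ideal.span {X (KeyVar.p 1)}) = L := by
    refine inf_sup_span_singleton_eq hLE ?_ ?_
    · rw [X_mem_span_X_image_iff]
      simp [s']
    · refine forall_mem_span_mul_mem ?_
      rintro _ ⟨v, (rfl | rfl | rfl | rfl | rfl), rfl⟩ <;> refine mem_of_mkₐ_eq_zero ?_ <;>
        change f _ = 0 <;> rw [map_mul] <;> refine two_mul_cancel ?_
      · linear_combination 2 * f (X (KeyVar.p 1)) * h10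
      · linear_combination h3 - f (X (KeyVar.p 1)) * h11
      · linear_combination h3 + f (X (KeyVar.p 1)) * h11
      · linear_combination h1 - h4 - f (X (KeyVar.p 2)) * h11
      · linear_combination h5
  have hJL : J₂ ≤ L ⊔ Ideal.span {X (KeyVar.p 1)} := by
    have hp : X (KeyVar.p 1) ∈ L ⊔ Ideal.span {X (KeyVar.p 1)} :=
      Ideal.mem_sup_right (Ideal.mem_span_singleton_self _)
    refine Ideal.span_le.2 ?_
    simp only [Set.insert_subset_iff, Set.singleton_subset_iff, SetLike.mem_coe]
    refine ⟨Ideal.mem_sup_left huL, Ideal.mem_sup_left hxL, hp, ?_⟩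
    have : X (KeyVar.p 0) * X (KeyVar.q 0) + X (KeyVar.p 2) * X (KeyVar.q 2) = X (KeyVar.p 0) *
      X (KeyVar.q 0) + X (KeyVar.p 1) * X (KeyVar.q 1) +
      X (KeyVar.p 2) * X (KeyVar.q 2) - X (KeyVar.q 1) *
        (X (KeyVar.p 1) : MvPolynomial KeyVar ℂ) := by ring
    rw [this]
    refine sub_mem (Ideal.mem_sup_left (mem_of_mkₐ_eq_zero ?_)) (Ideal.mul_mem_left _ _ hp)
    simpa only [map_add, map_mul] using h1
  have hI₂ : K ≤ J₂ := by
    refine sup_le ((hle J₂).2 ?_) ?_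
    · set f := Ideal.Quotient.mkₐ ℂ J₂
      have h0 : f (X KeyVar.u) = 0 := mkₐ_eq_zero (Ideal.subset_span (by simp))
      have h1 : f (X (KeyVar.q 2) - X KeyVar.r) = 0 := mkₐ_eq_zero (Ideal.subset_span (by simp))
      have h2 : f (X (KeyVar.p 1)) = 0 := mkₐ_eq_zero (Ideal.subset_span (by simp))
      have h3 : f (X (KeyVar.p 0) * X (KeyVar.q 0) + X (KeyVar.p 2) * X (KeyVar.q 2)) = 0 :=
        mkₐ_eq_zero (Ideal.subset_span (by simp))
      simp only [map_add, map_mul, map_sub] at h3 h1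
      simp only [h0, h2, zero_mul, zero_add, and_self, true_and, mul_zero, add_zero]
      refine ⟨h3, ⟨?_, ?_⟩, ?_⟩
      · linear_combination -f (X (KeyVar.p 0)) * h1
      · linear_combination -f (X (KeyVar.p 2)) * h1 + h3
      · linear_combination -(f (X (KeyVar.q 2)) + f (X KeyVar.r)) * h1
    · rwa [Ideal.span_singleton_le_iff_mem]
  have e₄ : J₂ ⊓ J₃ = K := by
    refine le_antisymm ?_ (le_inf hI₂ (e₃ ▸ inf_le_left))
    rw [← e₃]
    refine le_inf inf_le_right ?_
    rw [← e₂]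
    exact le_inf (inf_le_right.trans hJE) (inf_le_left.trans hJL)
  rw [inf_assoc, e₄, e₁]

/-! ### Double structures -/

/-- Over a local ring, a quotient whose maximal ideal is simple has length two. -/
theorem length_quotient_eq_two {R : Type*} [CommRing R] [IsLocalRing R] {D : Ideal R} {x : R}
    (hxm : x ∈ IsLocalRing.maximalIdeal R) (hxD : x ∉ D)
    (hx : ∀ r ∈ IsLocalRing.maximalIdeal R, r * x ∈ D)
    (hgen : ∀ r ∈ IsLocalRing.maximalIdeal R, ∃ c, r - c * x ∈ D)
    (hDm : D ≤ IsLocalRing.maximalIdeal R) : Module.length R (R ⧸ D) = 2 := by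
  set m := IsLocalRing.maximalIdeal R
  let f : (R ⧸ m) →ₗ[R] (R ⧸ D) := Submodule.mapQ m D
    (LinearMap.toSpanSingleton R R x) fun r hr => hx r hr
  let g : (R ⧸ D) →ₗ[R] (R ⧸ m) := Submodule.factor hDm
  have hf : Function.Injective f := by
    rw [← LinearMap.ker_eq_bot, LinearMap.ker_eq_bot']
    intro y hy
    obtain ⟨r, rfl⟩ := Submodule.Quotient.mk_surjective _ y
    rw [Submodule.Quotient.mk_eq_zero]
    have hr : r * x ∈ D := (Submodule.Quotient.mk_eq_zero _).1 hy
    rw [IsLocalRing.mem_maximalIdeal, mem_nonunits_iff]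
    exact fun hu => hxD ((Ideal.unit_mul_mem_iff_mem _ hu).1 hr)
  have hg : Function.Surjective g := Submodule.factor_surjective hDm
  have hfg : Function.Exact f g := by
    intro y
    obtain ⟨r, rfl⟩ := Submodule.Quotient.mk_surjective _ y
    constructor
    · intro hr
      obtain ⟨c, hc⟩ := hgen r ((Submodule.Quotient.mk_eq_zero _).1 hr)
      refine ⟨Submodule.Quotient.mk c, ((Submodule.Quotient.eq _).2 ?_).symm⟩
      exact hc
    · rintro ⟨z, hz⟩
      obtain ⟨c, rfl⟩ := Submodule.Quotient.mk_surjective _ z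
      rw [← hz]
      exact (Submodule.Quotient.mk_eq_zero _).2 (Ideal.mul_mem_left _ _ hxm)
  have hsimple : IsSimpleModule R (R ⧸ m) :=
    isSimpleModule_iff_isCoatom.2 (Ideal.isMaximal_def.1 (IsLocalRing.maximalIdeal.isMaximal R))
  rw [Module.length_eq_add_of_exact f g hf hg hfg, Module.length_eq_one]
  norm_num

/-- A criterion for double structures: generically the prime ideal `J` modulo `D` is generated by a
single nonzero element `x`, which is annihilated by `J`. -/
structure IsGenericallyDouble {A : Type} [CommRing A] (D J : Ideal A) : Prop where
  isPrime : J.IsPrime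
  isPrimary : D.IsPrimary
  radical_eq : D.radical = J
  exists_generator : ∃ x ∈ J, x ∉ D ∧ (∀ y ∈ J, x * y ∈ D) ∧
    ∃ s ∉ J, ∀ y ∈ J, ∃ c, s * y - c * x ∈ D

theorem IsGenericallyDouble.comap {A B : Type} [CommRing A] [CommRing B] {D J : Ideal B}
    (h : IsGenericallyDouble D J) (f : A →+* B) (hf : Function.Surjective f) :
    IsGenericallyDouble (D.comap f) (J.comap f) := by
  obtain ⟨hJ, hD, hrad, x, hxJ, hxD, hx, s, hs, hs'⟩ := h
  obtain ⟨x, rfl⟩ := hf x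
  obtain ⟨s, rfl⟩ := hf s
  refine ⟨hJ.comap f, hD.comap f, by rw [← Ideal.comap_radical, hrad], x, hxJ, hxD, fun y hy => ?_,
    s, hs, fun y hy => ?_⟩
  · rw [Ideal.mem_comap, map_mul]
    exact hx (f y) hy
  · obtain ⟨c, hc⟩ := hs' (f y) hy
    obtain ⟨c, rfl⟩ := hf c
    exact ⟨c, by rwa [Ideal.mem_comap, map_sub, map_mul, map_mul]⟩

theorem IsGenericallyDouble.isDoubleStructure {σ : Type} {D J : Ideal (MvPolynomial σ ℂ)}
    (h : IsGenericallyDouble D J) : IsDoubleStructure D J := by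
  obtain ⟨hJ, hD, hrad, x, hxJ, hxD, hx, s, hs, hs'⟩ := h
  refine ⟨hJ, hD, hrad, ?_⟩
  have hDJ : D ≤ J := hrad ▸ Ideal.le_radical
  have hm : J.map (algebraMap (MvPolynomial σ ℂ) (Localization.AtPrime J)) =
    IsLocalRing.maximalIdeal (Localization.AtPrime J) := Localization.AtPrime.map_eq_maximalIdeal
  refine length_quotient_eq_two (x := algebraMap _ _ x) ?_ ?_ ?_ ?_ ?_
  · rw [← hm]
    exact Ideal.mem_map_of_mem _ hxJ
  · have hdisj : Disjoint (J.primeCompl : Set (MvPolynomial σ ℂ)) (D : Set _) :=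
      Set.disjoint_left.2 fun a ha ha' => ha (hDJ ha')
    intro h
    rw [← IsLocalization.under_map_of_isPrimary_disjoint J.primeCompl (Localization.AtPrime J)
      hD hdisj] at hxD
    exact hxD h
  · intro r hr
    rw [← hm] at hr
    refine Submodule.span_induction ?_ (by simp) ?_ ?_ hr
    · rintro _ ⟨y, hy, rfl⟩
      rw [← map_mul, mul_comm]
      exact Ideal.mem_map_of_mem _ (hx y hy)
    · intro a b _ _ ha hb
      rw [add_mul]
      exact add_mem ha hb
    · intro a b _ hb
      rw [smul_eq_mul, mul_assoc]
      exact Ideal.mul_mem_left _ _ hb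
  · intro r hr
    obtain ⟨⟨a, b⟩, hab⟩ := IsLocalization.surj J.primeCompl r
    generalize hφ : algebraMap (MvPolynomial σ ℂ) (Localization.AtPrime J) = φ at *
    have ha : a ∈ J := by
      rw [← IsLocalization.AtPrime.to_map_mem_maximal_iff (Localization.AtPrime J) J, hφ]
      exact hab ▸ Ideal.mul_mem_right _ _ hr
    obtain ⟨c, hc⟩ := hs' a ha
    have hsu : IsUnit (φ s) := hφ ▸ IsLocalization.map_units _ (⟨s, hs⟩ : J.primeCompl)
    have hbu : IsUnit (φ b) := hφ ▸ IsLocalization.map_units _ b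
    obtain ⟨w, hw⟩ := (hsu.mul hbu).exists_left_inv
    refine ⟨w * φ c, (Ideal.unit_mul_mem_iff_mem _ (hsu.mul hbu)).1 ?_⟩
    have h3 : φ s * φ b * (r - w * φ c * φ x) = φ (s * a - c * x) := by
      rw [map_sub, map_mul, map_mul]
      simp only at hab
      linear_combination φ s * hab - φ c * φ x * hw
    rw [h3]
    exact Ideal.mem_map_of_mem φ hc
  · rw [← hm]
    exact Ideal.map_mono hDJ

/-! ### The fibre over a zero vector and a matrix of rank one -/

/-- The ideal of the hypersurface `p₁q₁ + p₂q₂ = 0` in the linear subspace `p₀ = r = u = 0`. -/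
def splitQuadricIdeal : Ideal (MvPolynomial KeyVar ℂ) :=
  Ideal.span {X KeyVar.u, X KeyVar.r, X (KeyVar.p 0), X (KeyVar.p 1) * X (KeyVar.q 1) +
    X (KeyVar.p 2) * X (KeyVar.q 2)}

theorem mk_splitQuadricIdeal_eq_zero :
    Ideal.Quotient.mk splitQuadricIdeal (X KeyVar.u) = 0 ∧ Ideal.Quotient.mk splitQuadricIdeal
      (X KeyVar.r) = 0 ∧
    Ideal.Quotient.mk splitQuadricIdeal (X (KeyVar.p 0)) = 0 ∧
    Ideal.Quotient.mk splitQuadricIdeal (X (KeyVar.p 1)) * Ideal.Quotient.mk splitQuadricIdeal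
      (X (KeyVar.q 1)) +
      Ideal.Quotient.mk splitQuadricIdeal (X (KeyVar.p 2)) *
        Ideal.Quotient.mk splitQuadricIdeal (X (KeyVar.q 2)) = 0 := by
  refine ⟨?_, ?_, ?_, ?_⟩
  · exact Ideal.Quotient.eq_zero_iff_mem.2 (Ideal.subset_span (by simp))
  · exact Ideal.Quotient.eq_zero_iff_mem.2 (Ideal.subset_span (by simp))
  · exact Ideal.Quotient.eq_zero_iff_mem.2 (Ideal.subset_span (by simp))
  · rw [← map_mul, ← map_mul, ← map_add]
    exact Ideal.Quotient.eq_zero_iff_mem.2 (Ideal.subset_span (by simp))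

/-- The first order deformation of a homomorphism `g` which, for the quotient map `g` to the
coordinate ring of the quadric `splitQuadricIdeal`, describes the double structure in the fibre over
`t = 0` and `S` of rank one: the ideal of the double structure is the kernel. -/
def doubleHom {B : Type} [CommRing B] [Algebra ℂ B] (g : MvPolynomial KeyVar ℂ →ₐ[ℂ] B) :
    MvPolynomial KeyVar ℂ →ₐ[ℂ] DualNumber B :=
  aeval (keyFamily
    ![TrivSqZeroExt.inr (g (X (KeyVar.p 1))), TrivSqZeroExt.inl (g (X (KeyVar.p 1))),
      TrivSqZeroExt.inl (g (X (KeyVar.p 2)))]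
    (TrivSqZeroExt.inl (g (X KeyVar.p4)))
    ![TrivSqZeroExt.inl (g (X (KeyVar.q 0))),
      TrivSqZeroExt.inl (g (X (KeyVar.q 1))) - TrivSqZeroExt.inr (g (X (KeyVar.q 0))),
      TrivSqZeroExt.inl (g (X (KeyVar.q 2)))]
    (-TrivSqZeroExt.inr (g (X (KeyVar.q 2)))) 0)

theorem le_ker_doubleHom {B : Type} [CommRing B] [Algebra ℂ B] {g : MvPolynomial KeyVar ℂ →ₐ[ℂ] B}
    (hg : g (X (KeyVar.p 1)) * g (X (KeyVar.q 1)) + g (X (KeyVar.p 2)) * g (X (KeyVar.q 2)) = 0)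
    {s : Sym2 (Fin 3) → ℂ} (hs : symMat s = !![1, 0, 0; 0, 0, 0; 0, 0, 0]) :
    (keyIdeal s 0).toIdeal ⊔ Ideal.span {X KeyVar.u} ≤ RingHom.ker (doubleHom g) := by
  refine sup_le ?_ ((Ideal.span_singleton_le_iff_mem _).2 (by simp [doubleHom]))
  refine (keyIdeal_le_ker_iff_rank_one hs (doubleHom g) (funext fun v => aeval_X _ v)).2 ?_
  refine ⟨?_, ⟨?_, ?_, ?_⟩, ?_, ⟨?_, ?_, ?_⟩, ?_⟩ <;> ext <;>
    simp [pow_two]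
  · linear_combination hg
  · ring
  · linear_combination -hg

theorem fst_doubleHom (a : MvPolynomial KeyVar ℂ) :
    (doubleHom (Ideal.Quotient.mkₐ ℂ splitQuadricIdeal) a).fst =
      Ideal.Quotient.mk splitQuadricIdeal a := by
  obtain ⟨h1, h2, h3, -⟩ := mk_splitQuadricIdeal_eq_zero
  have : (TrivSqZeroExt.fstHom ℂ _ _).comp (doubleHom (Ideal.Quotient.mkₐ ℂ splitQuadricIdeal)) =
      Ideal.Quotient.mkₐ ℂ splitQuadricIdeal := by
    refine MvPolynomial.algHom_ext (KeyVar.forall_iff.2 ?_)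
    simp [doubleHom, h1, h2, h3]
  exact DFunLike.congr_fun this a

theorem keyIdeal_sup_eq_ker_doubleHom {s : Sym2 (Fin 3) → ℂ}
    (hs : symMat s = !![1, 0, 0; 0, 0, 0; 0, 0, 0]) :
    (keyIdeal s 0).toIdeal ⊔ Ideal.span {X KeyVar.u} =
      RingHom.ker (doubleHom (Ideal.Quotient.mkₐ ℂ splitQuadricIdeal)) := by
  set D := (keyIdeal s 0).toIdeal ⊔ Ideal.span {X KeyVar.u} with hD
  apply le_antisymm
  · exact le_ker_doubleHom mk_splitQuadricIdeal_eq_zero.2.2.2 hs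
  · obtain ⟨h1, ⟨h2, h3, h4⟩, h5, -, h7⟩ := (keyIdeal_le_ker_iff_rank_one hs _
      (apply_X_eq_keyFamily (Ideal.Quotient.mkₐ ℂ D))).1
        (le_sup_left.trans (Ideal.Quotient.mkₐ_ker ℂ D).ge)
    have hu : X KeyVar.u ∈ D := Ideal.mem_sup_right (Ideal.mem_span_singleton_self _)
    have h8 := mkₐ_eq_zero hu
    intro a ha
    have ha0 : doubleHom (Ideal.Quotient.mkₐ ℂ splitQuadricIdeal) a = 0 := ha
    have ha1 : a ∈ splitQuadricIdeal := by
      rw [← Ideal.Quotient.eq_zero_iff_mem, ← fst_doubleHom, ha0, TrivSqZeroExt.fst_zero]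
    obtain ⟨x, _, hy₁, rfl⟩ := Ideal.mem_span_insert.1 ha1
    obtain ⟨h, _, hy₂, rfl⟩ := Ideal.mem_span_insert.1 hy₁
    obtain ⟨g, _, hy₃, rfl⟩ := Ideal.mem_span_insert.1 hy₂
    obtain ⟨c, rfl⟩ := Ideal.mem_span_singleton'.1 hy₃
    -- modulo `D` the element is `(g - c q₀) p₀ + h r`
    have hsnd : X (KeyVar.p 1) * (g - c * X (KeyVar.q 0)) - X (KeyVar.q 2) *
      h ∈ splitQuadricIdeal := by
      have := congrArg TrivSqZeroExt.snd ha0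
      simp only [map_add, map_mul, TrivSqZeroExt.snd_add, DualNumber.snd_mul, fst_doubleHom] at this
      obtain ⟨g1, g2, g3, g4⟩ := mk_splitQuadricIdeal_eq_zero
      simp only [g1, g2, g3] at this
      generalize (doubleHom (Ideal.Quotient.mkₐ ℂ splitQuadricIdeal) c).snd = w at this
      simp [doubleHom] at this
      rw [← Ideal.Quotient.eq_zero_iff_mem]
      simp only [map_sub, map_mul]
      linear_combination this - w * g4
    obtain ⟨a1, _, hz₁, e1⟩ := Ideal.mem_span_insert.1 hsnd
    obtain ⟨a2, _, hz₂, rfl⟩ := Ideal.mem_span_insert.1 hz₁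
    obtain ⟨a3, _, hz₃, rfl⟩ := Ideal.mem_span_insert.1 hz₂
    obtain ⟨e, rfl⟩ := Ideal.mem_span_singleton'.1 hz₃
    obtain ⟨m, hm1, hm2⟩ := exists_of_X_mul_sub_X_mul_mem (s := {KeyVar.u, KeyVar.r, KeyVar.p 0})
      (v := .p 1) (w := .q 2) (by simp) (by simp) (by simp)
        (a := g - c * X (KeyVar.q 0) - e * X (KeyVar.q 1))
      (b := h + e * X (KeyVar.p 2)) (by
        have e2 : X (KeyVar.p 1) * (g - c * X (KeyVar.q 0) - e * X (KeyVar.q 1)) - X (KeyVar.q 2) *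
          (h + e * X (KeyVar.p 2)) =
            a1 * X KeyVar.u + (a2 * X KeyVar.r + a3 * X (KeyVar.p 0)) := by
          linear_combination e1
        rw [e2]
        refine add_mem (Ideal.mul_mem_left _ _ ?_) (add_mem (Ideal.mul_mem_left _ _ ?_)
          (Ideal.mul_mem_left _ _ ?_)) <;>
        exact X_mem_span_X_image_iff.2 (by simp))
    have hr : ∀ y ∈ Ideal.span (X '' {KeyVar.u, KeyVar.r, KeyVar.p 0}), X KeyVar.r * y ∈ D := by
      refine forall_mem_span_mul_mem ?_
      rintro _ ⟨v, (rfl | rfl | rfl), rfl⟩ <;> refine mem_of_mkₐ_eq_zero ?_ <;> rw [map_mul]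
      · rw [h8, mul_zero]
      · linear_combination h7 - Ideal.Quotient.mkₐ ℂ D (X KeyVar.p4) * h8
      · exact h2
    have hp : ∀ y ∈ Ideal.span (X '' {KeyVar.u, KeyVar.r, KeyVar.p 0}), X (KeyVar.p 0) * y ∈ D := by
      refine forall_mem_span_mul_mem ?_
      rintro _ ⟨v, (rfl | rfl | rfl), rfl⟩ <;> refine mem_of_mkₐ_eq_zero ?_ <;> rw [map_mul]
      · rw [h8, mul_zero]
      · linear_combination h2
      · linear_combination h5
    have h9 := mkₐ_eq_zero (hr _ hm2)
    have h10 := mkₐ_eq_zero (hp _ hm1)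
    refine mem_of_mkₐ_eq_zero ?_
    simp only [map_add, map_sub, map_mul] at h9 h10 ⊢
    set f := Ideal.Quotient.mkₐ ℂ D
    linear_combination f x * h8 + h9 + h10 + f m * h3 - f e * h4 + f c * h1

theorem isGenericallyDouble_of_rank_one {s : Sym2 (Fin 3) → ℂ}
    (hs : symMat s = !![1, 0, 0; 0, 0, 0; 0, 0, 0]) :
    IsGenericallyDouble ((keyIdeal s 0).toIdeal ⊔ Ideal.span {X KeyVar.u}) splitQuadricIdeal := by
  have hD := keyIdeal_sup_eq_ker_doubleHom hs
  set D := (keyIdeal s 0).toIdeal ⊔ Ideal.span {X KeyVar.u}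
  obtain ⟨h1, ⟨h2, h3, h4⟩, h5, -, h7⟩ := (keyIdeal_le_ker_iff_rank_one hs _
    (apply_X_eq_keyFamily (Ideal.Quotient.mkₐ ℂ D))).1
      (le_sup_left.trans (Ideal.Quotient.mkₐ_ker ℂ D).ge)
  have h8 : Ideal.Quotient.mkₐ ℂ D (X KeyVar.u) = 0 :=
    mkₐ_eq_zero (Ideal.mem_sup_right (Ideal.mem_span_singleton_self _))
  have hJ : splitQuadricIdeal.IsPrime := isQuadric_split.isPrime
  have hDJ : D ≤ splitQuadricIdeal := fun a ha => by
    rw [hD] at ha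
    rw [← Ideal.Quotient.eq_zero_iff_mem, ← fst_doubleHom, show doubleHom
      (Ideal.Quotient.mkₐ ℂ splitQuadricIdeal) a = 0 from ha,
      TrivSqZeroExt.fst_zero]
  have hr : Ideal.Quotient.mkₐ ℂ D (X KeyVar.r) ^ 2 = 0 := by
    linear_combination h7 - Ideal.Quotient.mkₐ ℂ D (X KeyVar.p4) * h8
  have hrad : D.radical = splitQuadricIdeal := by
    refine le_antisymm (hJ.radical_le_iff.2 hDJ) (Ideal.span_le.2 ?_)
    simp only [Set.insert_subset_iff, Set.singleton_subset_iff, SetLike.mem_coe]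
    have hp : X (KeyVar.p 0) ∈ D.radical := ⟨2, mem_of_mkₐ_eq_zero (by rw [map_pow, h5])⟩
    refine ⟨⟨1, mem_of_mkₐ_eq_zero (by rw [map_pow, h8, pow_one])⟩,
      ⟨2, mem_of_mkₐ_eq_zero (by rw [map_pow, hr])⟩, hp, ?_⟩
    have e : X (KeyVar.p 1) * X (KeyVar.q 1) + X (KeyVar.p 2) * X (KeyVar.q 2) =
      (X (KeyVar.p 0) * X (KeyVar.q 0) + X (KeyVar.p 1) * X (KeyVar.q 1) +
      X (KeyVar.p 2) * X (KeyVar.q 2)) - (X (KeyVar.q 0) *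
        X (KeyVar.p 0) : MvPolynomial KeyVar ℂ) := by ring
    rw [e]
    refine sub_mem (Ideal.le_radical (mem_of_mkₐ_eq_zero ?_)) (Ideal.mul_mem_left _ _ hp)
    simpa only [map_add, map_mul] using h1
  have hp : X (KeyVar.p 1) ∉ splitQuadricIdeal :=
    notMem_span_of_eval (keyFamily ![0, 1, 0] 0 ![0, 0, 0] 0 0) (by simp) (by simp)
  -- `p₀` generates the nilpotents of the double structure after inverting `p₁`
  refine ⟨hJ, ?_, hrad, X (KeyVar.p 0), Ideal.subset_span (by simp), ?_, ?_, X (KeyVar.p 1), ?_, ?_⟩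
  · refine Ideal.isPrimary_iff.2 ⟨fun h => hJ.ne_top (top_le_iff.1 (h ▸ hDJ)), fun {a b} hab => ?_⟩
    rw [hrad, or_iff_not_imp_right]
    intro hb
    rw [hD] at hab ⊢
    have hab : doubleHom (Ideal.Quotient.mkₐ ℂ splitQuadricIdeal) (a * b) = 0 := hab
    rw [map_mul] at hab
    -- a dual number over a domain is a nonzerodivisor if its first component is nonzero
    have hb' : (doubleHom (Ideal.Quotient.mkₐ ℂ splitQuadricIdeal) b).fst ≠ 0 := by
      rwa [fst_doubleHom, Ne, Ideal.Quotient.eq_zero_iff_mem]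
    have e1 : (doubleHom (Ideal.Quotient.mkₐ ℂ splitQuadricIdeal) a).fst = 0 := by
      have := congrArg TrivSqZeroExt.fst hab
      rw [TrivSqZeroExt.fst_mul, TrivSqZeroExt.fst_zero] at this
      exact (mul_eq_zero.1 this).resolve_right hb'
    have e2 : (doubleHom (Ideal.Quotient.mkₐ ℂ splitQuadricIdeal) a).snd = 0 := by
      have := congrArg TrivSqZeroExt.snd hab
      rw [DualNumber.snd_mul, TrivSqZeroExt.snd_zero, e1, zero_mul, zero_add] at this
      exact (mul_eq_zero.1 this).resolve_right hb'
    exact TrivSqZeroExt.ext e1 e2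
  · rw [hD]
    intro h
    have h : doubleHom (Ideal.Quotient.mkₐ ℂ splitQuadricIdeal) (X (KeyVar.p 0)) = 0 := h
    have := congrArg TrivSqZeroExt.snd h
    simp only [doubleHom, aeval_X, keyFamily_p, Matrix.cons_val_zero, TrivSqZeroExt.snd_inr,
      TrivSqZeroExt.snd_zero] at this
    exact hp (Ideal.Quotient.eq_zero_iff_mem.1 this)
  · refine forall_mem_span_mul_mem ?_
    simp only [Set.mem_insert_iff, Set.mem_singleton_iff, forall_eq_or_imp, forall_eq]
    refine ⟨?_, ?_, ?_, ?_⟩ <;> refine mem_of_mkₐ_eq_zero ?_ <;> simp only [map_mul, map_add]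
    · rw [h8, mul_zero]
    · linear_combination h2
    · linear_combination h5
    · set f := Ideal.Quotient.mkₐ ℂ D
      linear_combination f (X (KeyVar.p 0)) * h1 - f (X (KeyVar.q 0)) * h5
  · exact hp
  · have key : ∀ y ∈ splitQuadricIdeal, X (KeyVar.p 1) * y ∈ D ⊔ Ideal.span {X (KeyVar.p 0)} := by
      refine forall_mem_span_mul_mem ?_
      simp only [Set.mem_insert_iff, Set.mem_singleton_iff, forall_eq_or_imp, forall_eq]
      have h0 := mkₐ_eq_zero (I := D ⊔ Ideal.span {X (KeyVar.p 0)})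
        (Ideal.mem_sup_right (Ideal.mem_span_singleton_self _))
      obtain ⟨g1, ⟨-, g3, -⟩, -⟩ := (keyIdeal_le_ker_iff_rank_one hs _
        (apply_X_eq_keyFamily (Ideal.Quotient.mkₐ ℂ (D ⊔ Ideal.span {X (KeyVar.p 0)})))).1
          ((le_sup_left.trans le_sup_left).trans (Ideal.Quotient.mkₐ_ker ℂ _).ge)
      set f := Ideal.Quotient.mkₐ ℂ (D ⊔ Ideal.span {X (KeyVar.p 0)})
      refine ⟨Ideal.mul_mem_left _ _ (Ideal.mem_sup_left (mem_of_mkₐ_eq_zero h8)), ?_,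
        Ideal.mul_mem_left _ _ (mem_of_mkₐ_eq_zero h0), Ideal.mul_mem_left _ _ ?_⟩ <;>
      refine mem_of_mkₐ_eq_zero ?_ <;> change f _ = 0 <;> simp only [map_mul, map_add]
      · linear_combination g3 - f (X (KeyVar.q 2)) * h0
      · linear_combination g1 - f (X (KeyVar.q 0)) * h0
    intro y hy
    obtain ⟨d, hd, z, hz, e⟩ := Submodule.mem_sup.1 (key y hy)
    obtain ⟨c, rfl⟩ := Ideal.mem_span_singleton'.1 hz
    exact ⟨c, by rwa [← e, add_sub_cancel_right]⟩

/-- The fibre for `t = 0` and `S = x₀²`. The linear form `u` splits off the quadric inside `p = 0`;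
the rest is the double structure. -/
theorem exists_decomposition_of_rank_one {s : Sym2 (Fin 3) → ℂ}
    (hs : symMat s = !![1, 0, 0; 0, 0, 0; 0, 0, 0]) :
    ∃ J₁ J₂ D : Ideal (MvPolynomial KeyVar ℂ), IsQuadric 4 J₁ ∧ IsQuadric 4 J₂ ∧ J₁ ≠ J₂ ∧
      IsGenericallyDouble D J₂ ∧ (keyIdeal s 0).toIdeal = J₁ ⊓ D := by
  refine ⟨_, _, _, isQuadric_rank_three, isQuadric_split, ?_,
    isGenericallyDouble_of_rank_one hs, ?_⟩
  · intro h
    have h1 : (X KeyVar.u : MvPolynomial KeyVar ℂ) ∉ Ideal.span {X (KeyVar.p 0), X (KeyVar.p 1),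
      X (KeyVar.p 2),
        X KeyVar.u * X KeyVar.p4 + X KeyVar.r ^ 2} :=
      notMem_span_of_eval (keyFamily ![0, 0, 0] 0 ![0, 0, 0] 0 1) (by simp) (by simp)
    rw [h] at h1
    exact h1 (Ideal.subset_span (by simp))
  · have hprime := isQuadric_rank_three.isPrime
    refine (inf_sup_span_singleton_eq ?_ ?_ ?_).symm
    · set f := Ideal.Quotient.mkₐ ℂ (Ideal.span {X (KeyVar.p 0), X (KeyVar.p 1), X (KeyVar.p 2),
        X KeyVar.u * X KeyVar.p4 + X KeyVar.r ^ 2} : Ideal (MvPolynomial KeyVar ℂ))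
      have h0 : f (X (KeyVar.p 0)) = 0 := mkₐ_eq_zero (Ideal.subset_span (by simp))
      have h1 : f (X (KeyVar.p 1)) = 0 := mkₐ_eq_zero (Ideal.subset_span (by simp))
      have h2 : f (X (KeyVar.p 2)) = 0 := mkₐ_eq_zero (Ideal.subset_span (by simp))
      have h3 : f (X KeyVar.u * X KeyVar.p4 + X KeyVar.r ^ 2) = 0 := mkₐ_eq_zero
        (Ideal.subset_span (by simp))
      have h := (keyIdeal_le_ker_iff_rank_one hs f (apply_X_eq_keyFamily f)).2 (by
        simp only [map_add, map_mul, map_pow] at h3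
        simp only [h0, h1, h2, zero_mul, zero_add, sub_self, and_self, true_and, mul_zero,
          zero_pow, ne_eq, OfNat.ofNat_ne_zero, not_false_eq_true]
        linear_combination h3)
      exact fun x hx => mem_of_mkₐ_eq_zero (h hx)
    · refine notMem_span_of_eval (keyFamily ![0, 0, 0] 0 ![0, 0, 0] 0 1) ?_ (by simp)
      simp
    · set f := Ideal.Quotient.mkₐ ℂ (keyIdeal s 0).toIdeal
      obtain ⟨-, -, -, ⟨h6, h7, h8⟩, h9⟩ := (keyIdeal_le_ker_iff_rank_one hs f
        (apply_X_eq_keyFamily f)).1 (Ideal.Quotient.mkₐ_ker ℂ _).ge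
      refine forall_mem_span_mul_mem ?_
      simp only [Set.mem_insert_iff, Set.mem_singleton_iff, forall_eq_or_imp, forall_eq]
      refine ⟨mem_of_mkₐ_eq_zero ?_, mem_of_mkₐ_eq_zero ?_, mem_of_mkₐ_eq_zero ?_,
        Ideal.mul_mem_left _ _ (mem_of_mkₐ_eq_zero ?_)⟩ <;> change f _ = 0 <;>
        simp only [map_mul, map_add, map_pow]
      exacts [h6, h7, h8, h9]

/-! ### Reduction to the normal forms -/

theorem IsQuadric.comap {σ : Type} {n : ℕ} {J : Ideal (MvPolynomial σ ℂ)} (h : IsQuadric n J)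
    {e : MvPolynomial σ ℂ ≃ₐ[ℂ] MvPolynomial σ ℂ} (he : ∀ i, (e (X i)).IsHomogeneous 1)
    (he' : ∀ i, (e.symm (X i)).IsHomogeneous 1) : IsQuadric n (J.comap e) := by
  obtain ⟨f, hf, hf', h⟩ := h
  exact ⟨f, hf, hf', (projEquiv_comap e he he' J).trans h⟩

theorem comap_ne_comap {A B : Type} [CommRing A] [CommRing B] [Algebra ℂ A] [Algebra ℂ B]
    (e : A ≃ₐ[ℂ] B) {J J' : Ideal B} (h : J ≠ J') : J.comap e ≠ J'.comap e :=
  fun h' => h (Ideal.comap_injective_of_surjective e e.surjective h')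

/-- The three types of fibres over `t ≠ 0`, with the invariants that distinguish them. -/
theorem fibre_type_of_ne_zero (s : Sym2 (Fin 3) → ℂ) {t : Fin 3 → ℂ} (ht : t ≠ 0) :
    (tSt s t ≠ 0 ∧ (matBSB s t).rank = 2 ∧ IsP2P2 (keyIdeal s t).toIdeal) ∨
    (tSt s t = 0 ∧ (matBSB s t).rank = 1 ∧ IsP22 (keyIdeal s t).toIdeal) ∨
    (tSt s t = 0 ∧ (matBSB s t).rank = 0 ∧
      ∃ s', symMat s' = 0 ∧ SameType s t s' ![1, 0, 0]) := by
  obtain ⟨s', h, hs | hs | hs⟩ := exists_sameType_of_ne_zero s t ht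
  · refine Or.inl ⟨?_, ?_, h.linEquiv.projEquiv.trans (isP2P2_of_hyperbolic hs)⟩
    · rw [Ne, h.tSt_eq_zero_iff, tSt_of_hyperbolic hs]
      norm_num
    · rw [h.rank_eq, rank_matBSB_of_hyperbolic hs]
  · refine Or.inr (Or.inl ⟨?_, ?_, h.linEquiv.projEquiv.trans (isP22_of_square hs)⟩)
    · rw [h.tSt_eq_zero_iff, tSt_of_square hs]
    · rw [h.rank_eq, rank_matBSB_of_square hs]
  · refine Or.inr (Or.inr ⟨?_, ?_, s', hs, h⟩)
    · rw [h.tSt_eq_zero_iff, tSt, hs]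
      simp
    · rw [h.rank_eq, matBSB, hs]
      simp

theorem SameType.isConeUnionQuadric {s s' : Sym2 (Fin 3) → ℂ} {t : Fin 3 → ℂ} (hs : symMat s' = 0)
    (h : SameType s t s' ![1, 0, 0]) : IsConeUnionQuadric (keyIdeal s t).toIdeal := by
  obtain ⟨J₁, J₂, h1, -, h2, h3⟩ := exists_decomposition_of_zero hs
  exact IsConeUnionQuadric.of_linEquiv h.linEquiv ⟨J₁, J₂, h1, h2, h3⟩

theorem exists_decomposition_of_eq_zero_of_ne_zero {s : Sym2 (Fin 3) → ℂ} {t : Fin 3 → ℂ}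
    (hs : symMat s = 0) (ht : t ≠ 0) : ∃ J₁ J₂ : Ideal (MvPolynomial KeyVar ℂ),
      IsConeSegreSection J₁ ∧ IsSmoothQuadric 4 J₂ ∧ (keyIdeal s t).toIdeal = J₁ ⊓ J₂ := by
  obtain ⟨g, hg, hgt⟩ := exists_transpose_mulVec_eq t ht
  obtain ⟨e, he, he', h⟩ := linEquivIdeal_of_congruent (s := s) (s' := s) (t := t)
    (t' := ![1, 0, 0]) g (isUnit_iff_ne_zero.2 hg) (by simp [hs]) hgt
  obtain ⟨J₁, J₂, h1, h2, -, h3⟩ := exists_decomposition_of_zero hs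
  refine ⟨J₁.comap e, J₂.comap e, (projEquiv_comap e he he' J₁).trans h1,
    (projEquiv_comap e he he' J₂).trans h2, ?_⟩
  rw [h, h3]
  rfl

theorem isConeUnionQuadric_of_rank_eq_three {s : Sym2 (Fin 3) → ℂ} (hs : (symMat s).rank = 3) :
    IsConeUnionQuadric (keyIdeal s 0).toIdeal := by
  obtain ⟨s', h, ⟨-, h'⟩ | ⟨h', -⟩ | ⟨h', -⟩ | ⟨h', -⟩⟩ := exists_sameType_zero s
  · exact IsConeUnionQuadric.of_linEquiv h.linEquiv (isConeUnionQuadric_of_rank_three h')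
  all_goals omega

theorem exists_decomposition_of_rank_eq_two {s : Sym2 (Fin 3) → ℂ} (hs : (symMat s).rank = 2) :
    ∃ J₁ J₂ J₃ : Ideal (MvPolynomial KeyVar ℂ),
      IsQuadric 4 J₁ ∧ IsQuadric 4 J₂ ∧ IsQuadric 4 J₃ ∧
      J₁ ≠ J₂ ∧ J₁ ≠ J₃ ∧ J₂ ≠ J₃ ∧ (keyIdeal s 0).toIdeal = J₁ ⊓ J₂ ⊓ J₃ := by
  obtain ⟨s', h, ⟨h', -⟩ | ⟨-, h'⟩ | ⟨h', -⟩ | ⟨h', -⟩⟩ := exists_sameType_zero s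
  · omega
  · obtain ⟨e, he, he', h⟩ := h.linEquiv
    obtain ⟨J₁, J₂, J₃, h1, h2, h3, h12, h13, h23, h4⟩ := exists_decomposition_of_rank_two h'
    refine ⟨_, _, _, h1.comap he he', h2.comap he he', h3.comap he he', comap_ne_comap e h12,
      comap_ne_comap e h13, comap_ne_comap e h23, ?_⟩
    rw [h, h4]
    rfl
  all_goals omega

theorem exists_decomposition_of_rank_eq_one {s : Sym2 (Fin 3) → ℂ} (hs : (symMat s).rank = 1) :
    ∃ J₁ J₂ D : Ideal (MvPolynomial KeyVar ℂ), IsQuadric 4 J₁ ∧ IsQuadric 4 J₂ ∧ J₁ ≠ J₂ ∧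
      IsDoubleStructure D J₂ ∧ (keyIdeal s 0).toIdeal = J₁ ⊓ D := by
  obtain ⟨s', h, ⟨h', -⟩ | ⟨h', -⟩ | ⟨-, h'⟩ | ⟨h', -⟩⟩ := exists_sameType_zero s
  · omega
  · omega
  · obtain ⟨e, he, he', h⟩ := h.linEquiv
    obtain ⟨J₁, J₂, D, h1, h2, h12, hD, h4⟩ := exists_decomposition_of_rank_one h'
    refine ⟨_, _, _, h1.comap he he', h2.comap he he', comap_ne_comap e h12,
      (hD.comap (e : MvPolynomial KeyVar ℂ →+* MvPolynomial KeyVar ℂ)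
        e.surjective).isDoubleStructure, ?_⟩
    rw [h, h4]
    rfl
  · omega

theorem fibres_of_ne_zero {s : Sym2 (Fin 3) → ℂ} {t : Fin 3 → ℂ} (ht : t ≠ 0) :
    ((symMat s).rank = 3 →
      (tSt s t ≠ 0 → (matBSB s t).rank = 2 ∧ IsP2P2 (keyIdeal s t).toIdeal) ∧
      (tSt s t = 0 → (matBSB s t).rank = 1 ∧ IsP22 (keyIdeal s t).toIdeal)) ∧
    ((symMat s).rank = 2 →
      (tSt s t ≠ 0 → (matBSB s t).rank = 2 ∧ IsP2P2 (keyIdeal s t).toIdeal) ∧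
      (tSt s t = 0 →
        ((matBSB s t).rank = 1 ∧ IsP22 (keyIdeal s t).toIdeal) ∨
        ((matBSB s t).rank = 0 ∧ IsConeUnionQuadric (keyIdeal s t).toIdeal))) ∧
    ((symMat s).rank = 1 →
      tSt s t = 0 ∧
        (((matBSB s t).rank = 1 ∧ IsP22 (keyIdeal s t).toIdeal) ∨
        ((matBSB s t).rank = 0 ∧ IsConeUnionQuadric (keyIdeal s t).toIdeal))) := by
  have h3 : (symMat s).rank = 3 → (matBSB s t).rank ≠ 0 := fun h => by
    refine matBSB_ne_zero_of_det_ne_zero ht ?_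
    rw [← isUnit_iff_ne_zero, ← Matrix.isUnit_iff_isUnit_det, ← Matrix.mulVec_surjective_iff_isUnit]
    refine (LinearMap.range_eq_top (f := (symMat s).mulVecLin)).1
      (Submodule.eq_top_of_finrank_eq (h.trans ?_))
    simp
  have h1 : (symMat s).rank = 1 → tSt s t = 0 := tSt_eq_zero_of_rank_eq_one t
  rcases fibre_type_of_ne_zero s ht with ⟨ha, hb, hc⟩ | ⟨ha, hb, hc⟩ | ⟨ha, hb, s', hs', h⟩
  · exact ⟨fun _ => ⟨fun _ => ⟨hb, hc⟩, fun h => absurd h ha⟩,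
      fun _ => ⟨fun _ => ⟨hb, hc⟩, fun h => absurd h ha⟩, fun h => absurd (h1 h) ha⟩
  · exact ⟨fun _ => ⟨fun h => absurd ha h, fun _ => ⟨hb, hc⟩⟩,
      fun _ => ⟨fun h => absurd ha h, fun _ => Or.inl ⟨hb, hc⟩⟩, fun _ => ⟨ha, Or.inl ⟨hb, hc⟩⟩⟩
  · have hc := h.isConeUnionQuadric hs'
    exact ⟨fun h => absurd hb (h3 h), fun _ => ⟨fun h => absurd ha h, fun _ => Or.inr ⟨hb, hc⟩⟩,
      fun _ => ⟨ha, Or.inr ⟨hb, hc⟩⟩⟩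

/-! ### The scheme-theoretic fibre, and smoothness -/

theorem keyIdeal_le_map {R R' : Type} [CommRing R] [CommRing R'] (φ : R →+* R')
    {s : Sym2 (Fin 3) → R} {t : Fin 3 → R} {s' : Sym2 (Fin 3) → R'} {t' : Fin 3 → R'}
    (hs : ∀ e, φ (s e) = s' e) (ht : ∀ i, φ (t i) = t' i) :
    (keyIdeal s' t').toIdeal ≤ (keyIdeal s t).toIdeal.map (MvPolynomial.map φ) := by
  obtain rfl : s' = fun e => φ (s e) := funext fun e => (hs e).symm
  obtain rfl : t' = fun i => φ (t i) := funext fun i => (ht i).symm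
  have key : ∀ f g, f ∈ keyEqns s t → MvPolynomial.map φ f = g →
      g ∈ (keyIdeal s t).toIdeal.map (MvPolynomial.map φ) := by
    rintro f _ hf rfl
    exact Ideal.mem_map_of_mem _ (Ideal.subset_span hf)
  refine Ideal.span_le.mpr fun f hf => ?_
  rcases hf with (((hf | ⟨i, rfl⟩) | hf) | ⟨i, rfl⟩) | hf
  · rw [Set.mem_singleton_iff.mp hf]
    refine key _ _ (Or.inl <| Or.inl <| Or.inl <| Or.inl rfl) ?_
    simp [dotProduct, Fin.sum_univ_three]
  · refine key _ _ (Or.inl <| Or.inl <| Or.inl <| Or.inr ⟨i, rfl⟩) ?_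
    fin_cases i <;> simp [dotProduct, Fin.sum_univ_three, Matrix.mulVec, symMat, skewMat,
      Matrix.one_apply, Matrix.vecHead, Matrix.vecTail]
  · rw [Set.mem_singleton_iff.mp hf]
    refine key _ _ (Or.inl <| Or.inl <| Or.inr rfl) ?_
    simp [dotProduct, Fin.sum_univ_three, Matrix.mulVec, symMat]
  · refine key _ _ (Or.inl <| Or.inr ⟨i, rfl⟩) ?_
    fin_cases i <;> simp [dotProduct, Fin.sum_univ_three, Matrix.mulVec, symMat, skewMat,
      Matrix.one_apply, Matrix.vecHead, Matrix.vecTail]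
  · rw [Set.mem_singleton_iff.mp hf]
    refine key _ _ (Or.inr rfl) ?_
    simp [dotProduct, Fin.sum_univ_three, Matrix.mulVec, symMat, Matrix.adjugate_fin_three]

/-- Base change of closed subschemes of projective space, along the evaluation of the coordinates
of the base at the point. -/
theorem isPullback_specialMap (s : Sym2 (Fin 3) → ℂ) (t : Fin 3 → ℂ) :
    IsPullback (specialMap s t) (projStructure (keyIdeal s t)) rhoSigma (basePoint s t) :=
  isPullback_projBaseMap _ _ _ _ (keyIdeal_le_map _ (by simp [evalBase]) (by simp [evalBase]))

theorem nonempty_rhoFiber_iso (s : Sym2 (Fin 3) → ℂ) (t : Fin 3 → ℂ) :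
    Nonempty (rhoFiber s t ≅ projOver (keyIdeal s t)) :=
  ⟨(Over.isoMk (isPullback_specialMap s t).isoPullback
    ((isPullback_specialMap s t).isoPullback_hom_snd)).symm⟩

section Transport

variable {σ τ : Type} {I : HomogeneousIdeal (homogeneousSubmodule σ ℂ)}
  {J : HomogeneousIdeal (homogeneousSubmodule τ ℂ)}

theorem smooth_of_iso (e : projOver I ≅ projOver J) (h : Smooth (projStructure I)) :
    Smooth (projStructure J) := by
  let g : projScheme I ≅ projScheme J := (Over.forget _).mapIso e
  have h1 : g.inv ≫ projStructure I = projStructure J := Over.w e.inv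
  rw [← h1]
  infer_instance

theorem preirreducibleSpace_of_iso (e : projOver I ≅ projOver J)
    (h : PreirreducibleSpace (projScheme I)) : PreirreducibleSpace (projScheme J) := by
  let g : projScheme I ≅ projScheme J := (Over.forget _).mapIso e
  exact (Scheme.homeoOfIso g).surjective.preirreducibleSpace (Scheme.homeoOfIso g).continuous

end Transport

section Segre

theorem isPrime_segreIdeal (a b : ℕ) : (segreIdeal a b).toIdeal.IsPrime :=
  RingHom.ker_isPrime (segreHom a b)

/-- A chart of a Segre variety is a retract of a polynomial ring, hence smooth. -/
theorem smooth_segreIdeal (a b : ℕ) : Smooth (projStructure (segreIdeal a b)) := by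
  rw [smooth_projStructure_iff]
  rintro ⟨k, l⟩
  set D := dehomIdeal (segreIdeal a b) (k, l)
  let x : Fin a → MvPolynomial (Fin a ⊕ Fin b) ℂ := fun i => if i = k then 1 else X (Sum.inl i)
  let y : Fin b → MvPolynomial (Fin a ⊕ Fin b) ℂ := fun j => if j = l then 1 else X (Sum.inr j)
  let F : MvPolynomial (Fin a × Fin b) ℂ →ₐ[ℂ] MvPolynomial (Fin a ⊕ Fin b) ℂ :=
    aeval fun ij => x ij.1 * y ij.2
  have hF : ∀ f ∈ D, F f = 0 := by
    have hle : D ≤ RingHom.ker F := by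
      refine sup_le (fun f hf => ?_) ?_
      · have : F = (aeval (Sum.elim x y)).comp (segreHom a b) :=
          MvPolynomial.algHom_ext fun ij => by simp [F, segreHom]
        rw [RingHom.mem_ker, this, AlgHom.comp_apply, show segreHom a b f = 0 from hf, map_zero]
      · rw [Ideal.span_singleton_le_iff_mem, RingHom.mem_ker]
        simp [F, x, y]
    exact hle
  let m := Ideal.Quotient.mkₐ ℂ D
  let ρ : MvPolynomial (Fin a ⊕ Fin b) ℂ →ₐ[ℂ] MvPolynomial (Fin a × Fin b) ℂ ⧸ D :=
    aeval (Sum.elim (fun i => m (X (i, l))) fun j => m (X (k, j)))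
  have h1 : m (X (k, l)) = 1 := by
    rw [← map_one m, ← sub_eq_zero, ← map_sub]
    exact mkₐ_eq_zero (Ideal.mem_sup_right (Ideal.mem_span_singleton_self _))
  have h2 : ∀ i j, m (X (i, l)) * m (X (k, j)) = m (X (i, j)) := by
    intro i j
    have : X (i, l) * X (k, j) - X (i, j) * X (k, l) ∈ D := by
      refine Ideal.mem_sup_left ?_
      change segreHom a b _ = 0
      simp only [segreHom, map_sub, map_mul, aeval_X]
      ring
    have := mkₐ_eq_zero this
    rw [map_sub, map_mul, map_mul] at this
    linear_combination this + m (X (i, j)) * h1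
  have hρ : ∀ f, ρ (Ideal.Quotient.liftₐ D F hF f) = f := by
    have : (ρ.comp (Ideal.Quotient.liftₐ D F hF)) = AlgHom.id ℂ _ := by
      refine Ideal.Quotient.algHom_ext _ (MvPolynomial.algHom_ext fun ⟨i, j⟩ => ?_)
      have hx : ∀ i, ρ (x i) = m (X (i, l)) := fun i => by
        by_cases h : i = k
        · simp [x, h, h1]
        · simp [x, h, ρ]
      have hy : ∀ j, ρ (y j) = m (X (k, j)) := fun j => by
        by_cases h : j = l
        · simp [y, h, h1]
        · simp [y, h, ρ]
      change ρ (F (X (i, j))) = m (X (i, j))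
      simp only [F, aeval_X, map_mul, hx, hy, h2]
    exact DFunLike.congr_fun this
  exact ⟨formallySmooth_of_retract _ ρ hρ, Algebra.FinitePresentation.of_finiteType.1 inferInstance⟩

end Segre

section PTwoTwo

/-- A tangent vector at the point `M = 0`, `σ = e₂` does not extend to second order. -/
theorem not_formallySmooth_pTwoTwoIdeal {T : Type} [CommRing T] [Algebra ℂ T] {ε : T}
    (hε : ε ^ 3 = 0) (hε' : ε ^ 2 ≠ 0) : ¬ Algebra.FormallySmooth ℂ
      (MvPolynomial (Sym2 (Fin 3) ⊕ Fin 3) ℂ ⧸ dehomIdeal pTwoTwoIdeal (Sum.inr 2)) := by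
  intro hsm
  set D := dehomIdeal pTwoTwoIdeal (Sum.inr 2)
  let N : Ideal T := Ideal.span {ε ^ 2}
  have hmul : ∀ a ∈ N, ε * a = 0 := by
    intro a ha
    obtain ⟨b, rfl⟩ := Ideal.mem_span_singleton'.1 ha
    linear_combination b * hε
  have hN' : ∀ a ∈ N, ∀ b ∈ N, a * b = 0 := by
    intro a ha b hb
    obtain ⟨c, rfl⟩ := Ideal.mem_span_singleton'.1 ha
    linear_combination c * ε * hmul b hb
  have hN : N ^ 2 = ⊥ := by
    rw [pow_two, eq_bot_iff, Ideal.mul_le]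
    exact fun a ha b hb => (hN' a ha b hb)
  let δ : T ⧸ N := Ideal.Quotient.mk N ε
  have hδ : δ ^ 2 = 0 := by
    rw [← map_pow, Ideal.Quotient.eq_zero_iff_mem]
    exact Ideal.mem_span_singleton_self _
  let G : MvPolynomial (Sym2 (Fin 3) ⊕ Fin 3) ℂ →ₐ[ℂ] T ⧸ N :=
    aeval (Sum.elim (fun e => if e = s(0, 1) then δ else 0) ![0, 0, 1])
  have hG : ∀ f ∈ D, G f = 0 := by
    have hle : D ≤ RingHom.ker G := by
      refine sup_le ((pTwoTwoIdeal_le_ker_iff G).2 ⟨?_, ?_⟩) ?_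
      · rw [Matrix.adjugate_fin_three]
        ext i j
        fin_cases i <;> fin_cases j <;> simp [symMat, G, ← pow_two, hδ]
      · ext i
        fin_cases i <;> simp [symMat, G, Matrix.mulVec, dotProduct]
      · rw [Ideal.span_singleton_le_iff_mem, RingHom.mem_ker]
        simp [G]
    exact hle
  obtain ⟨g, hg⟩ := Algebra.FormallySmooth.comp_surjective ℂ _ N hN (Ideal.Quotient.liftₐ D G hG)
  let m := Ideal.Quotient.mkₐ ℂ D
  have hlift : ∀ v, Ideal.Quotient.mk N (g (m (X v))) = G (X v) := fun v =>
    DFunLike.congr_fun hg (m (X v))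
  have hD := ((pTwoTwoIdeal_le_ker_iff (g.comp m)).1 (fun f hf => by
    have : m f = 0 := mkₐ_eq_zero (Ideal.mem_sup_left hf)
    rw [RingHom.mem_ker, AlgHom.comp_apply, this, map_zero])).1
  have hadj := congrFun (congrFun hD 2) 2
  rw [Matrix.adjugate_fin_three] at hadj
  have h00 : g (m (X (Sum.inl s(0, 0)))) ∈ N := by
    rw [← Ideal.Quotient.eq_zero_iff_mem, hlift]
    simp [G]
  have h11 : g (m (X (Sum.inl s(1, 1)))) ∈ N := by
    rw [← Ideal.Quotient.eq_zero_iff_mem, hlift]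
    simp [G]
  have h01 : g (m (X (Sum.inl s(0, 1)))) - ε ∈ N := by
    rw [← Ideal.Quotient.eq_zero_iff_mem, map_sub, hlift]
    simp [G, δ]
  have hs : s((1 : Fin 3), 0) = s(0, 1) := Sym2.eq_swap
  simp [symMat, hs] at hadj
  refine hε' ?_
  linear_combination -hadj + hN' _ h00 _ h11 - hN' _ h01 _ h01 - 2 * hmul _ h01

theorem not_smooth_pTwoTwoIdeal : ¬ Smooth (projStructure pTwoTwoIdeal) := by
  rw [smooth_projStructure_iff]
  intro h
  refine not_formallySmooth_pTwoTwoIdeal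
    (T := Polynomial ℂ ⧸ Ideal.span {(Polynomial.X ^ 3 : Polynomial ℂ)})
    (ε := Ideal.Quotient.mk _ Polynomial.X) ?_ ?_ (h (Sum.inr 2)).formallySmooth
  · rw [← map_pow, Ideal.Quotient.eq_zero_iff_mem]
    exact Ideal.mem_span_singleton_self _
  · rw [← map_pow, Ne, Ideal.Quotient.eq_zero_iff_mem, Ideal.mem_span_singleton,
      Polynomial.X_pow_dvd_iff]
    intro h
    have := h 2 (by norm_num)
    simp at this

end PTwoTwo

/-! ### Irreducibility -/

section PTwoTwoIrreducible

variable {T : Type} [CommRing T]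

/-- The point `(λ v ᵗv, v × w)` of the affine cone over `ℙ^{2,2}`, for the value `λ` of the
coordinate `none` and the values `v` and `w` of the two blocks of other coordinates. -/
def pTwoTwoPoint (x : Option (Fin 3 ⊕ Fin 3) → T) : Sym2 (Fin 3) ⊕ Fin 3 → T :=
  Sum.elim
    (Sym2.lift ⟨fun i j => x none * (x (some (Sum.inl i)) * x (some (Sum.inl j))),
      fun i j => by ring⟩)
    (skewMat (fun i => x (some (Sum.inl i))) *ᵥ fun i => x (some (Sum.inr i)))

theorem pTwoTwoIdeal_le_ker_of_pTwoTwoPoint [Algebra ℂ T] (x : Option (Fin 3 ⊕ Fin 3) → T)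
    (f : MvPolynomial (Sym2 (Fin 3) ⊕ Fin 3) ℂ →ₐ[ℂ] T) (hf : ∀ v, f (X v) = pTwoTwoPoint x v) :
    pTwoTwoIdeal.toIdeal ≤ RingHom.ker f := by
  rw [pTwoTwoIdeal_le_ker_iff]
  simp only [hf]
  constructor
  · rw [Matrix.adjugate_fin_three]
    ext i j
    fin_cases i <;> fin_cases j <;> simp [symMat, pTwoTwoPoint] <;> ring
  · ext i
    fin_cases i <;> simp [symMat, pTwoTwoPoint, skewMat_mulVec, Matrix.mulVec, dotProduct,
      Fin.sum_univ_three] <;> ring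

/-- Every point of the affine cone over `ℙ^{2,2}` has the form `(λ v ᵗv, v × w)`. -/
theorem exists_eq_pTwoTwoPoint (y : Sym2 (Fin 3) ⊕ Fin 3 → ℂ)
    (h : (symMat fun e => y (Sum.inl e)).adjugate = 0)
    (h' : (symMat fun e => y (Sum.inl e)) *ᵥ (fun i => y (Sum.inr i)) = 0) :
    ∃ x, y = pTwoTwoPoint x := by
  set M := symMat fun e => y (Sum.inl e) with hM
  set z : Fin 3 → ℂ := fun i => y (Sum.inr i)
  have hsymm : ∀ i j, M i j = M j i := fun i j => by simp [hM, symMat, Sym2.eq_swap]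
  obtain ⟨l, v, hv, hvz, hl⟩ : ∃ (l : ℂ) (v : Fin 3 → ℂ), v ≠ 0 ∧ v ⬝ᵥ z = 0 ∧
      ∀ i j, M i j = l * (v i * v j) := by
    have hminor : ∀ i j k : Fin 3, M i i * M j k = M i j * M i k := by
      have s01 := hsymm 1 0
      have s02 := hsymm 2 0
      have s12 := hsymm 2 1
      have e := fun i j => congrFun (congrFun h i) j
      rw [Matrix.adjugate_fin_three] at e
      have e00 := e 0 0
      have e01 := e 0 1
      have e02 := e 0 2
      have e11 := e 1 1
      have e12 := e 1 2
      have e22 := e 2 2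
      simp [s01, s02, s12] at e00 e01 e02 e11 e12 e22
      intro i j k
      fin_cases i <;> fin_cases j <;> fin_cases k <;>
        simp only [Fin.zero_eta, Fin.mk_one, Fin.reduceFinMk, s01, s02, s12]
      all_goals first
        | ring1
        | linear_combination e00
        | linear_combination e01
        | linear_combination e02
        | linear_combination e11
        | linear_combination e12
        | linear_combination e22
        | linear_combination -e01
        | linear_combination -e02
        | linear_combination -e12
    -- a symmetric matrix with vanishing minors is determined by a row with nonzero diagonal entry
    by_cases hd : ∃ i, M i i ≠ 0
    · obtain ⟨i, hi⟩ := hd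
      refine ⟨(M i i)⁻¹, M i, fun h0 => hi (congrFun h0 i), congrFun h' i, fun j k => ?_⟩
      rw [eq_inv_mul_iff_mul_eq₀ hi]
      exact hminor i j k
    · push Not at hd
      have hM0 : ∀ i j, M i j = 0 := fun i j => by
        have := hminor i j j
        rw [hd i, zero_mul] at this
        exact mul_self_eq_zero.1 this.symm
      obtain ⟨v, hv, hvz⟩ : ∃ v : Fin 3 → ℂ, v ≠ 0 ∧ v ⬝ᵥ z = 0 := by
        by_cases h1 : z 1 = 0
        · exact ⟨![0, 1, 0], fun h => one_ne_zero (congrFun h 1), by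
            simp [dotProduct, Fin.sum_univ_three, h1]⟩
        · exact ⟨![-z 1, z 0, 0], fun h => h1 (by simpa using congrFun h 0), by
            simp [dotProduct, Fin.sum_univ_three]; ring⟩
      exact ⟨0, v, hv, hvz, fun i j => by rw [hM0, zero_mul]⟩
  obtain ⟨w, hw⟩ : ∃ w, skewMat v *ᵥ w = z := by
    rw [dotProduct_fin_three] at hvz
    have : v 0 ≠ 0 ∨ v 1 ≠ 0 ∨ v 2 ≠ 0 := by
      by_contra! h
      exact hv ((funext_fin_three_iff v 0).2 h)
    rcases this with h | h | h
    · refine ⟨![0, z 2 / v 0, -z 1 / v 0], ?_⟩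
      rw [skewMat_mulVec, funext_fin_three_iff]
      refine ⟨?_, ?_, ?_⟩ <;> simp <;> field_simp; linear_combination -hvz
    · refine ⟨![-z 2 / v 1, 0, z 0 / v 1], ?_⟩
      rw [skewMat_mulVec, funext_fin_three_iff]
      refine ⟨?_, ?_, ?_⟩ <;> simp <;> field_simp; linear_combination -hvz
    · refine ⟨![z 1 / v 2, -z 0 / v 2, 0], ?_⟩
      rw [skewMat_mulVec, funext_fin_three_iff]
      refine ⟨?_, ?_, ?_⟩ <;> simp <;> field_simp; linear_combination -hvz
  refine ⟨fun o => o.elim l (Sum.elim v w), funext fun e => ?_⟩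
  rcases e with e | i
  · induction e with | _ i j
    exact hl i j
  · exact (congrFun hw i).symm

/-- The variety `ℙ^{2,2}` is irreducible, being the closure of the image of an affine space. -/
theorem isPrime_radical_pTwoTwoIdeal : pTwoTwoIdeal.toIdeal.radical.IsPrime := by
  let Φ : MvPolynomial (Sym2 (Fin 3) ⊕ Fin 3) ℂ →ₐ[ℂ]
      MvPolynomial (Option (Fin 3 ⊕ Fin 3)) ℂ := aeval (pTwoTwoPoint X)
  have hle : pTwoTwoIdeal.toIdeal ≤ RingHom.ker Φ :=
    pTwoTwoIdeal_le_ker_of_pTwoTwoPoint X Φ fun v => aeval_X _ _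
  have hprime : (RingHom.ker Φ).IsPrime := RingHom.ker_isPrime Φ
  have : pTwoTwoIdeal.toIdeal.radical = RingHom.ker Φ := by
    refine le_antisymm (hprime.radical_le_iff.2 hle) fun f hf => ?_
    rw [← vanishingIdeal_zeroLocus_eq_radical (K := ℂ), mem_vanishingIdeal_iff]
    intro y hy
    have hy' := (pTwoTwoIdeal_le_ker_iff (aeval y : _ →ₐ[ℂ] ℂ)).1 fun g hg => hy g hg
    simp only [aeval_X] at hy'
    obtain ⟨x, rfl⟩ := exists_eq_pTwoTwoPoint y hy'.1 hy'.2
    have hcomp : (aeval (pTwoTwoPoint x) : _ →ₐ[ℂ] ℂ) = (aeval x).comp Φ := by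
      refine MvPolynomial.algHom_ext fun v => ?_
      rcases v with e | i
      · induction e with | _ i j
        simp [Φ, pTwoTwoPoint]
      · fin_cases i <;> simp [Φ, pTwoTwoPoint, skewMat_mulVec]
    rw [hcomp, AlgHom.comp_apply, show Φ f = 0 from hf, map_zero]
  rw [this]
  exact hprime

end PTwoTwoIrreducible

section Reducible

theorem skewMat_zero : skewMat (0 : Fin 3 → ℂ) = 0 := by
  ext i j
  fin_cases i <;> fin_cases j <;> simp [skewMat]

/-- The fibres over `t = 0` are reducible: the forms `u pᵢ` vanish on them. -/
theorem not_preirreducibleSpace_of_eq_zero (s : Sym2 (Fin 3) → ℂ) :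
    ¬ PreirreducibleSpace (projScheme (keyIdeal s 0)) := by
  have hev : ∀ P : KeyVar → ℂ, IsKeySolution (symMat s) 0 (fun i => P (KeyVar.p i)) (P .p4)
      (fun i => P (KeyVar.q i)) (P .r) (P .u) → ∀ h ∈ (keyIdeal s 0).toIdeal, eval P h = 0 := by
    intro P hP
    have hle := (keyIdeal_le_ker_iff s 0 (aeval P : _ →ₐ[ℂ] ℂ)).2 (by
      simp only [aeval_X]
      exact hP)
    exact fun h hh => hle hh
  have hsol := (keyIdeal_le_ker_iff s 0 (Ideal.Quotient.mkₐ ℂ (keyIdeal s 0).toIdeal)).1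
    (Ideal.Quotient.mkₐ_ker ℂ _).ge
  have hmem : ∀ i, X KeyVar.u * X (KeyVar.p i) ∈ (keyIdeal s 0).toIdeal := by
    intro i
    refine mem_of_mkₐ_eq_zero ?_
    have h0 : (fun i => algebraMap ℂ (MvPolynomial KeyVar ℂ ⧸ (keyIdeal s 0).toIdeal)
        ((0 : Fin 3 → ℂ) i)) = 0 := funext fun i => map_zero _
    have := congrFun hsol.smul i
    rw [h0] at this
    simpa only [Matrix.mulVec_zero, smul_zero, sub_zero, add_zero, Pi.smul_apply, smul_eq_mul,
      Pi.zero_apply, ← map_mul] using this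
  -- a point of the conic `S`, which gives a solution with `u = 0` and `p = v`
  obtain ⟨v, i, hvi, hv⟩ : ∃ (v : Fin 3 → ℂ) (i : Fin 3), v i ≠ 0 ∧ v ⬝ᵥ (symMat s *ᵥ v) = 0 := by
    by_cases h : s s(0, 0) = 0
    · exact ⟨![1, 0, 0], 0, one_ne_zero, by
        simp only [dotProduct_fin_three, mulVec_fin_three, symMat, Matrix.of_apply]
        simp [h]⟩
    · obtain ⟨d, hd⟩ := IsAlgClosed.exists_pow_nat_eq (s s(0, 1) ^ 2 - s s(0, 0) * s s(1, 1))
        zero_lt_two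
      refine ⟨![(d - s s(0, 1)) / s s(0, 0), 1, 0], 1, one_ne_zero, ?_⟩
      have hs : s s(1, 0) = s s(0, 1) := congrArg s Sym2.eq_swap
      simp only [dotProduct_fin_three, mulVec_fin_three, symMat, Matrix.of_apply, hs]
      simp
      field_simp
      linear_combination hd
  refine not_preirreducibleSpace_projScheme (keyIdeal s 0) one_pos one_pos (isHomogeneous_X ℂ _)
    (isHomogeneous_X ℂ _) (hmem i)
    (hev (keyFamily 0 0 0 0 1) ?_) (by simp) (hev (keyFamily v 0 0 0 0) ?_) (by simpa)
  · change IsKeySolution (symMat s) 0 0 0 0 0 1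
    constructor <;> simp [skewMat_zero]
  · change IsKeySolution (symMat s) 0 v 0 0 0 0
    constructor <;> simp [skewMat_zero, hv]

theorem not_preirreducibleSpace_of_symMat_eq_zero {s : Sym2 (Fin 3) → ℂ} (hs : symMat s = 0) :
    ¬ PreirreducibleSpace (projScheme (keyIdeal s ![1, 0, 0])) := by
  have hev : ∀ {p0 p1 p2 p4 q0 q1 q2 r u : ℂ}, _ →
      ∀ h ∈ (keyIdeal s ![1, 0, 0]).toIdeal,
        eval (keyFamily ![p0, p1, p2] p4 ![q0, q1, q2] r u) h = 0 := fun hP h hh =>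
    (keyIdeal_le_ker_iff_zero hs (aeval (keyFamily _ _ _ _ _) : _ →ₐ[ℂ] ℂ)
      (funext fun v => aeval_X _ v)).2 hP hh
  obtain ⟨-, ⟨h2, -, -⟩, -⟩ := (keyIdeal_le_ker_iff_zero hs _ (apply_X_eq_keyFamily
    (Ideal.Quotient.mkₐ ℂ (keyIdeal s ![1, 0, 0]).toIdeal))).1 (Ideal.Quotient.mkₐ_ker ℂ _).ge
  refine not_preirreducibleSpace_projScheme (keyIdeal s ![1, 0, 0]) one_pos one_pos
    (isHomogeneous_X ℂ .r) (isHomogeneous_X ℂ (KeyVar.p 0)) ?_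
    (hev (p0 := 0) (p1 := 0) (p2 := 0) (p4 := -1) (q0 := 0) (q1 := 0) (q2 := 0) (r := 1) (u := 1)
      ?_) (by simp)
    (hev (p0 := 1) (p1 := 0) (p2 := 0) (p4 := 0) (q0 := 0) (q1 := 0) (q2 := 0) (r := 0) (u := 0)
      ?_) (by simp)
  · refine mem_of_mkₐ_eq_zero ?_
    rw [map_mul]
    linear_combination h2
  · simp
  · simp

end Reducible

theorem not_preirreducibleSpace_of_rank_eq_zero {s : Sym2 (Fin 3) → ℂ} {t : Fin 3 → ℂ}
    (h : (matBSB s t).rank = 0) : ¬ PreirreducibleSpace (projScheme (keyIdeal s t)) := by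
  by_cases ht : t = 0
  · subst ht
    exact not_preirreducibleSpace_of_eq_zero s
  · rcases fibre_type_of_ne_zero s ht with ⟨-, h', -⟩ | ⟨-, h', -⟩ | ⟨-, -, s', hs', e⟩
    · omega
    · omega
    · obtain ⟨e⟩ := e.linEquiv.projEquiv.nonempty_iso
      exact fun h => not_preirreducibleSpace_of_symMat_eq_zero hs' (preirreducibleSpace_of_iso e h)

/-- The three kinds of fibres that are distinguished by smoothness and irreducibility. -/
theorem fibre_trichotomy (s : Sym2 (Fin 3) → ℂ) (t : Fin 3 → ℂ) :
    (tSt s t ≠ 0 ∧ (matBSB s t).rank = 2 ∧ IsP2P2 (keyIdeal s t).toIdeal) ∨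
    (tSt s t = 0 ∧ (matBSB s t).rank = 1 ∧ IsP22 (keyIdeal s t).toIdeal) ∨
    (tSt s t = 0 ∧ (matBSB s t).rank = 0) := by
  by_cases ht : t = 0
  · subst ht
    exact Or.inr (Or.inr ⟨by simp [tSt], by
      rw [matBSB, skewMat_zero, zero_mul, zero_mul, Matrix.rank_zero]⟩)
  · exact (fibre_type_of_ne_zero s ht).imp id (Or.imp id fun h => ⟨h.1, h.2.1⟩)

theorem isEmpty_iso_segreIdeal_pTwoTwoIdeal :
    IsEmpty (projOver (segreIdeal 3 3) ≅ projOver pTwoTwoIdeal) :=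
  ⟨fun e => not_smooth_pTwoTwoIdeal (smooth_of_iso e (smooth_segreIdeal 3 3))⟩

theorem nonempty_iso_segreIdeal_iff (s : Sym2 (Fin 3) → ℂ) (t : Fin 3 → ℂ) :
    Nonempty (rhoFiber s t ≅ projOver (segreIdeal 3 3)) ↔ tSt s t ≠ 0 := by
  obtain ⟨e⟩ := nonempty_rhoFiber_iso s t
  rcases fibre_trichotomy s t with ⟨h, -, h'⟩ | ⟨h, -, h'⟩ | ⟨h, h'⟩
  · exact iff_of_true (h'.nonempty_iso.map e.trans) h
  · obtain ⟨e'⟩ := h'.nonempty_iso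
    exact iff_of_false (fun ⟨f⟩ => isEmpty_iso_segreIdeal_pTwoTwoIdeal.false
      (f.symm ≪≫ e ≪≫ e')) (not_not.2 h)
  · refine iff_of_false (fun ⟨f⟩ => not_preirreducibleSpace_of_rank_eq_zero h'
      (preirreducibleSpace_of_iso (f.symm ≪≫ e) (preirreducibleSpace_projScheme _ ?_)))
      (not_not.2 h)
    rw [(isPrime_segreIdeal 3 3).radical]
    exact isPrime_segreIdeal 3 3

theorem nonempty_iso_pTwoTwoIdeal_iff (s : Sym2 (Fin 3) → ℂ) (t : Fin 3 → ℂ) :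
    Nonempty (rhoFiber s t ≅ projOver pTwoTwoIdeal) ↔ tSt s t = 0 ∧ matBSB s t ≠ 0 := by
  obtain ⟨e⟩ := nonempty_rhoFiber_iso s t
  rw [Ne, ← matrix_rank_eq_zero_iff]
  rcases fibre_trichotomy s t with ⟨h, -, h'⟩ | ⟨h, h₁, h'⟩ | ⟨-, h'⟩
  · obtain ⟨e'⟩ := h'.nonempty_iso
    exact iff_of_false (fun ⟨f⟩ => isEmpty_iso_segreIdeal_pTwoTwoIdeal.false
      (e'.symm ≪≫ e.symm ≪≫ f)) fun h'' => h h''.1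
  · exact iff_of_true (h'.nonempty_iso.map e.trans) ⟨h, by omega⟩
  · exact iff_of_false (fun ⟨f⟩ => not_preirreducibleSpace_of_rank_eq_zero h'
      (preirreducibleSpace_of_iso (f.symm ≪≫ e)
        (preirreducibleSpace_projScheme _ isPrime_radical_pTwoTwoIdeal))) fun h => h.2 h'

end

theorem proposition7p2 (s : Sym2 (Fin 3) → ℂ) (t : Fin 3 → ℂ) :
    -- the fibre over `(S, t)` is the subscheme of `ℙ⁸` cut out by the nine equations
    IsPullback (specialMap s t) (projStructure (keyIdeal s t)) rhoSigma (basePoint s t) ∧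
    -- fibres in case of `S ≠ 0` and `t ≠ 0`
    (symMat s ≠ 0 → t ≠ 0 →
      ((symMat s).rank = 3 →
        (tSt s t ≠ 0 → (matBSB s t).rank = 2 ∧ IsP2P2 (keyIdeal s t).toIdeal) ∧
        (tSt s t = 0 → (matBSB s t).rank = 1 ∧ IsP22 (keyIdeal s t).toIdeal)) ∧
      ((symMat s).rank = 2 →
        (tSt s t ≠ 0 → (matBSB s t).rank = 2 ∧ IsP2P2 (keyIdeal s t).toIdeal) ∧
        (tSt s t = 0 →
          ((matBSB s t).rank = 1 ∧ IsP22 (keyIdeal s t).toIdeal) ∨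
          ((matBSB s t).rank = 0 ∧ IsConeUnionQuadric (keyIdeal s t).toIdeal))) ∧
      ((symMat s).rank = 1 →
        tSt s t = 0 ∧
          (((matBSB s t).rank = 1 ∧ IsP22 (keyIdeal s t).toIdeal) ∨
          ((matBSB s t).rank = 0 ∧ IsConeUnionQuadric (keyIdeal s t).toIdeal)))) ∧
    -- fibres in case of `S ≠ 0` and `t = 0`
    (symMat s ≠ 0 → t = 0 →
      ((symMat s).rank = 3 → IsConeUnionQuadric (keyIdeal s t).toIdeal) ∧
      ((symMat s).rank = 2 → ∃ J₁ J₂ J₃ : Ideal (MvPolynomial KeyVar ℂ),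
        IsQuadric 4 J₁ ∧ IsQuadric 4 J₂ ∧ IsQuadric 4 J₃ ∧
        J₁ ≠ J₂ ∧ J₁ ≠ J₃ ∧ J₂ ≠ J₃ ∧ (keyIdeal s t).toIdeal = J₁ ⊓ J₂ ⊓ J₃) ∧
      ((symMat s).rank = 1 → ∃ J₁ J₂ D : Ideal (MvPolynomial KeyVar ℂ),
        IsQuadric 4 J₁ ∧ IsQuadric 4 J₂ ∧ J₁ ≠ J₂ ∧ IsDoubleStructure D J₂ ∧
        (keyIdeal s t).toIdeal = J₁ ⊓ D)) ∧
    -- fibres in case of `S = 0` and `t ≠ 0`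
    (symMat s = 0 → t ≠ 0 → ∃ J₁ J₂ : Ideal (MvPolynomial KeyVar ℂ),
      IsConeSegreSection J₁ ∧ IsSmoothQuadric 4 J₂ ∧ (keyIdeal s t).toIdeal = J₁ ⊓ J₂) ∧
    -- the fibre in case of `S = 0` and `t = 0`
    (symMat s = 0 → t = 0 → ∃ J₁ J₂ : Ideal (MvPolynomial KeyVar ℂ),
      J₁ = Ideal.span {X KeyVar.r, X KeyVar.u, ∑ i, X (KeyVar.p i) * X (KeyVar.q i)} ∧
      J₂ = Ideal.span {X (KeyVar.p 0), X (KeyVar.p 1), X (KeyVar.p 2),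
        X KeyVar.r ^ 2 + X KeyVar.p4 * X KeyVar.u} ∧
      IsQuadric 5 J₁ ∧ IsQuadric 4 J₂ ∧ (keyIdeal s t).toIdeal = J₁ ⊓ J₂) ∧
    -- the two irreducible types of fibres, up to isomorphism of schemes over `ℂ`
    (Nonempty (rhoFiber s t ≅ projOver (segreIdeal 3 3)) ↔ tSt s t ≠ 0) ∧
    (Nonempty (rhoFiber s t ≅ projOver pTwoTwoIdeal) ↔ tSt s t = 0 ∧ matBSB s t ≠ 0) := by
  refine ⟨isPullback_specialMap s t, fun _ ht => fibres_of_ne_zero ht, fun _ ht => ?_,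
    exists_decomposition_of_eq_zero_of_ne_zero, fun hs ht => ?_, nonempty_iso_segreIdeal_iff s t,
    nonempty_iso_pTwoTwoIdeal_iff s t⟩
  · subst ht
    exact ⟨isConeUnionQuadric_of_rank_eq_three, exists_decomposition_of_rank_eq_two,
      exists_decomposition_of_rank_eq_one⟩
  · subst ht
    exact exists_decomposition_of_rank_zero hs
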